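/- A \emph{factor} over a finite set $\mathbf{X}'$ of discrete variables (each with a finite non-empty set of values) maps each instantiation of $\mathbf{X}'$ to a non-negative rational number and is given by its table. Consider instances that consist of finitely many discrete variables $\mathbf{X}$, factors $f_1(\mathbf{X}_1),\ldots,f_n(\mathbf{X}_n)$ with $\mathbf{X}_i\subseteq\mathbf{X}$, and a rational number $k$; let $f = f_1\cdots f_n$ be the joint factor, $f(\mathbf{x})=\prod_i f_i(\mathbf{x}_i)$, where $\mathbf{x}_i$ is the restriction of $\mathbf{x}$ to $\mathbf{X}_i$. Instances are encoded as strings over a finite alphabet, with factors written as tables and all numbers written in binary. Consider the decision problems \begin{itemize} \item \textbf{D-MPE}: is there an instantiation $\mathbf{x}$ of $\mathbf{X}$ with $f(\mathbf{x})>k$? \item \textbf{D-PR}: is $\sum_{\mathbf{x}} f(\mathbf{x})>k$? \end{itemize} Then D-MPE is reducible to D-PR by a polynomial-time many-one reduction: there is a map $r$ on instances, computable in polynomial time by a Turing machine, such that an instance $I$ is a yes-instance of D-MPE if and only if $r(I)$ is a yes-instance of D-PR. Moreover, $r$ can be chosen so that $r(I)$ always consists of $\{0,1\}$-valued factors $g_1,\ldots,g_m$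 over binary variables which form a CNF (each $g_j$ is the indicator of a clause, i.e. it is $0$ at exactly one instantiation of its variables and $1$ at all others), together with the threshold $0$; thus $\sum g_1\cdots g_m>0$ if and only if $f(\mathbf{x})>k$ for some $\mathbf{x}$. -/

import Mathlib

open scoped NNRat

namespace FactorModel

/-! ### Factors and models -/

/-- An instantiation of discrete variables: variable `v` takes one of its `card v` values. -/
abbrev Instantiation {n : ℕ} (card : Fin n → ℕ) : Type := ∀ v, Fin (card v)

/-- A factor `f(X')` over a set `X'` of `arity` distinct variables among the `n` variables of a model
(listed by `scope`). It maps each instantiation of `X'` to a non-negative rational number. -/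
structure Factor {n : ℕ} (card : Fin n → ℕ) where
  arity : ℕ
  scope : Fin arity ↪ Fin n
  val : Instantiation (fun j => card (scope j)) → ℚ≥0

/-- The value of a factor at an instantiation of all the variables. -/
def Factor.eval {n : ℕ} {card : Fin n → ℕ} (f : Factor card) (x : Instantiation card) : ℚ≥0 :=
  f.val fun j => x (f.scope j)

/-- A graphical model: finitely many discrete variables, each with a non-empty finite set of values,
and a finite family of factors `f₁(X₁), …, fₘ(Xₘ)` over subsets of them. -/
structure Model where
  numVars : ℕ
  card : Fin numVars → ℕ
  card_pos : ∀ v, 0 < card v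
  factors : List (Factor card)

/-- The joint factor `f = f₁ ⋯ fₘ`. -/
def Model.joint (M : Model) (x : Instantiation M.card) : ℚ≥0 :=
  (M.factors.map fun f => f.eval x).prod

/-- An instance of the decision problems: a model and a rational number `k`. -/
structure Query where
  model : Model
  k : ℚ

/-- D-MPE: is there an instantiation `x` with `f(x) > k`? -/
def DMPE (Q : Query) : Prop :=
  ∃ x : Instantiation Q.model.card, (Q.model.joint x : ℚ) > Q.k

/-- D-PR: is `∑ₓ f(x) > k`? -/
def DPR (Q : Query) : Prop :=
  (∑ x : Instantiation Q.model.card, (Q.model.joint x : ℚ)) > Q.k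

/-! ### CNFs as models -/

/-- Over binary variables: `f` is the 0/1-valued factor of a clause on its variables, that is, of a
disjunction of one literal for each of them; exactly one row, `y₀`, falsifies the clause. -/
def Factor.IsClause {n : ℕ} {card : Fin n → ℕ} (f : Factor card) : Prop :=
  ∃ y₀ : Instantiation (fun j => card (f.scope j)), ∀ y, f.val y = if y = y₀ then 0 else 1

/-- All variables are binary and every factor is the 0/1-valued factor of a clause. -/
def Model.IsCNF (M : Model) : Prop :=
  (∀ v, M.card v = 2) ∧ ∀ f ∈ M.factors, f.IsClause

/-! ### Encoding of instances as strings -/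

/-- The alphabet. -/
inductive Sym
  | bit (b : Bool)
  | slash
  | minus
  | comma
  | semi
  deriving DecidableEq, Fintype

/-- Natural numbers in binary, least significant bit first. -/
def encNat (n : ℕ) : List Sym := n.bits.map Sym.bit

def encNNRat (q : ℚ≥0) : List Sym := encNat q.num ++ Sym.slash :: encNat q.den

def encRat (q : ℚ) : List Sym :=
  (if q < 0 then [Sym.minus] else []) ++ encNat q.num.natAbs ++ Sym.slash :: encNat q.den

/-- A list: each entry is followed by a comma, and the list is closed by a semicolon. -/
def encList {α : Type} (e : α → List Sym) (l : List α) : List Sym :=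
  l.flatMap (fun a => e a ++ [Sym.comma]) ++ [Sym.semi]

/-- The table of a factor: its values at all the instantiations of its variables, in mixed-radix
order (the first variable of the scope varies fastest). -/
def Factor.table {n : ℕ} {card : Fin n → ℕ} (f : Factor card) : List ℚ≥0 :=
  List.ofFn fun r => f.val (finPiFinEquiv.symm r)

/-- A factor is written as the list of its variables followed by its table. -/
def Factor.encode {n : ℕ} {card : Fin n → ℕ} (f : Factor card) : List Sym :=
  encList (fun v : Fin n => encNat v) (List.ofFn f.scope) ++ encList encNNRat f.table

/-- An instance is written as the number `k`, the list of the numbers of values of the variables,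
and the factors. -/
def Query.encode (Q : Query) : List Sym :=
  encRat Q.k ++ Sym.semi ::
    (encList encNat (List.ofFn Q.model.card) ++ Q.model.factors.flatMap Factor.encode)

/-! ### The encoding is injective -/

theorem append_cons_inj {s : Sym} {l₁ l₂ t₁ t₂ : List Sym} (h₁ : s ∉ l₁) (h₂ : s ∉ l₂)
    (h : l₁ ++ s :: t₁ = l₂ ++ s :: t₂) : l₁ = l₂ ∧ t₁ = t₂ := by
  induction l₁ generalizing l₂ with
  | nil =>
    cases l₂ with
    | nil => simpa using h
    | cons b l₂ => exact absurd (by rw [(List.cons.inj h).1]; simp) h₂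
  | cons a l₁ ih =>
    cases l₂ with
    | nil => exact absurd (by rw [(List.cons.inj h).1]; simp) h₁
    | cons b l₂ =>
      simp only [List.cons_append, List.cons.injEq] at h
      have := ih (l₂ := l₂) (List.not_mem_of_not_mem_cons h₁) (List.not_mem_of_not_mem_cons h₂) h.2
      exact ⟨by rw [h.1, this.1], this.2⟩

theorem encNat_injective : Function.Injective encNat := by
  intro m n h
  have : m.bits = n.bits := List.map_injective_iff.2 (fun a b h => by simpa using h) h
  have hm : ∀ k : ℕ, (k.bits).foldr (fun b r => Nat.bit b r) 0 = k := by
    intro k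
    induction k using Nat.binaryRec' with
    | zero => simp
    | bit b n hn ih => rw [Nat.bits_append_bit n b hn]; simp [ih]
  rw [← hm m, ← hm n, this]

theorem notMem_encNat {s : Sym} (hs : ∀ b, s ≠ Sym.bit b) (n : ℕ) : s ∉ encNat n := by
  simp only [encNat, List.mem_map, not_exists, not_and]
  exact fun b _ h => hs b h.symm

theorem encNNRat_injective : Function.Injective encNNRat := by
  intro p q h
  have := append_cons_inj (notMem_encNat (by simp) _) (notMem_encNat (by simp) _) h
  exact NNRat.ext_num_den (encNat_injective this.1) (encNat_injective this.2)

theorem encRat_injective : Function.Injective encRat := by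
  have key : ∀ q : ℚ, Sym.slash ∉ (if q < 0 then [Sym.minus] else []) ++ encNat q.num.natAbs := by
    intro q
    have := notMem_encNat (s := Sym.slash) (by simp) q.num.natAbs
    split_ifs <;> simp [this]
  intro p q h
  obtain ⟨h₁, h₂⟩ := append_cons_inj (key p) (key q) h
  have hm := notMem_encNat (s := Sym.minus) (by simp)
  refine Rat.ext ?_ (encNat_injective h₂)
  have hp := @Rat.num_neg p
  have hq := @Rat.num_neg q
  split_ifs at h₁ with a b b
  · have := encNat_injective (by simpa using h₁)
    have := hp.2 a
    have := hq.2 b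
    omega
  · exact absurd (by rw [List.nil_append] at h₁; rw [← h₁]; simp) (hm q.num.natAbs)
  · exact absurd (by rw [List.nil_append] at h₁; rw [h₁]; simp) (hm p.num.natAbs)
  · have := encNat_injective (by simpa using h₁)
    have := hp.not.2 a
    have := hq.not.2 b
    omega

theorem encList_append_inj {α : Type} {e : α → List Sym} (he : Function.Injective e)
    (hc : ∀ a, Sym.comma ∉ e a) (hs : ∀ a, Sym.semi ∉ e a) {l₁ l₂ : List α} {t₁ t₂ : List Sym}
    (h : encList e l₁ ++ t₁ = encList e l₂ ++ t₂) : l₁ = l₂ ∧ t₁ = t₂ := by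
  have ne : ∀ (a : α) (u v : List Sym), e a ++ Sym.comma :: u ≠ Sym.semi :: v := by
    intro a u v h
    cases hea : e a with
    | nil => simp [hea] at h
    | cons b l =>
      have := hs a
      simp_all
  induction l₁ generalizing l₂ with
  | nil =>
    cases l₂ with
    | nil => simpa [encList] using h
    | cons b l₂ => exact absurd h.symm (by simpa [encList] using ne b _ _)
  | cons a l₁ ih =>
    cases l₂ with
    | nil => exact absurd h (by simpa [encList] using ne a _ _)
    | cons b l₂ =>
      have h' : e a ++ Sym.comma :: (encList e l₁ ++ t₁)
          = e b ++ Sym.comma :: (encList e l₂ ++ t₂) := by simpa [encList] using h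
      obtain ⟨h₁, h₂⟩ := append_cons_inj (hc a) (hc b) h'
      obtain ⟨h₃, h₄⟩ := ih h₂
      exact ⟨by rw [he h₁, h₃], h₄⟩

theorem Factor.encode_append_inj {n : ℕ} {card : Fin n → ℕ} {f g : Factor card}
    {t₁ t₂ : List Sym} (h : f.encode ++ t₁ = g.encode ++ t₂) : f = g ∧ t₁ = t₂ := by
  simp only [Factor.encode, List.append_assoc] at h
  obtain ⟨h₁, h₂⟩ := encList_append_inj (fun a b h => Fin.ext (encNat_injective h))
    (fun a => notMem_encNat (by simp) _) (fun a => notMem_encNat (by simp) _) h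
  have hr : ∀ s, (∀ b, s ≠ Sym.bit b) → s ≠ Sym.slash → ∀ q : ℚ≥0, s ∉ encNNRat q := by
    intro s hs hs' q
    simp [encNNRat, notMem_encNat hs, hs']
  obtain ⟨h₃, h₄⟩ := encList_append_inj encNNRat_injective (hr _ (by simp) (by simp))
    (hr _ (by simp) (by simp)) h₂
  refine ⟨?_, h₄⟩
  obtain ⟨a, s, u⟩ := f
  obtain ⟨b, s', u'⟩ := g
  obtain rfl : a = b := by simpa using congrArg List.length h₁
  obtain rfl : s = s' := DFunLike.coe_injective (List.ofFn_injective h₁)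
  congr 1
  funext y
  have := congrFun (List.ofFn_injective h₃) (finPiFinEquiv y)
  simpa using this

theorem Query.encode_injective : Function.Injective Query.encode := by
  rintro ⟨⟨n, c, hc, fs⟩, k⟩ ⟨⟨n', c', hc', fs'⟩, k'⟩ h
  have hr : ∀ q : ℚ, Sym.semi ∉ encRat q := by
    intro q
    have := notMem_encNat (s := Sym.semi) (by simp)
    unfold encRat
    split_ifs <;> simp [this]
  obtain ⟨h₁, h₂⟩ := append_cons_inj (hr _) (hr _) h
  obtain rfl := encRat_injective h₁
  obtain ⟨h₃, h₄⟩ := encList_append_inj encNat_injective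
    (fun a => notMem_encNat (by simp) _) (fun a => notMem_encNat (by simp) _) h₂
  obtain rfl : n = n' := by simpa using congrArg List.length h₃
  obtain rfl : c = c' := List.ofFn_injective h₃
  congr 2
  have ne : ∀ f : Factor c, f.encode ≠ [] := by
    intro f; simp [Factor.encode, encList]
  simp only at h₄
  clear h h₁ h₂ h₃
  induction fs generalizing fs' with
  | nil =>
    cases fs' with
    | nil => rfl
    | cons g fs' => simp [ne g] at h₄
  | cons f fs ih =>
    cases fs' with
    | nil => simp [ne f] at h₄
    | cons g fs' =>
      obtain ⟨rfl, h₅⟩ := Factor.encode_append_inj (by simpa using h₄)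
      rw [ih fs' h₅]

/-! ### Polynomial-time reductions -/

/-- `r` is a polynomial-time many-one reduction from `P` to `P'`, where instances are written as
strings by `e` and `e'`: a Turing machine computes `r` in polynomial time, and `r` preserves yes
and no instances. -/
def IsPolyTimeReduction {α β Γ Γ' : Type} (e : α → List Γ) (e' : β → List Γ')
    (P : α → Prop) (P' : β → Prop) (r : α → β) : Prop :=
  Nonempty (Turing.TM2ComputableInPolyTime e e' r) ∧ ∀ a, P a ↔ P' (r a)

end FactorModel

/-! The argument is the Cook–Levin theorem in the style of Fagin. "Some instantiation has f(x) > k"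
is expressed by a fixed finite set of universal clauses about the positions of the input string
(`scanTheory`): relations satisfying the clauses exist if and only if the instance is a yes-instance
(`exists_structure_iff`, `dmpe_iff_describes`). Replacing the variables of the clauses by numbers
below a power of two that is linear in the input length gives a CNF with a propositional variable
for each ground atom. A sum of products of 0/1-valued clause factors is positive exactly when the
CNF is satisfiable (`dpr_query`).

The relations describe one pass over the encoding for a guessed instantiation. For k ≥ 0 the scan
maintains x = den(k) · ∏ num and y = |num(k)| · ∏ den over the table entries selected so far, so
that at the end y < x means f(x) > k (`Query.exists_path`). For k < 0 every instance is a
yes-instance, and the scan stops in a mode without constraints. Tables are written out in full, so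
strides and row numbers are at most the input length and can be elements of the domain. The products
are exponentially large, but have linearly many digits (`reg_run_le`); they are described digit by
digit, with relations for the carries.

The rules only force atoms to be true; nothing says that a relation is functional. This suffices for
soundness: along the scan the correct facts are forced (`knows_step`), and a rule with empty head
then excludes x ≤ y (`lt_of_knows`). The only guess is a disjunctive rule that walks up the possible
values of a variable (`exists_choice`). Conversely, an actual successful scan interprets all the
relations and satisfies all the rules (`Env.Path.describes`).

The reduction runs in polynomial time because the theory is fixed: grounding it amounts to a fixed
number of nested loops over binary counters of logarithmic width. It is written in a small stack
language whose steps are single steps of a Turing machine (`Run.tm2ComputableInPolyTime`,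
`exec_program`). One obstacle is that the scope of a factor must consist of distinct variables,
whereas a ground clause may repeat an atom. So every relation is split into copies, one for each
place in a clause, and two-literal clauses make the copies equivalent
(`exists_structure_linearize`). -/

namespace FactorModel

/-! ### A structured programming language on stacks -/

/-- Programs on stacks indexed by `K` with symbols in `Γ`: `case` pops a stack and branches on the
result; `loop` pops a stack and runs its body, until the stack is empty. -/
inductive Cmd (K Γ : Type)
  | skip
  | push (k : K) (a : Γ)
  | seq (c d : Cmd K Γ)
  | case (k : K) (f : Option Γ → Cmd K Γ)
  | loop (k : K) (f : Γ → Cmd K Γ)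

namespace Cmd

variable {K Γ : Type}

/-- `Run c s t s'`: started on the stacks `s`, the program `c` ends with the stacks `s'` after `t`
steps. -/
inductive Run [DecidableEq K] : Cmd K Γ → (K → List Γ) → ℕ → (K → List Γ) → Prop
  | skip (s) : Run skip s 1 s
  | push (k a s) : Run (push k a) s 1 (Function.update s k (a :: s k))
  | seq {c d s t s' t' u} : Run c s t s' → Run d s' t' u → Run (seq c d) s (t + t') u
  | case {k f s t s'} : Run (f (s k).head?) (Function.update s k (s k).tail) t s' →
      Run (case k f) s (t + 1) s'
  | loop_nil {k f s} : s k = [] → Run (loop k f) s 1 s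
  | loop_cons {k f s a l t s' t' u} : s k = a :: l → Run (f a) (Function.update s k l) t s' →
      Run (loop k f) s' t' u → Run (loop k f) s (t + t' + 1) u

/-- The program points of a program. -/
def Lab : Cmd K Γ → Type
  | skip => Unit
  | push _ _ => Unit
  | seq c d => c.Lab ⊕ d.Lab
  | case _ f => Option (Σ o, (f o).Lab)
  | loop _ f => Option (Σ a, (f a).Lab)

theorem finite_lab [Finite Γ] : ∀ c : Cmd K Γ, Finite c.Lab
  | skip => inferInstanceAs (Finite Unit)
  | push _ _ => inferInstanceAs (Finite Unit)
  | seq c d => by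
    have := finite_lab c
    have := finite_lab d
    exact inferInstanceAs (Finite (c.Lab ⊕ d.Lab))
  | case _ f => by
    have := fun o => finite_lab (f o)
    exact inferInstanceAs (Finite (Option (Σ o, (f o).Lab)))
  | loop _ f => by
    have := fun o => finite_lab (f o)
    exact inferInstanceAs (Finite (Option (Σ o, (f o).Lab)))

/-- The first program point. -/
def entry : ∀ c : Cmd K Γ, c.Lab
  | skip => ()
  | push _ _ => ()
  | seq c _ => Sum.inl c.entry
  | case _ _ => none
  | loop _ _ => none

/-- The statement at a program point, when the program points are placed among the labels `Λ` by
`emb` and the program is left to the label `ex`. -/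
def code {Λ : Type} : ∀ c : Cmd K Γ, (c.Lab → Λ) → Λ → c.Lab →
    Turing.TM2.Stmt (fun _ : K => Γ) Λ (Option Γ)
  | skip, _, ex, _ => .goto fun _ => ex
  | push k a, _, ex, _ => .push k (fun _ => a) (.goto fun _ => ex)
  | seq c d, emb, _, Sum.inl l => c.code (fun l => emb (Sum.inl l)) (emb (Sum.inr d.entry)) l
  | seq _ d, emb, ex, Sum.inr l => d.code (fun l => emb (Sum.inr l)) ex l
  | case k f, emb, _, none => .pop k (fun _ o => o) (.goto fun o => emb (some ⟨o, (f o).entry⟩))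
  | case _ f, emb, ex, some ⟨o, l⟩ => (f o).code (fun l => emb (some ⟨o, l⟩)) ex l
  | loop k f, emb, ex, none => .pop k (fun _ o => o)
      (.goto fun o => o.elim ex fun a => emb (some ⟨a, (f a).entry⟩))
  | loop _ f, emb, _, some ⟨a, l⟩ => (f a).code (fun l => emb (some ⟨a, l⟩)) (emb none) l

/-- Every counted step of `Run` is exactly one machine step. The embedding `emb` and the exit label
`ex` are arbitrary because a subprogram sits inside a larger machine: the first half of a sequence
exits to the entry of the second, and a loop body exits to the head of its loop. -/
theorem Run.iterate_step [DecidableEq K] {c : Cmd K Γ} {s s' : K → List Γ} {t : ℕ}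
    (h : Run c s t s') : ∀ {Λ : Type} (M : Λ → Turing.TM2.Stmt (fun _ : K => Γ) Λ (Option Γ))
    (emb : c.Lab → Λ) (ex : Λ), (∀ l, M (emb l) = c.code emb ex l) → ∀ v, ∃ v',
    (flip bind (Turing.TM2.step M))^[t] (some ⟨some (emb c.entry), v, s⟩)
      = some ⟨some ex, v', s'⟩ := by
  induction h with
  | skip s =>
    intro Λ M emb ex hM v
    refine ⟨v, ?_⟩
    have := hM ()
    simp only [Function.iterate_one, flip, bind, Option.bind_some, Turing.TM2.step, entry]
    rw [this]
    simp [code]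
  | push k a s =>
    intro Λ M emb ex hM v
    refine ⟨v, ?_⟩
    have := hM ()
    simp only [Function.iterate_one, flip, bind, Option.bind_some, Turing.TM2.step, entry]
    rw [this]
    simp [code]
  | @seq c d s t s' t' u _ _ ih ih' =>
    intro Λ M emb ex hM v
    obtain ⟨v', hv⟩ := ih M (fun l => emb (Sum.inl l)) (emb (Sum.inr d.entry))
      (fun l => hM (Sum.inl l)) v
    obtain ⟨v'', hv'⟩ := ih' M (fun l => emb (Sum.inr l)) ex (fun l => hM (Sum.inr l)) v'
    refine ⟨v'', ?_⟩
    rw [add_comm, Function.iterate_add_apply]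
    exact (congrArg _ hv).trans hv'
  | @case k f s t s' _ ih =>
    intro Λ M emb ex hM v
    obtain ⟨v', hv⟩ := ih M (fun l => emb (some ⟨_, l⟩)) ex (fun l => hM (some ⟨_, l⟩)) (s k).head?
    refine ⟨v', ?_⟩
    rw [Function.iterate_succ_apply, ← hv]
    have := hM none
    simp only [flip, bind, Option.bind_some, Turing.TM2.step, entry]
    rw [this]
    simp [code]
  | @loop_nil k f s hk =>
    intro Λ M emb ex hM v
    refine ⟨none, ?_⟩
    have := hM none
    simp only [Function.iterate_one, flip, bind, Option.bind_some, Turing.TM2.step, entry]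
    rw [this]
    -- Popping an empty stack changes nothing, so testing for the end of a loop is harmless.
    have hs : Function.update s k [] = s := by rw [← hk, Function.update_eq_self]
    simp [code, hk, hs]
  | @loop_cons k f s a l t s' t' u hk _ _ ih ih' =>
    intro Λ M emb ex hM v
    obtain ⟨v', hv⟩ := ih M (fun l => emb (some ⟨_, l⟩)) (emb none) (fun l => hM (some ⟨_, l⟩))
      (some a)
    obtain ⟨v'', hv'⟩ := ih' M emb ex hM v'
    refine ⟨v'', ?_⟩
    rw [Function.iterate_succ_apply, add_comm, Function.iterate_add_apply, ← hv']
    change _ = (flip bind (Turing.TM2.step M))^[t'] (some ⟨some (emb none), v', s'⟩)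
    rw [← hv]
    have := hM none
    simp only [flip, bind, Option.bind_some, Turing.TM2.step, entry]
    rw [this]
    simp [code, hk]

/-- The machine that runs a program. -/
noncomputable def machine [DecidableEq K] [Fintype K] [Fintype Γ] (c : Cmd K Γ) (kin kout : K) :
    Turing.FinTM2 :=
  haveI := c.finite_lab
  { K := K
    k₀ := kin
    k₁ := kout
    Γ := fun _ => Γ
    Λ := Option c.Lab
    main := some c.entry
    ΛFin := Fintype.ofFinite _
    σ := Option Γ
    initialState := none
    Γk₀Fin := inferInstanceAs (Fintype Γ)
    m := fun l => match l with
      | none => .load (fun _ => none) .halt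
      | some l => c.code some none l }

/-- The machine halts through an extra label that clears the symbol register, as the prescribed
final configuration demands; this is the `+ 1` in the time bound. -/
theorem Run.tm2ComputableInPolyTime [DecidableEq K] [Fintype K] [Fintype Γ] {α β : Type}
    {e : α → List Γ} {e' : β → List Γ} {f : α → β} {c : Cmd K Γ} (kin kout : K)
    (p : Polynomial ℕ)
    (h : ∀ a, ∃ t ≤ p.eval (e a).length, Run c (Function.update (fun _ => []) kin (e a)) t
      (Function.update (fun _ => []) kout (e' (f a)))) :
    Nonempty (Turing.TM2ComputableInPolyTime e e' f) := by
  refine ⟨{ tm := c.machine kin kout, inputAlphabet := Equiv.refl Γ, outputAlphabet := Equiv.refl Γ,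
            time := p + 1, outputsFun := fun a => Classical.choice ?_ }⟩
  obtain ⟨t, ht, hr⟩ := h a
  obtain ⟨v, hv⟩ := hr.iterate_step (c.machine kin kout).m some none (fun l => rfl) none
  refine ⟨⟨⟨t + 1, ?_⟩, by simpa using ht⟩⟩
  rw [Function.iterate_succ_apply']
  have hstk : ∀ (k₀ : K) (l : List Γ) (k : K),
      (dite (k = k₀) (fun _ => List.map (Equiv.refl Γ).invFun l) fun _ => [])
        = Function.update (fun _ => []) k₀ l k := by
    intro k₀ l k
    by_cases hk : k = k₀
    · subst hk
      simp
    · simp [hk]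
  have hi : Turing.initList (c.machine kin kout) (List.map (Equiv.refl Γ).invFun (e a))
      = ⟨some (some c.entry), none, Function.update (fun _ => []) kin (e a)⟩ :=
    congrArg (Turing.TM2.Cfg.mk _ _) (funext (hstk kin (e a)))
  have ho : Turing.haltList (c.machine kin kout) (List.map (Equiv.refl Γ).invFun (e' (f a)))
      = ⟨none, none, Function.update (fun _ => []) kout (e' (f a))⟩ :=
    congrArg (Turing.TM2.Cfg.mk _ _) (funext (hstk kout (e' (f a))))
  refine (congrArg _ ((congrArg _ (congrArg some hi)).trans hv)).trans ?_
  exact congrArg some ho.symm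

end Cmd
end FactorModel

namespace FactorModel

/-! ### Stores of the grounding program -/

/-- The stacks of the grounding program: input, scratch, output (in reverse), result, flag, and
`m` counters. -/
inductive Stk (m : ℕ)
  | inp
  | tmp
  | out
  | res
  | flag
  | x (i : Fin m)
  deriving DecidableEq, Fintype

/-- The contents of the stacks; `out` is the text written so far. -/
structure Store (m : ℕ) where
  inp : List Sym := []
  tmp : List Sym := []
  out : List Sym := []
  res : List Sym := []
  flag : List Sym := []
  x : Fin m → List Sym := fun _ => []

namespace Store

variable {m : ℕ}

/-- A push puts the newest symbol on top, so the output stack is the reverse of the text in writing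
order. -/
def stk (S : Store m) : Stk m → List Sym
  | .inp => S.inp
  | .tmp => S.tmp
  | .out => S.out.reverse
  | .res => S.res
  | .flag => S.flag
  | .x i => S.x i

theorem update_inp (S : Store m) (l : List Sym) :
    Function.update S.stk .inp l = { S with inp := l }.stk := by
  funext j; cases j <;> simp [stk]

theorem update_tmp (S : Store m) (l : List Sym) :
    Function.update S.stk .tmp l = { S with tmp := l }.stk := by
  funext j; cases j <;> simp [stk]

theorem update_out (S : Store m) (l : List Sym) :
    Function.update S.stk .out l = { S with out := l.reverse }.stk := by
  funext j; cases j <;> simp [stk]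

theorem update_res (S : Store m) (l : List Sym) :
    Function.update S.stk .res l = { S with res := l }.stk := by
  funext j; cases j <;> simp [stk]

theorem update_flag (S : Store m) (l : List Sym) :
    Function.update S.stk .flag l = { S with flag := l }.stk := by
  funext j; cases j <;> simp [stk]

theorem update_x (S : Store m) (i : Fin m) (l : List Sym) :
    Function.update S.stk (.x i) l = { S with x := Function.update S.x i l }.stk := by
  funext j
  cases j with
  | x j => by_cases h : j = i <;> simp [stk, Function.update, h]
  | _ => simp [stk]

end Store

open Cmd

variable {m : ℕ}

/-- Started on the store `S`, the program `c` ends with the store `S'` after at most `T` steps. -/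
def Exec (c : Cmd (Stk m) Sym) (S : Store m) (T : ℕ) (S' : Store m) : Prop :=
  ∃ t ≤ T, Run c S.stk t S'.stk

namespace Exec

variable {c d : Cmd (Stk m) Sym} {S S' S'' : Store m} {T T' : ℕ}

theorem mono (h : Exec c S T S') (hT : T ≤ T') : Exec c S T' S' := by
  obtain ⟨t, ht, hr⟩ := h
  exact ⟨t, ht.trans hT, hr⟩

theorem congr (h : Exec c S T S') (e : S' = S'') : Exec c S T S'' := e ▸ h

theorem skip : Exec .skip S 1 S := ⟨1, le_rfl, .skip _⟩

theorem seq (h : Exec c S T S') (h' : Exec d S' T' S'') : Exec (.seq c d) S (T + T') S'' := by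
  obtain ⟨t, ht, hr⟩ := h
  obtain ⟨t', ht', hr'⟩ := h'
  exact ⟨_, add_le_add ht ht', hr.seq hr'⟩

theorem push_tmp (a : Sym) : Exec (.push .tmp a) S 1 { S with tmp := a :: S.tmp } :=
  ⟨1, le_rfl, by have h := Run.push .tmp a S.stk; rwa [Store.update_tmp] at h⟩

theorem push_inp (a : Sym) : Exec (.push .inp a) S 1 { S with inp := a :: S.inp } :=
  ⟨1, le_rfl, by have h := Run.push .inp a S.stk; rwa [Store.update_inp] at h⟩

theorem push_res (a : Sym) : Exec (.push .res a) S 1 { S with res := a :: S.res } :=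
  ⟨1, le_rfl, by have h := Run.push .res a S.stk; rwa [Store.update_res] at h⟩

theorem push_flag (a : Sym) : Exec (.push .flag a) S 1 { S with flag := a :: S.flag } :=
  ⟨1, le_rfl, by have h := Run.push .flag a S.stk; rwa [Store.update_flag] at h⟩

theorem push_out (a : Sym) : Exec (.push .out a) S 1 { S with out := S.out ++ [a] } := by
  have h := Run.push .out a S.stk
  rw [Store.update_out] at h
  exact ⟨1, le_rfl, by simpa [Store.stk] using h⟩

theorem push_x (i : Fin m) (a : Sym) :
    Exec (.push (.x i) a) S 1 { S with x := Function.update S.x i (a :: S.x i) } :=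
  ⟨1, le_rfl, by have h := Run.push (.x i) a S.stk; rwa [Store.update_x] at h⟩

theorem case_flag {f : Option Sym → Cmd (Stk m) Sym}
    (h : Exec (f S.flag.head?) { S with flag := S.flag.tail } T S') :
    Exec (.case .flag f) S (T + 1) S' := by
  obtain ⟨t, ht, hr⟩ := h
  exact ⟨t + 1, by omega, .case (by rw [Store.update_flag]; exact hr)⟩

/-- The rule for loops: `st a l` is the store when the value `a` has been computed and the symbols
`l` are still to be read. -/
theorem loop {α : Type} {k : Stk m} {f : Sym → Cmd (Stk m) Sym} (st : α → List Sym → Store m)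
    (next : α → Sym → α) (P : α → List Sym → Prop) (hk : ∀ a l, (st a l).stk k = l)
    (hpop : ∀ a x l, Function.update (st a (x :: l)).stk k l = (st a l).stk)
    (hbody : ∀ a x l, P a (x :: l) → Exec (f x) (st a l) T (st (next a x) l) ∧ P (next a x) l) :
    ∀ l a, P a l → Exec (.loop k f) (st a l) (l.length * (T + 1) + 1) (st (l.foldl next a) []) := by
  intro l
  induction l with
  | nil => exact fun a _ => ⟨1, by simp, .loop_nil (hk a [])⟩
  | cons x l ih =>
    intro a ha
    obtain ⟨⟨t, ht, hr⟩, hP⟩ := hbody a x l ha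
    obtain ⟨t', ht', hr'⟩ := ih _ hP
    refine ⟨t + t' + 1, ?_, .loop_cons (hk a (x :: l)) (by rw [hpop]; exact hr) hr'⟩
    rw [List.length_cons, add_mul]
    omega

end Exec

/-! ### Basic programs -/

/-- The `w` lowest bits of `v`, least significant bit first. -/
def binary : ℕ → ℕ → List Bool
  | 0, _ => []
  | w + 1, v => decide (v % 2 = 1) :: binary w (v / 2)

@[simp]
theorem length_binary (w v : ℕ) : (binary w v).length = w := by
  induction w generalizing v with
  | zero => rfl
  | succ w ih => simp [binary, ih]

theorem binary_zero (w : ℕ) : binary w 0 = List.replicate w false := by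
  induction w with
  | zero => rfl
  | succ w ih => simp [binary, ih, List.replicate_succ]

/-- The content of a counter. -/
def symBinary (w v : ℕ) : List Sym := (binary w v).map Sym.bit

@[simp]
theorem length_symBinary (w v : ℕ) : (symBinary w v).length = w := by simp [symBinary]

theorem symBinary_zero (w : ℕ) : symBinary w 0 = List.replicate w (Sym.bit false) := by
  simp [symBinary, binary_zero]

/-- Write a string. -/
def emit (l : List Sym) : Cmd (Stk m) Sym := l.foldr (fun a c => .seq (.push .out a) c) .skip

theorem exec_emit (l : List Sym) (S : Store m) :
    Exec (emit l) S (l.length + 1) { S with out := S.out ++ l } := by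
  induction l generalizing S with
  | nil => rw [List.append_nil]; exact Exec.skip
  | cons a l ih =>
    have := (Exec.push_out (S := S) a).seq (ih _)
    simp only [List.append_assoc, List.singleton_append] at this
    exact this.mono (by simp; omega)

/-- Move the scratch stack to a counter. -/
def restore (i : Fin m) : Cmd (Stk m) Sym := .loop .tmp fun a => .push (.x i) a

/-- Popping a counter onto the scratch stack reverses its digits; this move reverses them back. -/
theorem exec_restore (i : Fin m) (S : Store m) :
    Exec (restore i) S (2 * S.tmp.length + 1)
      { S with tmp := [], x := Function.update S.x i (S.tmp.reverse ++ S.x i) } := by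
  have h := Exec.loop (k := .tmp) (f := fun a => .push (.x i) a) (T := 1)
    (fun (y : List Sym) l => { S with tmp := l, x := Function.update S.x i y }) (fun y a => a :: y)
    (fun _ _ => True) (fun _ _ => rfl) (fun _ _ _ => Store.update_tmp _ _)
    (fun y a l _ => ⟨by
      have := Exec.push_x (S := { S with tmp := l, x := Function.update S.x i y }) i a
      simpa using this, trivial⟩) S.tmp (S.x i) trivial
  have e : ∀ (l y : List Sym), l.foldl (fun y a => a :: y) y = l.reverse ++ y := by
    intro l
    induction l with
    | nil => simp
    | cons a l ih => intro y; simp [ih]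
  rw [e] at h
  simp only [Function.update_eq_self] at h
  exact h.mono (by omega)

/-- Write the content of a counter. -/
def emitField (i : Fin m) : Cmd (Stk m) Sym :=
  .seq (.loop (.x i) fun a => .seq (.push .tmp a) (.push .out a)) (restore i)

theorem exec_emitField (i : Fin m) (S : Store m) (h : S.tmp = []) :
    Exec (emitField i) S (5 * (S.x i).length + 2) { S with out := S.out ++ S.x i } := by
  have h₁ := Exec.loop (k := .x i) (f := fun a => .seq (.push .tmp a) (.push .out a)) (T := 2)
    (fun (y : List Sym) l => { S with
      x := Function.update S.x i l, tmp := y.reverse, out := S.out ++ y })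
    (fun y a => y ++ [a])
    (fun _ _ => True) (fun _ _ => by simp [Store.stk])
    (fun _ _ _ => by rw [Store.update_x]; simp)
    (fun y a l _ => ⟨by
      have := (Exec.push_tmp (S := { S with
        x := Function.update S.x i l, tmp := y.reverse, out := S.out ++ y }) a).seq
        (Exec.push_out a)
      simpa using this, trivial⟩) (S.x i) [] trivial
  have e : ∀ (l y : List Sym), l.foldl (fun y a => y ++ [a]) y = y ++ l := by
    intro l
    induction l with
    | nil => simp
    | cons a l ih => intro y; simp [ih]
  rw [e] at h₁
  have h₂ := h₁.seq (exec_restore i _)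
  simp only [Function.update_eq_self, List.reverse_nil, List.append_nil, List.nil_append,
    List.length_reverse, List.reverse_reverse, Function.update_self, Function.update_idem] at h₂
  obtain ⟨inp, tmp, out, res, flag, x⟩ := S
  obtain rfl : tmp = [] := h
  exact h₂.mono (by simp; omega)

/-- Increment a counter, without the final move from the scratch stack. The flag is the carry. -/
def incBody (a : Sym) : Option Sym → Cmd (Stk m) Sym
  | none => .push .tmp a
  | some _ => if a = Sym.bit true then .seq (.push .tmp (Sym.bit false)) (.push .flag (Sym.bit true))
      else .push .tmp (Sym.bit true)

/-- Increment a counter. The flag is set if the counter overflows. -/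
def inc (i : Fin m) : Cmd (Stk m) Sym :=
  .seq (.push .flag (Sym.bit true))
    (.seq (.loop (.x i) fun a => .case .flag (incBody a)) (restore i))

/-- A carry is represented by the presence of a symbol on the flag stack. -/
def carryFlag (c : Bool) : List Sym := if c then [Sym.bit true] else []

/-- One digit of a ripple-carry increment: the pair holds the digits already produced, in reverse,
and the carry. -/
def incStep (y : List Sym × Bool) (a : Sym) : List Sym × Bool :=
  if y.2 then (if a = Sym.bit true then (Sym.bit false :: y.1, true) else (Sym.bit true :: y.1, false))
    else (a :: y.1, false)

/-- Induction on the width, splitting off the lowest digit: its carry is added to `v / 2`. The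
outgoing carry is overflow of the truncated value, which is why it is stated with `v % 2 ^ w`. -/
theorem foldl_incStep (w v : ℕ) (y : List Sym) (c : Bool) :
    (symBinary w v).foldl incStep (y, c)
      = ((symBinary w (v + c.toNat)).reverse ++ y, decide (2 ^ w ≤ v % 2 ^ w + c.toNat)) := by
  induction w generalizing v y c with
  | zero => cases c <;> simp [symBinary, binary, Nat.mod_one]
  | succ w ih =>
    have hm : v % 2 ^ (w + 1) = v % 2 + 2 * (v / 2 % 2 ^ w) := by
      rw [pow_succ', Nat.mod_mul]
    have hp : 2 ^ (w + 1) = 2 * 2 ^ w := pow_succ' 2 w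
    have hs : ∀ u, symBinary (w + 1) u = Sym.bit (decide (u % 2 = 1)) :: symBinary w (u / 2) :=
      fun u => rfl
    rw [hs, hs, List.foldl_cons]
    cases c with
    | false =>
      have : incStep (y, false) (Sym.bit (decide (v % 2 = 1)))
        = (Sym.bit (decide (v % 2 = 1)) :: y, false) := rfl
      rw [this, ih]
      simp only [Bool.toNat_false, add_zero, List.reverse_cons, List.append_assoc,
        List.singleton_append, Prod.mk.injEq, true_and, decide_eq_decide]
      have h₁ := Nat.mod_lt v (show 0 < 2 ^ (w + 1) by positivity)
      have h₂ := Nat.mod_lt (v / 2) (show 0 < 2 ^ w by positivity)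
      omega
    | true =>
      rcases Nat.mod_two_eq_zero_or_one v with h | h
      · have : incStep (y, true) (Sym.bit (decide (v % 2 = 1)))
          = (Sym.bit true :: y, false) := by simp [incStep, h]
        rw [this, ih]
        have e₁ : (v + 1) / 2 = v / 2 := by omega
        have e₂ : (v + 1) % 2 = 1 := by omega
        have h₂ := Nat.mod_lt (v / 2) (show 0 < 2 ^ w by positivity)
        simp only [Bool.toNat_false, add_zero, Bool.toNat_true, e₁, e₂, List.reverse_cons,
          List.append_assoc, List.singleton_append, decide_true, Prod.mk.injEq, true_and,
          decide_eq_decide]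
        omega
      · have : incStep (y, true) (Sym.bit (decide (v % 2 = 1)))
          = (Sym.bit false :: y, true) := by simp [incStep, h]
        rw [this, ih]
        have e₁ : (v + 1) / 2 = v / 2 + 1 := by omega
        have e₂ : (v + 1) % 2 = 0 := by omega
        simp only [Bool.toNat_true, e₁, e₂, List.reverse_cons,
          List.append_assoc, List.singleton_append, zero_ne_one, decide_false, Prod.mk.injEq,
          true_and, decide_eq_decide]
        omega

/-- Overflow is not excluded: at `v + 1 = 2 ^ w` the digits wrap around to zero and the flag reports
it, which both the loops over a counter and the growing counter exploit. -/
theorem exec_inc (i : Fin m) (S : Store m) (ht : S.tmp = []) (hf : S.flag = []) {w v : ℕ}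
    (hx : S.x i = symBinary w v) (hv : v < 2 ^ w) :
    Exec (inc i) S (7 * (w + 1)) { S with
      flag := carryFlag (decide (v + 1 = 2 ^ w))
      x := Function.update S.x i (symBinary w (v + 1)) } := by
  obtain ⟨inp, tmp, out, res, flag, x⟩ := S
  dsimp only at ht hf hx ⊢
  subst ht hf
  have h₁ := Exec.loop (k := .x i) (f := fun a => .case .flag (incBody a)) (T := 3)
    (fun (y : List Sym × Bool) l => ⟨inp, y.1, out, res, carryFlag y.2, Function.update x i l⟩)
    incStep (fun _ _ => True) (fun _ _ => by simp [Store.stk])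
    (fun _ _ _ => by rw [Store.update_x]; simp)
    (fun y a l _ => ⟨by
      obtain ⟨y, c⟩ := y
      refine Exec.case_flag ?_
      cases c with
      | false => exact (Exec.push_tmp a).mono (by omega)
      | true =>
        by_cases ha : a = Sym.bit true
        · simp only [carryFlag, if_true, List.head?_cons, List.tail_cons, incBody, incStep, ha]
          exact (Exec.push_tmp _).seq (Exec.push_flag _)
        · simp only [carryFlag, if_true, List.head?_cons, List.tail_cons, incBody, incStep, ha,
            if_false]
          exact (Exec.push_tmp _).mono (by omega), trivial⟩) (x i) ([], true) trivial
  rw [hx, foldl_incStep, ← hx, Function.update_eq_self] at h₁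
  have h₂ := (Exec.push_flag (S := ⟨inp, [], out, res, [], x⟩) (Sym.bit true)).seq
    (h₁.seq (exec_restore i _))
  have e : decide (2 ^ w ≤ v % 2 ^ w + 1) = decide (v + 1 = 2 ^ w) := by
    rw [decide_eq_decide, Nat.mod_eq_of_lt hv]
    omega
  simp only [e, Bool.toNat_true, List.append_nil, List.reverse_reverse, Function.update_self,
    Function.update_idem, hx, length_symBinary, List.length_reverse] at h₂
  exact h₂.mono (by omega)

end FactorModel

namespace FactorModel
open Cmd

/-! ### Writing the ground instances of clauses -/

/-- A literal over relation symbols `R`, all of arity three, and variables `Fin m`. -/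
structure Lit (R : Type) (m : ℕ) where
  rel : R
  arg : Fin 3 → Fin m
  pos : Bool

/-- The row of the table of a clause that falsifies the clause. -/
def falsifier {R : Type} {m : ℕ} (c : List (Lit R m)) (i : Fin c.length) : Fin 2 :=
  if (c.get i).pos then 0 else 1

/-- The encoding of the table of a clause. -/
def clauseTable {R : Type} {m : ℕ} (c : List (Lit R m)) : List Sym :=
  encList encNNRat (List.ofFn fun r : Fin (∏ _ : Fin c.length, 2) =>
    if finPiFinEquiv.symm r = falsifier c then 0 else 1)

section Strings

variable {R : Type} {m : ℕ} (tag : R → List Bool) (w : ℕ)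

/-- The bits of the propositional variable of a ground atom. -/
def atomBits (r : R) (a : Fin 3 → ℕ) : List Bool :=
  binary w (a 0) ++ binary w (a 1) ++ binary w (a 2) ++ tag r

/-- The string of the ground instance of a clause at a valuation. -/
def clauseStr (c : List (Lit R m)) (v : Fin m → ℕ) : List Sym :=
  c.flatMap (fun l => (atomBits tag w l.rel fun k => v (l.arg k)).map Sym.bit ++ [Sym.comma]) ++
    Sym.semi :: clauseTable c

end Strings

variable {R : Type} {m : ℕ}

/-- The store between two programs that write. -/
def work (w : ℕ) (inp out : List Sym) (v : Fin m → ℕ) : Store m :=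
  ⟨inp, [], out, [], [], fun i => symBinary w (v i)⟩

theorem work_update (w : ℕ) (v : Fin m → ℕ) (i : Fin m) (a : ℕ) :
    Function.update (fun j => symBinary w (v j)) i (symBinary w a)
      = fun j => symBinary w (Function.update v i a j) := by
  funext j
  by_cases h : j = i
  · subst h; simp
  · simp [h]

/-- The program `c` writes `str v` when the counters have the values `v`. -/
def Writes (w : ℕ) (c : Cmd (Stk m) Sym) (str : (Fin m → ℕ) → List Sym) (T : ℕ) : Prop :=
  ∀ inp out v, Exec c (work w inp out v) T (work w inp (out ++ str v) v)

theorem Writes.mono {w : ℕ} {c : Cmd (Stk m) Sym} {str : (Fin m → ℕ) → List Sym} {T T' : ℕ}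
    (h : Writes w c str T) (hT : T ≤ T') : Writes w c str T' :=
  fun inp out v => (h inp out v).mono hT

theorem Writes.seq {w : ℕ} {c d : Cmd (Stk m) Sym} {str str' : (Fin m → ℕ) → List Sym} {T T' : ℕ}
    (h : Writes w c str T) (h' : Writes w d str' T') :
    Writes w (.seq c d) (fun v => str v ++ str' v) (T + T') := by
  intro inp out v
  have := (h inp out v).seq (h' inp _ v)
  rwa [List.append_assoc] at this

theorem writes_emit (w : ℕ) (l : List Sym) :
    Writes (m := m) w (emit l) (fun _ => l) (l.length + 1) :=
  fun _ _ _ => exec_emit l _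

theorem writes_emitField (w : ℕ) (i : Fin m) :
    Writes w (emitField i) (fun v => symBinary w (v i)) (5 * w + 2) :=
  fun inp out v => (exec_emitField i (work w inp out v) rfl).mono (by simp [work])

/-- Write a ground atom. -/
def emitAtom (tag : R → List Bool) (l : Lit R m) : Cmd (Stk m) Sym :=
  .seq (.seq (.seq (emitField (l.arg 0)) (emitField (l.arg 1))) (emitField (l.arg 2)))
    (emit ((tag l.rel).map Sym.bit ++ [Sym.comma]))

theorem writes_emitAtom (tag : R → List Bool) (l : Lit R m) (w : ℕ) :
    Writes w (emitAtom tag l)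
      (fun v => (atomBits tag w l.rel fun k => v (l.arg k)).map Sym.bit ++ [Sym.comma])
      (((tag l.rel).length + 17) * (w + 1)) := by
  have h := (((writes_emitField w (l.arg 0)).seq (writes_emitField w (l.arg 1))).seq
    (writes_emitField w (l.arg 2))).seq (writes_emit w ((tag l.rel).map Sym.bit ++ [Sym.comma]))
  simp only [atomBits, List.map_append, ← symBinary.eq_1, List.append_assoc] at h ⊢
  refine h.mono ?_
  simp only [List.length_append, List.length_map, List.length_singleton]
  nlinarith

/-- Run a list of programs. -/
def seqAll (l : List (Cmd (Stk m) Sym)) : Cmd (Stk m) Sym := l.foldr .seq .skip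

/-- The constant is chosen before the width: the program is fixed while the counters grow with the
input. -/
theorem writes_seqAll {α : Type} (f : α → Cmd (Stk m) Sym) (str : ℕ → α → (Fin m → ℕ) → List Sym)
    (l : List α) (h : ∀ a ∈ l, ∃ C, ∀ w, Writes w (f a) (str w a) (C * (w + 1))) :
    ∃ C, ∀ w, Writes w (seqAll (l.map f)) (fun v => l.flatMap fun a => str w a v)
      (C * (w + 1)) := by
  induction l with
  | nil =>
    refine ⟨1, fun w inp out v => ?_⟩
    simp only [List.flatMap_nil, List.append_nil]
    exact Exec.skip.mono (by omega)
  | cons a l ih =>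
    obtain ⟨C, hC⟩ := h a (by simp)
    obtain ⟨C', hC'⟩ := ih fun b hb => h b (by simp [hb])
    refine ⟨C + C', fun w => ?_⟩
    have := (hC w).seq (hC' w)
    rw [← add_mul] at this
    simpa [seqAll] using this

/-- Write the ground instance of a clause. -/
def emitClause (tag : R → List Bool) (c : List (Lit R m)) : Cmd (Stk m) Sym :=
  .seq (seqAll (c.map (emitAtom tag))) (emit (Sym.semi :: clauseTable c))

theorem writes_emitClause (tag : R → List Bool) (c : List (Lit R m)) :
    ∃ C, ∀ w, Writes w (emitClause tag c) (clauseStr tag w c) (C * (w + 1)) := by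
  obtain ⟨C, hC⟩ := writes_seqAll (emitAtom tag) (fun w l v =>
    (atomBits tag w l.rel fun k => v (l.arg k)).map Sym.bit ++ [Sym.comma]) c
    fun l _ => ⟨_, writes_emitAtom tag l⟩
  refine ⟨C + ((Sym.semi :: clauseTable c).length + 1), fun w => ?_⟩
  refine ((hC w).seq (writes_emit w (Sym.semi :: clauseTable c))).mono ?_
  rw [add_mul]
  gcongr
  exact Nat.le_mul_of_pos_right _ (by omega)

/-! ### Counters -/

/-- Because of this wrap-around, a loop over all the values of a counter leaves it at zero, ready
for the next round of an enclosing loop. -/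
theorem binary_two_pow (w : ℕ) : binary w (2 ^ w) = binary w 0 := by
  induction w with
  | zero => rfl
  | succ w ih => simp [binary, pow_succ, ih]

theorem symBinary_two_pow (w : ℕ) : symBinary w (2 ^ w) = symBinary w 0 := by
  rw [symBinary, binary_two_pow, symBinary]

theorem exec_inc_work {w : ℕ} (i : Fin m) (inp out : List Sym) (v : Fin m → ℕ)
    (h : v i + 1 < 2 ^ w) :
    Exec (inc i) (work w inp out v) (7 * (w + 1))
      (work w inp out (Function.update v i (v i + 1))) := by
  have := exec_inc i (work w inp out v) rfl rfl rfl (show v i < 2 ^ w by omega)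
  rw [decide_eq_false (by omega)] at this
  simp only [work, work_update] at this ⊢
  exact this

/-- Set a counter to zero. -/
def reset (i : Fin m) : Cmd (Stk m) Sym :=
  .seq (.loop (.x i) fun _ => .push .tmp (Sym.bit false)) (restore i)

theorem foldl_cons_const (a : Sym) (l y : List Sym) :
    l.foldl (fun y _ => a :: y) y = List.replicate l.length a ++ y := by
  induction l generalizing y with
  | nil => simp
  | cons b l ih => simp [ih, List.replicate_succ', List.append_assoc]

theorem exec_reset {w : ℕ} (i : Fin m) (inp out : List Sym) (v : Fin m → ℕ) :
    Exec (reset i) (work w inp out v) (4 * (w + 1))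
      (work w inp out (Function.update v i 0)) := by
  have h := Exec.loop (k := .x i) (f := fun _ => .push .tmp (Sym.bit false)) (T := 1)
    (fun (y : List Sym) l =>
      ⟨inp, y, out, [], [], Function.update (fun j => symBinary w (v j)) i l⟩)
    (fun y _ => Sym.bit false :: y)
    (fun _ _ => True) (fun _ _ => by simp [Store.stk])
    (fun _ _ _ => by rw [Store.update_x]; simp)
    (fun y a l _ => ⟨Exec.push_tmp _, trivial⟩) (symBinary w (v i)) [] trivial
  rw [foldl_cons_const] at h
  have h' := h.seq (exec_restore i _)
  simp only [length_symBinary, List.append_nil, List.length_replicate, List.reverse_replicate,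
    Function.update_self, Function.update_idem] at h'
  rw [← symBinary_zero, Function.update_eq_self, work_update] at h'
  exact h'.mono (by omega)

/-- Run a program for all the values of a counter. -/
def forAll (i : Fin m) (c : Cmd (Stk m) Sym) : Cmd (Stk m) Sym :=
  .seq (.push .flag (Sym.bit true)) (.loop .flag fun _ => .seq c (.seq (inc i)
    (.case .flag fun o => if o.isSome then .skip else .push .flag (Sym.bit true))))

/-- The flag stack controls the loop and also receives the overflow of the increment: on overflow
the symbol is removed and the loop stops, otherwise a symbol is pushed for another round. -/
theorem exec_forAll {w : ℕ} (i : Fin m) {c : Cmd (Stk m) Sym} (inp : List Sym) (v : Fin m → ℕ)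
    (hv : v i = 0) {str : ℕ → List Sym} {T : ℕ}
    (h : ∀ a < 2 ^ w, ∀ out, Exec c (work w inp out (Function.update v i a)) T
      (work w inp (out ++ str a) (Function.update v i a))) (out : List Sym) :
    Exec (forAll i c) (work w inp out v) (2 ^ w * (T + 10 * (w + 1)) + 2)
      (work w inp (out ++ (List.range (2 ^ w)).flatMap str) v) := by
  have hx : Function.update (fun j => symBinary w (v j)) i (symBinary w 0)
      = fun j => symBinary w (v j) := by rw [work_update, ← hv, Function.update_eq_self]
  -- Here `a` is the current value of the counter and `k + 1` rounds remain.
  have key : ∀ k a out, a + k + 1 = 2 ^ w →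
      Exec (.loop .flag fun _ => .seq c (.seq (inc i)
        (.case .flag fun o => if o.isSome then .skip else .push .flag (Sym.bit true))))
        { work w inp out (Function.update v i a) with flag := [Sym.bit true] }
        ((k + 1) * (T + 10 * (w + 1)) + 1)
        (work w inp (out ++ (List.range' a (k + 1)).flatMap str) v) := by
    intro k
    induction k with
    | zero =>
      intro a out ha
      have h₁ := (h a (by omega) out).seq ((exec_inc i _ rfl rfl
        (by rw [work]) (by rw [Function.update_self]; omega)).seq
          (Exec.case_flag (f := fun o => if o.isSome then .skip else .push .flag (Sym.bit true))
            (T := 1) (by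
              rw [decide_eq_true (by rw [Function.update_self]; omega)]
              exact Exec.skip)))
      obtain ⟨t, ht, hr⟩ := h₁
      refine ⟨t + 1 + 1, ?_, .loop_cons (l := []) rfl (by rw [Store.update_flag]; exact hr) ?_⟩
      · omega
      · simp only [work, List.tail_cons, Function.update_self, carryFlag, if_true]
        -- After the last round the counter has overflowed to `2 ^ w`, whose digits are those of `0
        -- = v i`.
        rw [← work_update, Function.update_idem, show a + 1 = 2 ^ w by omega, symBinary_two_pow, hx]
        simpa using Run.loop_nil rfl
    | succ k ih =>
      intro a out ha
      have h₁ := (h a (by omega) out).seq ((exec_inc_work i _ _ _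
        (by rw [Function.update_self]; omega)).seq
          (Exec.case_flag (f := fun o => if o.isSome then .skip else .push .flag (Sym.bit true))
            (T := 1) (Exec.push_flag _)))
      rw [Function.update_self, Function.update_idem] at h₁
      obtain ⟨t, ht, hr⟩ := h₁
      obtain ⟨t', ht', hr'⟩ := ih (a + 1) (out ++ str a) (by omega)
      refine ⟨t + t' + 1, ?_, .loop_cons (l := []) rfl (by rw [Store.update_flag]; exact hr) ?_⟩
      · rw [add_mul (k + 1) 1]
        omega
      · rw [List.range'_succ, List.flatMap_cons, ← List.append_assoc]
        exact hr'
  have hpos : 0 < 2 ^ w := by positivity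
  have h₁ := key (2 ^ w - 1) 0 out (by omega)
  rw [show 2 ^ w - 1 + 1 = 2 ^ w by omega, ← List.range_eq_range', ← hv,
    Function.update_eq_self] at h₁
  exact ((Exec.push_flag _).seq h₁).mono (by omega)

/-- All the valuations that take values below `N` at `l` and agree with `v` elsewhere. -/
def tuples (N : ℕ) : List (Fin m) → (Fin m → ℕ) → List (Fin m → ℕ)
  | [], v => [v]
  | i :: l, v => (List.range N).flatMap fun a => tuples N l (Function.update v i a)

def forTuples (l : List (Fin m)) (c : Cmd (Stk m) Sym) : Cmd (Stk m) Sym := l.foldr forAll c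

/-- Each loop must start at zero and own its counter, hence `hv` and `hl`. The 12 per level is the
overhead of `exec_forAll`, 10 for a round and 2 for start and end, absorbed into the main product.
-/
theorem exec_forTuples {c : Cmd (Stk m) Sym} {str : ℕ → (Fin m → ℕ) → List Sym} {C : ℕ}
    (h : ∀ w, Writes w c (str w) (C * (w + 1))) (w : ℕ) (inp : List Sym) {l : List (Fin m)}
    (hl : l.Nodup) (v : Fin m → ℕ) (hv : ∀ i ∈ l, v i = 0) (out : List Sym) :
    Exec (forTuples l c) (work w inp out v) ((C + 12 * l.length) * (w + 1) * (2 ^ w) ^ l.length)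
      (work w inp (out ++ (tuples (2 ^ w) l v).flatMap (str w)) v) := by
  induction l generalizing v out with
  | nil => simpa [tuples, forTuples] using h w inp out v
  | cons i l ih =>
    rw [List.nodup_cons] at hl
    have h₁ := exec_forAll (w := w) i inp v (hv i (by simp)) (c := forTuples l c)
      (T := (C + 12 * l.length) * (w + 1) * (2 ^ w) ^ l.length)
      (str := fun a => (tuples (2 ^ w) l (Function.update v i a)).flatMap (str w))
      (fun a _ out => ih hl.2 _ (fun j hj => by
        have : j ≠ i := fun e => hl.1 (e ▸ hj)
        rw [Function.update_of_ne this, hv j (by simp [hj])]) out) out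
    rw [tuples, List.flatMap_assoc]
    refine h₁.mono ?_
    rw [List.length_cons, pow_succ']
    have hp : 1 ≤ 2 ^ w := Nat.one_le_two_pow
    have hq : 1 ≤ (2 ^ w) ^ l.length := Nat.one_le_pow _ _ (by positivity)
    generalize 2 ^ w = N at *
    generalize N ^ l.length = M at *
    have h₁ : (w + 1) * 1 ≤ (w + 1) * M := Nat.mul_le_mul_left _ hq
    have h₂ : N * (10 * (w + 1)) ≤ N * (10 * ((w + 1) * M)) := by gcongr; omega
    have h₃ : 1 * 1 ≤ N * ((w + 1) * M) := Nat.mul_le_mul hp (by nlinarith)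
    nlinarith

end FactorModel

namespace FactorModel
open Cmd

/-! ### The grounding program -/

/-- A step pushes at most one symbol. This bounds the length of the output by the running time, and
hence the cost of reversing it at the end. -/
theorem Cmd.Run.length_le {K Γ : Type} [DecidableEq K] {c : Cmd K Γ} {s s' : K → List Γ} {t : ℕ}
    (h : Run c s t s') (k : K) : (s' k).length ≤ (s k).length + t := by
  induction h with
  | skip s => simp
  | push k' a s =>
    by_cases e : k = k'
    · subst e; simp
    · simp [e]
  | seq _ _ ih ih' => omega
  | @case k' f s t s' _ ih =>
    have : (Function.update s k' (s k').tail k).length ≤ (s k).length := by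
      by_cases e : k = k'
      · subst e; simp
      · simp [e]
    omega
  | loop_nil => omega
  | @loop_cons k' f s a l t s' t' s'' hk _ _ ih ih' =>
    have : (Function.update s k' l k).length ≤ (s k).length := by
      by_cases e : k = k'
      · subst e; simp [hk]
      · simp [e]
    omega

variable {R : Type} {m : ℕ}

/-- The number of bits of the counters on inputs of length `n`. -/
def width (n : ℕ) : ℕ := Nat.log 2 (n + 1) + 2

theorem two_pow_width_le (n : ℕ) : 2 ^ width n ≤ 4 * (n + 1) := by
  have := Nat.pow_log_le_self 2 (show n + 1 ≠ 0 by omega)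
  rw [width, pow_add]
  omega

/-- Positions run from 0 to `n + 1`, and the successor `n + 2` of the last one must also fit into a
counter. -/
theorem lt_two_pow_width (n : ℕ) : n + 2 < 2 ^ width n := by
  have := Nat.lt_pow_succ_log_self (b := 2) (by omega) (n + 1)
  rw [width, show Nat.log 2 (n + 1) + 2 = (Nat.log 2 (n + 1) + 1) + 1 by omega, pow_succ]
  simp only [Nat.succ_eq_add_one] at this
  omega

theorem width_lt (n : ℕ) : width n + 1 ≤ 4 * (n + 1) :=
  (Nat.lt_two_pow_self (n := width n)).trans_le (two_pow_width_le n)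

/-- Increment a counter, which is lengthened when it overflows. -/
def grow (i : Fin m) : Cmd (Stk m) Sym :=
  .seq (inc i) (.case .flag fun o => if o.isSome then .push (.x i) (Sym.bit false) else .skip)

/-- The content of the growing counter after `k` steps. -/
def grown (k : ℕ) : List Sym :=
  symBinary (Nat.log 2 (k + 1)) (k + 1 - 2 ^ Nat.log 2 (k + 1))

/-- The counter stores `k + 1` without its leading 1. It overflows exactly when `k + 2` is a power
of two; all its digits are then zero, so one more zero may be pushed at the low end. -/
theorem exec_grow (i : Fin m) (inp res : List Sym) (x : Fin m → List Sym) (k : ℕ)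
    (hx : x i = grown k) :
    Exec (grow i) ⟨inp, [], [], res, [], x⟩ (7 * (k + 2) + 2)
      ⟨inp, [], [], res, [], Function.update x i (grown (k + 1))⟩ := by
  have h₁ := Nat.pow_log_le_self 2 (show k + 1 ≠ 0 by omega)
  have h₂ := Nat.lt_pow_succ_log_self (b := 2) (by omega) (k + 1)
  have h₃ := Nat.log_le_self 2 (k + 1)
  rw [grown] at hx
  rw [grown]
  generalize Nat.log 2 (k + 1) = w at *
  rw [Nat.succ_eq_add_one, pow_succ] at h₂
  have h := (exec_inc i ⟨inp, [], [], res, [], x⟩ rfl rfl hx (by omega)).seq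
    (T' := 2) (d := .case .flag fun o => if o.isSome then .push (.x i) (Sym.bit false) else .skip)
    (S'' := ⟨inp, [], [], res, [], Function.update x i (grown (k + 1))⟩) (by
      refine Exec.case_flag (T := 1) ?_
      by_cases e : k + 1 + 1 = 2 ^ (w + 1)
      · have e₁ : k + 1 - 2 ^ w + 1 = 2 ^ w := by rw [pow_succ] at e; omega
        have e₂ : grown (k + 1) = Sym.bit false :: symBinary w (2 ^ w) := by
          rw [grown, e, Nat.log_pow (by omega), Nat.sub_self, symBinary_two_pow]
          rfl
        rw [decide_eq_true e₁, e₁, e₂]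
        have := Exec.push_x (S := ⟨inp, [], [], res, [], Function.update x i (symBinary w (2 ^ w))⟩)
          i (Sym.bit false)
        simp only [Function.update_self, Function.update_idem] at this
        exact this
      · rw [pow_succ] at e
        have e₁ : ¬ k + 1 - 2 ^ w + 1 = 2 ^ w := by omega
        have e₂ : Nat.log 2 (k + 1 + 1) = w := Nat.log_eq_of_pow_le_of_lt_pow (by omega)
          (by rw [pow_succ]; omega)
        rw [decide_eq_false e₁, grown, e₂, show k + 1 + 1 - 2 ^ w = k + 1 - 2 ^ w + 1 by omega]
        exact Exec.skip)
  exact h.mono (by omega)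

/-- Push a zero on all the counters of a list. -/
def pushZeros (l : List (Fin m)) : Cmd (Stk m) Sym :=
  seqAll (l.map fun i => .push (.x i) (Sym.bit false))

theorem exec_pushZeros (l : List (Fin m)) (hl : l.Nodup) (S : Store m) :
    Exec (pushZeros l) S (l.length + 1)
      { S with x := fun i => if i ∈ l then Sym.bit false :: S.x i else S.x i } := by
  induction l generalizing S with
  | nil =>
    simp only [List.not_mem_nil, if_false]
    exact Exec.skip
  | cons i l ih =>
    rw [List.nodup_cons] at hl
    have h := (Exec.push_x (S := S) i (Sym.bit false)).seq (ih hl.2 _)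
    have e : (fun j => if j ∈ l then
        Sym.bit false :: Function.update S.x i (Sym.bit false :: S.x i) j
        else Function.update S.x i (Sym.bit false :: S.x i) j)
        = fun j => if j ∈ i :: l then Sym.bit false :: S.x j else S.x j := by
      funext j
      by_cases hj : j = i
      · subst hj
        simp [hl.1]
      · simp [hj]
    simp only [e] at h
    exact h.mono (by simp; omega)

/-- Give all the counters their width. -/
def setup (i : Fin m) : Cmd (Stk m) Sym :=
  .seq (.seq (.loop .inp fun a => .seq (.push .res a) (grow i)) (.loop .res fun a => .push .inp a))
    (.seq (.loop (.x i) fun _ => .push .tmp (Sym.bit false))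
      (.seq (.seq (.push .tmp (Sym.bit false)) (.push .tmp (Sym.bit false)))
        (.loop .tmp fun _ => pushZeros (List.finRange m))))

theorem foldl_cons (l y : List Sym) : l.foldl (fun y a => a :: y) y = l.reverse ++ y := by
  induction l generalizing y with
  | nil => simp
  | cons a l ih => simp [ih]

/-- Counting the input symbols with the growing counter yields a stack of logarithmic height. Only
its height is used: it becomes that many zeros, two more are added, and each is copied to every
counter. The input passes through `res` and back so that it survives the count. -/
theorem exec_setup (i : Fin m) (w : List Sym) :
    Exec (setup i) ⟨w, [], [], [], [], fun _ => []⟩ ((50 + m) * (4 * (w.length + 1)) ^ 2)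
      (work (width w.length) w [] fun _ => 0) := by
  have h₁ := Exec.loop (k := .inp) (f := fun a => .seq (.push .res a) (grow i))
    (T := 1 + (7 * (w.length + 2) + 2))
    (fun (y : List Sym × ℕ) l =>
      ⟨l, [], [], y.1, [], Function.update (fun _ => []) i (grown y.2)⟩)
    (fun y a => (a :: y.1, y.2 + 1)) (fun y l => y.2 + l.length = w.length)
    (fun _ _ => rfl) (fun _ _ _ => Store.update_inp _ _) (fun y a l hP => by
      rw [List.length_cons] at hP
      refine ⟨(Exec.push_res a).seq ?_, by dsimp only; omega⟩
      have := exec_grow i l (a :: y.1) (Function.update (fun _ => []) i (grown y.2)) y.2 (by simp)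
      rw [Function.update_idem] at this
      exact this.mono (by omega)) w ([], 0) (by simp)
  have e : ∀ (l y : List Sym) (k : ℕ), l.foldl (fun (y : List Sym × ℕ) a => (a :: y.1, y.2 + 1))
      (y, k) = (l.reverse ++ y, k + l.length) := by
    intro l
    induction l with
    | nil => simp
    | cons a l ih => intro y k; simp [ih]; omega
  have hg : Function.update (fun _ : Fin m => ([] : List Sym)) i (grown 0) = fun _ => [] := by
    have : grown 0 = [] := by simp [grown, symBinary, binary]
    rw [this]
    exact Function.update_eq_self i _
  rw [e, List.append_nil, zero_add, hg] at h₁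
  have h₂ := Exec.loop (k := .res) (f := fun a => .push .inp a) (T := 1)
    (fun (y : List Sym) l =>
      ⟨y, [], [], l, [], Function.update (fun _ : Fin m => []) i (grown w.length)⟩)
    (fun y a => a :: y) (fun _ _ => True)
    (fun _ _ => rfl) (fun _ _ _ => Store.update_res _ _)
    (fun y a l _ => ⟨Exec.push_inp a, trivial⟩) w.reverse [] trivial
  rw [foldl_cons, List.reverse_reverse, List.append_nil, List.length_reverse] at h₂
  have h₃ := Exec.loop (k := .x i) (f := fun _ => .push .tmp (Sym.bit false)) (T := 1)
    (fun (y : List Sym) l =>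
      ⟨w, y, [], [], [], Function.update (fun _ : Fin m => []) i l⟩)
    (fun y _ => Sym.bit false :: y) (fun _ _ => True)
    (fun _ _ => by simp [Store.stk]) (fun _ _ _ => by rw [Store.update_x]; simp)
    (fun y a l _ => ⟨Exec.push_tmp _, trivial⟩) (grown w.length) [] trivial
  rw [foldl_cons_const, Function.update_eq_self_iff.2 rfl] at h₃
  have hl : (grown w.length).length = Nat.log 2 (w.length + 1) := by simp [grown]
  rw [hl, List.append_nil] at h₃
  have h₄ := Exec.loop (k := .tmp) (f := fun _ => pushZeros (List.finRange m)) (T := m + 1)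
    (fun (y : ℕ) l =>
      ⟨w, l, [], [], [], fun _ => List.replicate y (Sym.bit false)⟩)
    (fun y _ => y + 1) (fun _ _ => True)
    (fun _ _ => rfl) (fun _ _ _ => Store.update_tmp _ _)
    (fun y a l _ => ⟨by
      have := exec_pushZeros (List.finRange m) (List.nodup_finRange m)
        ⟨w, l, [], [], [], fun _ => List.replicate y (Sym.bit false)⟩
      simp only [List.mem_finRange, if_true, ← List.replicate_succ, List.length_finRange] at this
      exact this, trivial⟩)
    (List.replicate (width w.length) (Sym.bit false)) 0 trivial
  have e' : ∀ (l : List Sym) (k : ℕ), l.foldl (fun y _ => y + 1) k = k + l.length := by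
    intro l
    induction l with
    | nil => simp
    | cons a l ih => intro k; simp [ih]; omega
  rw [e', List.length_replicate, zero_add] at h₄
  have h₅ := (h₁.seq h₂).seq (h₃.seq (((Exec.push_tmp (Sym.bit false)).seq
    (Exec.push_tmp (Sym.bit false))).seq h₄))
  simp only [work, symBinary_zero]
  refine h₅.mono ?_
  have hw := width_lt w.length
  have hw' : Nat.log 2 (w.length + 1) ≤ width w.length := by simp [width]
  generalize width w.length = W at *
  generalize Nat.log 2 (w.length + 1) = L at *
  generalize w.length = n at *
  have a₁ : L * (1 + 1) + 1 ≤ 8 * (n + 1) := by omega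
  have a₂ : W * (m + 1 + 1) ≤ 4 * (n + 1) * (m + 2) := Nat.mul_le_mul (by omega) (by omega)
  nlinarith [Nat.zero_le (m * n), Nat.zero_le (n * n), Nat.zero_le (m * n * n)]

end FactorModel

/-! ### Theories about a string and the program that writes their ground instances -/

namespace FactorModel
open Cmd

variable {R : Type} {m : ℕ}

/-- A finite set of universal clauses, and the clauses that describe a string: the positions `0` and
`n + 1` are marked by `first` and `last`, the position `i + 1` by the `i`-th symbol, and `next` is
the successor relation. The clauses about positions only use the variables `i₀` (the position) and
`i₁` (the next position). -/
structure Theory (R : Type) (m : ℕ) where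
  i₀ : Fin m
  i₁ : Fin m
  ne : i₀ ≠ i₁
  first : List (Lit R m)
  last : List (Lit R m)
  next : List (Lit R m)
  symb : Sym → List (Lit R m)
  rules : List (List (Lit R m))

namespace Theory

variable (Θ : Theory R m)

/-- The valuation of the clauses about the position `a`. -/
def posVal (a : ℕ) : Fin m → ℕ :=
  Function.update (Function.update (fun _ => 0) Θ.i₁ (a + 1)) Θ.i₀ a

/-- The clauses about the positions after `a`. -/
def posInstances : ℕ → List Sym → List (List (Lit R m) × (Fin m → ℕ))
  | a, [] => [(Θ.last, Θ.posVal (a + 1)), (Θ.next, Θ.posVal (a + 1))]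
  | a, s :: l => (Θ.symb s, Θ.posVal (a + 1)) :: (Θ.next, Θ.posVal (a + 1)) :: posInstances (a + 1) l

/-- All the valuations with values below `2 ^ W`. -/
def valuations (m W : ℕ) : List (Fin m → ℕ) := tuples (2 ^ W) (List.finRange m) fun _ => 0

/-- The ground instances of the clauses for the string `w`. -/
def instances (w : List Sym) : List (List (Lit R m) × (Fin m → ℕ)) :=
  (Θ.first, Θ.posVal 0) :: (Θ.next, Θ.posVal 0) :: Θ.posInstances 0 w ++
    (valuations m (width w.length)).flatMap fun v => Θ.rules.map fun c => (c, v)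

/-- The output of the grounding program; `unit` is written for each valuation. -/
def text (tag : R → List Bool) (unit : List Sym) (w : List Sym) : List Sym :=
  [Sym.slash, Sym.bit true, Sym.semi] ++
    (valuations m (width w.length)).flatMap (fun _ => unit) ++ [Sym.semi] ++
    (Θ.instances w).flatMap fun i => clauseStr tag (width w.length) i.1 i.2

/-- Advance the position. -/
def advance : Cmd (Stk m) Sym := .seq (inc Θ.i₀) (inc Θ.i₁)

/-- The second counter is one ahead and reaches `a + 2`, so this is the value that must fit. -/
theorem exec_advance {W : ℕ} (inp out : List Sym) (a : ℕ) (h : a + 2 < 2 ^ W) :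
    Exec Θ.advance (work W inp out (Θ.posVal a)) (14 * (W + 1))
      (work W inp out (Θ.posVal (a + 1))) := by
  have h₀ : Θ.posVal a Θ.i₀ = a := by simp [posVal]
  have h₁ := exec_inc_work Θ.i₀ inp out (Θ.posVal a) (w := W) (by omega)
  rw [h₀] at h₁
  have h₂ : Function.update (Θ.posVal a) Θ.i₀ (a + 1) Θ.i₁ = a + 1 := by
    rw [Function.update_of_ne Θ.ne.symm, posVal, Function.update_of_ne Θ.ne.symm,
      Function.update_self]
  have h₃ := exec_inc_work Θ.i₁ inp out (Function.update (Θ.posVal a) Θ.i₀ (a + 1)) (w := W)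
    (by omega)
  have e : Function.update (Function.update (Θ.posVal a) Θ.i₀ (a + 1)) Θ.i₁ (a + 1 + 1)
      = Θ.posVal (a + 1) := by
    rw [posVal, posVal, Function.update_idem, Function.update_comm Θ.ne, Function.update_idem]
  rw [h₂, e] at h₃
  exact (h₁.seq h₃).mono (by omega)

/-- Write the clauses about the positions. -/
def emitPositions (tag : R → List Bool) : Cmd (Stk m) Sym :=
  .seq (.seq (inc Θ.i₁) (.seq (emitClause tag Θ.first) (emitClause tag Θ.next)))
    (.seq (.loop .inp fun s =>
        .seq Θ.advance (.seq (emitClause tag (Θ.symb s)) (emitClause tag Θ.next)))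
      (.seq (.seq Θ.advance (.seq (emitClause tag Θ.last) (emitClause tag Θ.next)))
        (.seq (reset Θ.i₀) (reset Θ.i₁))))

theorem exec_emitPositions (tag : R → List Bool) : ∃ C, ∀ (w out : List Sym),
    Exec (Θ.emitPositions tag) (work (width w.length) w out fun _ => 0)
      (C * (4 * (w.length + 1)) ^ 2)
      (work (width w.length) [] (out ++ ((Θ.first, Θ.posVal 0) :: (Θ.next, Θ.posVal 0) ::
        Θ.posInstances 0 w).flatMap fun i => clauseStr tag (width w.length) i.1 i.2)
        fun _ => 0) := by
  -- The clauses for the first position, the last position and each symbol are gathered into one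
  -- finite family, to have one constant for all of them.
  have hC : ∃ C, ∀ (c : Option (Option Sym)) W, Writes W
      (emitClause tag (c.elim Θ.first fun o => o.elim Θ.last Θ.symb))
      (clauseStr tag W (c.elim Θ.first fun o => o.elim Θ.last Θ.symb)) (C * (W + 1)) := by
    choose C hC using fun c : Option (Option Sym) =>
      writes_emitClause tag (c.elim Θ.first fun o => o.elim Θ.last Θ.symb)
    refine ⟨Finset.univ.sup C, fun c W => (hC c W).mono ?_⟩
    gcongr
    exact Finset.le_sup (Finset.mem_univ c)
  obtain ⟨C, hC⟩ := hC
  obtain ⟨D, hD⟩ := writes_emitClause tag Θ.next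
  refine ⟨50 + 3 * (C + D), fun w out => ?_⟩
  have hN := lt_two_pow_width w.length
  have hW := width_lt w.length
  generalize width w.length = W at *
  have hpair : ∀ (c : Option (Option Sym)) (inp out : List Sym) (a : ℕ), Exec
      (.seq (emitClause tag (c.elim Θ.first fun o => o.elim Θ.last Θ.symb))
        (emitClause tag Θ.next)) (work W inp out (Θ.posVal a)) ((C + D) * (W + 1))
      (work W inp (out ++ (clauseStr tag W (c.elim Θ.first fun o => o.elim Θ.last Θ.symb)
        (Θ.posVal a) ++ clauseStr tag W Θ.next (Θ.posVal a))) (Θ.posVal a)) := by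
    intro c inp out a
    rw [add_mul]
    exact (hC c W).seq (hD W) inp out _
  have h₁ := exec_inc_work Θ.i₁ w out (fun _ => 0) (w := W) (by omega)
  have e₁ : Function.update (fun _ : Fin m => 0) Θ.i₁ (0 + 1) = Θ.posVal 0 := by
    rw [posVal, Function.update_comm Θ.ne.symm]
    congr 1
    exact (Function.update_eq_self_iff.2 rfl).symm
  rw [e₁] at h₁
  have h₂ := Exec.loop (k := .inp) (f := fun s =>
      .seq Θ.advance (.seq (emitClause tag (Θ.symb s)) (emitClause tag Θ.next)))
    (T := 14 * (W + 1) + (C + D) * (W + 1))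
    (fun (y : ℕ × List Sym) l => work W l y.2 (Θ.posVal y.1))
    (fun y s => (y.1 + 1, y.2 ++ (clauseStr tag W (Θ.symb s) (Θ.posVal (y.1 + 1)) ++
      clauseStr tag W Θ.next (Θ.posVal (y.1 + 1)))))
    (fun y l => y.1 + l.length = w.length) (fun _ _ => rfl) (fun _ _ _ => Store.update_inp _ _)
    (fun y s l hP => by
      rw [List.length_cons] at hP
      exact ⟨(Θ.exec_advance _ _ _ (by omega)).seq (hpair (some (some s)) _ _ _),
        by dsimp only; omega⟩) w
    (0, out ++ (clauseStr tag W Θ.first (Θ.posVal 0) ++ clauseStr tag W Θ.next (Θ.posVal 0)))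
    (by simp)
  -- The loop over the input writes all position instances except the final pair, which belongs to
  -- the end marker and is written after the loop; hence the two `dropLast`.
  have e₂ : ∀ (l : List Sym) (a : ℕ) (out : List Sym),
      l.foldl (fun y s => (y.1 + 1, y.2 ++ (clauseStr tag W (Θ.symb s) (Θ.posVal (y.1 + 1)) ++
        clauseStr tag W Θ.next (Θ.posVal (y.1 + 1))))) (a, out)
      = (a + l.length, out ++ ((Θ.posInstances a l).dropLast.dropLast).flatMap
          fun i => clauseStr tag W i.1 i.2) ∧
      Θ.posInstances a l = (Θ.posInstances a l).dropLast.dropLast ++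
        [(Θ.last, Θ.posVal (a + l.length + 1)), (Θ.next, Θ.posVal (a + l.length + 1))] := by
    intro l
    induction l with
    | nil => intro a out; simp [posInstances]
    | cons s l ih =>
      intro a out
      have hne : Θ.posInstances (a + 1) l ≠ [] := by cases l <;> simp [posInstances]
      have hne' : (Θ.posInstances (a + 1) l).dropLast ≠ [] := by cases l <;> simp [posInstances]
      obtain ⟨ih₁, ih₂⟩ := ih (a + 1) (out ++ (clauseStr tag W (Θ.symb s) (Θ.posVal (a + 1)) ++
        clauseStr tag W Θ.next (Θ.posVal (a + 1))))
      have e : (Θ.posInstances a (s :: l)).dropLast.dropLast = (Θ.symb s, Θ.posVal (a + 1)) ::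
          (Θ.next, Θ.posVal (a + 1)) :: (Θ.posInstances (a + 1) l).dropLast.dropLast := by
        rw [posInstances, List.dropLast_cons_of_ne_nil (by simp),
          List.dropLast_cons_of_ne_nil hne, List.dropLast_cons_of_ne_nil (by simp),
          List.dropLast_cons_of_ne_nil hne']
      constructor
      · rw [List.foldl_cons, ih₁, e]
        simp only [List.length_cons, List.flatMap_cons, List.append_assoc, Prod.mk.injEq, and_true]
        omega
      · rw [e, posInstances, List.length_cons]
        conv_lhs => rw [ih₂]
        rw [show a + 1 + l.length = a + (l.length + 1) by omega]
        rfl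
  obtain ⟨e₃, e₄⟩ := e₂ w 0 (out ++ (clauseStr tag W Θ.first (Θ.posVal 0) ++
    clauseStr tag W Θ.next (Θ.posVal 0)))
  rw [e₃, zero_add] at h₂
  have h₃ := (Θ.exec_advance (W := W) [] (out ++ (clauseStr tag W Θ.first (Θ.posVal 0) ++
    clauseStr tag W Θ.next (Θ.posVal 0)) ++ ((Θ.posInstances 0 w).dropLast.dropLast).flatMap
          fun i => clauseStr tag W i.1 i.2) w.length (by omega)).seq (hpair (some none) _ _ _)
  have h₄ := (h₁.seq (hpair none w out 0)).seq (h₂.seq (h₃.seq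
    ((exec_reset Θ.i₀ _ _ _).seq (exec_reset Θ.i₁ _ _ _))))
  -- The loops over all valuations need every counter at zero again.
  have e₅ : Function.update (Function.update (Θ.posVal (w.length + 1)) Θ.i₀ 0) Θ.i₁ 0
      = fun _ => 0 := by
    funext j
    by_cases hj : j = Θ.i₁
    · simp [hj]
    · by_cases hj' : j = Θ.i₀
      · subst hj'; simp [hj]
      · simp [hj, hj', posVal]
  rw [e₅] at h₄
  rw [e₄]
  simp only [List.flatMap_cons, List.flatMap_append, List.flatMap_nil, List.append_nil,
    zero_add, List.append_assoc] at h₄ ⊢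
  refine h₄.mono ?_
  generalize w.length = n at *
  generalize C + D = E at *
  have a₁ : E * (W + 1) ≤ E * (4 * (n + 1)) := Nat.mul_le_mul_left _ hW
  have a₂ : n * (14 * (W + 1) + E * (W + 1) + 1)
      ≤ (n + 1) * (14 * (4 * (n + 1)) + E * (4 * (n + 1)) + 1) :=
    Nat.mul_le_mul (by omega) (by omega)
  nlinarith [Nat.zero_le (E * n), Nat.zero_le (n * n), Nat.zero_le (E * n * n)]

/-- Empty the counters of a list. -/
def clearAll (l : List (Fin m)) : Cmd (Stk m) Sym := seqAll (l.map fun i => .loop (.x i) fun _ => .skip)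

theorem exec_clearAll (W : ℕ) (l : List (Fin m)) (S : Store m) (hS : ∀ i, (S.x i).length ≤ W) :
    Exec (clearAll l) S (l.length * (2 * W + 1) + 1)
      { S with x := fun i => if i ∈ l then [] else S.x i } := by
  induction l generalizing S with
  | nil =>
    simp only [List.not_mem_nil, if_false]
    exact Exec.skip.mono (by simp)
  | cons i l ih =>
    have h := Exec.loop (k := .x i) (f := fun _ => .skip) (T := 1)
      (fun (_ : Unit) y => { S with x := Function.update S.x i y }) (fun y _ => y)
      (fun _ _ => True) (fun _ _ => by simp [Store.stk])
      (fun _ _ _ => by rw [Store.update_x]; simp) (fun _ _ _ _ => ⟨Exec.skip, trivial⟩)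
      (S.x i) () trivial
    rw [Function.update_eq_self] at h
    have h' := h.seq (ih { S with x := Function.update S.x i [] } (fun j => by
      by_cases hj : j = i
      · subst hj; simp
      · simpa [hj] using hS j))
    have e : (fun j => if j ∈ l then [] else Function.update S.x i [] j)
        = fun j => if j ∈ i :: l then [] else S.x j := by
      funext j
      by_cases hj : j = i
      · subst hj; simp
      · simp [hj]
    simp only [e] at h'
    refine h'.mono ?_
    have := hS i
    rw [List.length_cons, add_mul]
    omega

/-- The grounding program. -/
def program (tag : R → List Bool) (unit : List Sym) : Cmd (Stk m) Sym :=
  .seq (.seq (setup Θ.i₀)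
    (.seq (emit [Sym.slash, Sym.bit true, Sym.semi])
      (.seq (forTuples (List.finRange m) (emit unit))
        (.seq (emit [Sym.semi])
          (.seq (Θ.emitPositions tag)
            (forTuples (List.finRange m) (seqAll (Θ.rules.map (emitClause tag)))))))))
    (.seq (clearAll (List.finRange m)) (.loop .out fun a => .push .res a))

/-- The `m` nested loops contribute `(2 ^ width) ^ m`, with `2 ^ width` at most `4 * (w.length +
1)`, and the width of the counters one more factor. One further factor of slack lets the quadratic
setup and position phases fit under the same power for every `m`. -/
theorem exec_program (tag : R → List Bool) (unit : List Sym) : ∃ C, ∀ w : List Sym,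
    Exec (Θ.program tag unit) ⟨w, [], [], [], [], fun _ => []⟩
      (C * (4 * (w.length + 1)) ^ (m + 2)) ⟨[], [], [], Θ.text tag unit w, [], fun _ => []⟩ := by
  obtain ⟨C, hC⟩ := Θ.exec_emitPositions tag
  obtain ⟨D, hD⟩ := writes_seqAll (m := m) (emitClause tag) (fun W c v => clauseStr tag W c v)
    Θ.rules fun c _ => writes_emitClause tag c
  have hU : ∀ W, Writes (m := m) W (emit unit) (fun _ => unit) ((unit.length + 1) * (W + 1)) :=
    fun W => (writes_emit W unit).mono (Nat.le_mul_of_pos_right _ (by omega))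
  refine ⟨3 * ((50 + m) + 4 + (unit.length + 1 + 12 * m) + 2 + C + (D + 12 * m)) + 10 * m + 10,
    fun w => ?_⟩
  have hnd := List.nodup_finRange m
  have h₁ := (exec_setup Θ.i₀ w).seq ((exec_emit [Sym.slash, Sym.bit true, Sym.semi] _).seq
    ((exec_forTuples hU (width w.length) w hnd (fun _ => 0) (fun _ _ => rfl) _).seq
      ((exec_emit [Sym.semi] _).seq ((hC w _).seq
        (exec_forTuples hD (width w.length) [] hnd (fun _ => 0) (fun _ _ => rfl) _)))))
  have e : Θ.text tag unit w = [] ++ [Sym.slash, Sym.bit true, Sym.semi] ++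
      List.flatMap (fun _ => unit)
        (tuples (2 ^ width w.length) (List.finRange m) fun _ => 0) ++ [Sym.semi] ++
      List.flatMap (fun i => clauseStr tag (width w.length) i.1 i.2)
        ((Θ.first, Θ.posVal 0) :: (Θ.next, Θ.posVal 0) :: Θ.posInstances 0 w) ++
      List.flatMap (fun v => List.flatMap (fun c => clauseStr tag (width w.length) c v) Θ.rules)
        (tuples (2 ^ width w.length) (List.finRange m) fun _ => 0) := by
    simp [text, instances, valuations, List.flatMap_assoc, List.flatMap_map, List.append_assoc]
  have h₂ := h₁.congr (S'' := work (width w.length) [] (Θ.text tag unit w) fun _ => 0)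
    (by rw [e]; rfl)
  clear h₁
  set X := 4 * (w.length + 1) with hX
  have hX1 : 1 ≤ X := by omega
  have hT : ∀ E, E * (width w.length + 1) * (2 ^ width w.length) ^ (List.finRange m).length
      ≤ E * X ^ (m + 2) := by
    intro E
    rw [List.length_finRange, mul_assoc]
    gcongr
    calc (width w.length + 1) * (2 ^ width w.length) ^ m ≤ X * X ^ m := by
          gcongr
          · exact width_lt _
          · exact two_pow_width_le _
      _ ≤ X * X ^ (m + 1) := by gcongr; omega
      _ = X ^ (m + 2) := by ring
  have hS : X ^ 2 ≤ X ^ (m + 2) := Nat.pow_le_pow_right hX1 (by omega)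
  have hS1 : 1 ≤ X ^ (m + 2) := Nat.one_le_pow _ _ hX1
  have h₃ := h₂.mono (T' := ((50 + m) + 4 + (unit.length + 1 + 12 * m) + 2 + C + (D + 12 * m)) *
      X ^ (m + 2)) (by
    have b₁ := hT (unit.length + 1 + 12 * m)
    have b₂ := hT (D + 12 * m)
    have b₃ := Nat.mul_le_mul_left (50 + m) hS
    have b₄ := Nat.mul_le_mul_left C hS
    simp only [List.length_finRange] at b₁ b₂ ⊢
    rw [add_mul _ (D + 12 * m), add_mul _ C, add_mul _ 2, add_mul _ (unit.length + 1 + 12 * m),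
      add_mul _ 4]
    simp only [List.length_cons, List.length_nil]
    omega)
  clear h₂
  generalize hE : ((50 + m) + 4 + (unit.length + 1 + 12 * m) + 2 + C + (D + 12 * m)) = E at *
  -- The output starts empty and a step adds at most one symbol to it.
  have hlen : (Θ.text tag unit w).length ≤ E * X ^ (m + 2) := by
    obtain ⟨t, ht, hr⟩ := h₃
    have := hr.length_le .out
    simp only [Store.stk, work, List.length_reverse, List.length_nil, List.reverse_nil] at this
    omega
  have h₄ := exec_clearAll (width w.length) (List.finRange m)
    (work (width w.length) [] (Θ.text tag unit w) fun _ => 0) (fun i => by simp [work])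
  simp only [List.mem_finRange, if_true, List.length_finRange] at h₄
  have h₅ := Exec.loop (m := m) (k := .out) (f := fun a => .push .res a) (T := 1)
    (fun (y : List Sym) l => ⟨[], [], l.reverse, y, [], fun _ => []⟩)
    (fun y a => a :: y) (fun _ _ => True)
    (fun _ _ => by simp [Store.stk]) (fun _ _ _ => Store.update_out _ _)
    (fun y a l _ => ⟨Exec.push_res a, trivial⟩) (Θ.text tag unit w).reverse [] trivial
  rw [foldl_cons, List.reverse_reverse, List.append_nil, List.length_reverse] at h₅
  refine (h₃.seq (h₄.seq h₅)).mono ?_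
  have b₁ : m * (2 * width w.length + 1) ≤ m * (2 * X ^ (m + 2)) := by
    gcongr
    have h₁ := width_lt w.length
    have h₂ : X ≤ X ^ (m + 2) := Nat.le_self_pow (by omega) X
    omega
  nlinarith

end Theory

end FactorModel

namespace FactorModel

/-! ### The ground instances as a model -/

/-- The number with given bits, least significant bit first. -/
def ofBits (l : List Bool) : ℕ := l.foldr (fun b n => Nat.bit b n) 0

theorem ofBits_lt (l : List Bool) : ofBits l < 2 ^ l.length := by
  induction l with
  | nil => simp [ofBits]
  | cons b l ih =>
    rw [List.length_cons, pow_succ]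
    have : ofBits (b :: l) = Nat.bit b (ofBits l) := rfl
    rw [this, Nat.bit_val]
    have := b.toNat_le
    omega

theorem ofBits_pos (l : List Bool) : 0 < ofBits (l ++ [true]) := by
  induction l with
  | nil => simp [ofBits]
  | cons b l ih =>
    have : ofBits (b :: l ++ [true]) = Nat.bit b (ofBits (l ++ [true])) := rfl
    rw [this, Nat.bit_val]
    omega

/-- With a final 1 as most significant digit the string is canonical, so `Nat.bits` returns it
unchanged. For this reason the tag of a relation ends in `true`: the concatenated counters and tag
are then literally the encoding of a number. -/
theorem bits_ofBits (l : List Bool) : (ofBits (l ++ [true])).bits = l ++ [true] := by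
  induction l with
  | nil => simp [ofBits]
  | cons b l ih =>
    have h := ofBits_pos l
    have : ofBits (b :: l ++ [true]) = Nat.bit b (ofBits (l ++ [true])) := rfl
    rw [this, Nat.bits_append_bit _ _ (fun e => by omega), ih]
    rfl

theorem binary_injective {w a b : ℕ} (ha : a < 2 ^ w) (hb : b < 2 ^ w)
    (h : binary w a = binary w b) : a = b := by
  induction w generalizing a b with
  | zero => simp at ha hb; omega
  | succ w ih =>
    rw [binary, binary, List.cons.injEq, decide_eq_decide] at h
    rw [pow_succ] at ha hb
    have := ih (a := a / 2) (b := b / 2) (by omega) (by omega) h.2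
    omega

/-- The bits that name a relation symbol. -/
noncomputable def relTag (R : Type) [Fintype R] (r : R) : List Bool :=
  binary (Fintype.card R) (Fintype.equivFin R r) ++ [true]

section Atoms

variable {R : Type} [Fintype R]

theorem length_relTag (r : R) : (relTag R r).length = Fintype.card R + 1 := by simp [relTag]

theorem relTag_injective : Function.Injective (relTag R) := by
  intro r s h
  have hval := binary_injective ((Fintype.equivFin R r).2.trans Nat.lt_two_pow_self)
    ((Fintype.equivFin R s).2.trans Nat.lt_two_pow_self) (List.append_cancel_right h)
  exact (Fintype.equivFin R).injective (Fin.ext hval)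

/-- The propositional variable of a ground atom. -/
noncomputable def atomVar (W : ℕ) (r : R) (a : Fin 3 → ℕ) : ℕ := ofBits (atomBits (relTag R) W r a)

theorem atomVar_lt (W : ℕ) (r : R) (a : Fin 3 → ℕ) :
    atomVar W r a < 2 ^ (W * 3 + (Fintype.card R + 1)) := by
  have := ofBits_lt (atomBits (relTag R) W r a)
  simp only [atomBits, List.length_append, length_binary, length_relTag] at this
  rwa [show W + W + W = W * 3 by omega] at this

theorem bits_atomVar (W : ℕ) (r : R) (a : Fin 3 → ℕ) :
    (atomVar W r a).bits = atomBits (relTag R) W r a := by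
  have := bits_ofBits (binary W (a 0) ++ binary W (a 1) ++ binary W (a 2) ++
    binary (Fintype.card R) (Fintype.equivFin R r))
  rw [List.append_assoc _ _ [true]] at this
  exact this

theorem encNat_atomVar (W : ℕ) (r : R) (a : Fin 3 → ℕ) :
    encNat (atomVar W r a) = (atomBits (relTag R) W r a).map Sym.bit := by
  rw [encNat, bits_atomVar]

/-- The fields have fixed lengths, so the concatenation splits uniquely. Only the truncated
arguments are recovered, since an argument may exceed the width. -/
theorem atomBits_eq {W : ℕ} {r s : R} {a b : Fin 3 → ℕ} (h : atomVar W r a = atomVar W s b) :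
    r = s ∧ ∀ k, binary W (a k) = binary W (b k) := by
  have h' : atomBits (relTag R) W r a = atomBits (relTag R) W s b := by
    rw [← bits_atomVar, h, bits_atomVar]
  obtain ⟨h₁, h₂⟩ := List.append_inj h' (by simp)
  obtain ⟨h₃, h₄⟩ := List.append_inj h₁ (by simp)
  obtain ⟨h₅, h₆⟩ := List.append_inj h₃ (by simp)
  refine ⟨relTag_injective h₂, fun k => ?_⟩
  fin_cases k
  exacts [h₅, h₆, h₄]

end Atoms

/-- The factor of a clause over binary variables that is falsified by the row `y₀`. -/
def clauseFactor {n k : ℕ} (var : Fin k ↪ Fin n) (y₀ : Fin k → Fin 2) :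
    Factor (fun _ : Fin n => 2) where
  arity := k
  scope := var
  val y := if y = y₀ then 0 else 1

theorem clauseFactor_isClause {n k : ℕ} (var : Fin k ↪ Fin n) (y₀ : Fin k → Fin 2) :
    (clauseFactor var y₀).IsClause := ⟨y₀, fun _ => rfl⟩

/-- A ground clause is true in a structure. -/
def Holds {R : Type} {m : ℕ} (A : R → (Fin 3 → ℕ) → Prop) (c : List (Lit R m)) (v : Fin m → ℕ) :
    Prop :=
  ∃ l ∈ c, (A l.rel (fun k => v (l.arg k)) ↔ l.pos = true)

theorem length_tuples {m : ℕ} (N : ℕ) (l : List (Fin m)) (v : Fin m → ℕ) :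
    (tuples N l v).length = N ^ l.length := by
  induction l generalizing v with
  | nil => simp [tuples]
  | cons i l ih => simp [tuples, List.length_flatMap, ih, pow_succ']

theorem mem_tuples {m : ℕ} {N : ℕ} {l : List (Fin m)} {v u : Fin m → ℕ} :
    u ∈ tuples N l v ↔ (∀ i ∈ l, u i < N) ∧ ∀ i ∉ l, u i = v i := by
  induction l generalizing v with
  | nil => simp [tuples, funext_iff]
  | cons i l ih =>
    simp only [tuples, List.mem_flatMap, List.mem_range, ih]
    constructor
    · rintro ⟨a, ha, h₁, h₂⟩
      refine ⟨fun j hj => ?_, fun j hj => ?_⟩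
      · by_cases hjl : j ∈ l
        · exact h₁ j hjl
        · obtain rfl : j = i := by simpa [hjl] using hj
          rw [h₂ j hjl, Function.update_self]
          exact ha
      · simp only [List.mem_cons, not_or] at hj
        rw [h₂ j hj.2, Function.update_of_ne hj.1]
    · rintro ⟨h₁, h₂⟩
      refine ⟨u i, h₁ i (by simp), fun j hj => h₁ j (by simp [hj]), fun j hj => ?_⟩
      by_cases hji : j = i
      · subst hji; simp
      · rw [Function.update_of_ne hji, h₂ j (by simp [hj, hji])]

namespace Theory

variable {R : Type} {m : ℕ} (Θ : Theory R m)

theorem mem_valuations {W : ℕ} {v : Fin m → ℕ} : v ∈ valuations m W ↔ ∀ i, v i < 2 ^ W := by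
  simp [valuations, mem_tuples]

theorem length_valuations (m W : ℕ) : (valuations m W).length = (2 ^ W) ^ m := by
  simp [valuations, length_tuples]

/-- The clauses of a theory. -/
def IsClauseOf (c : List (Lit R m)) : Prop :=
  c = Θ.first ∨ c = Θ.last ∨ c = Θ.next ∨ (∃ s, c = Θ.symb s) ∨ c ∈ Θ.rules

theorem posVal_lt {a n : ℕ} (h : a ≤ n + 1) (i : Fin m) : Θ.posVal a i < 2 ^ width n := by
  have := lt_two_pow_width n
  by_cases h₀ : i = Θ.i₀
  · subst h₀; simp [posVal]; omega
  · by_cases h₁ : i = Θ.i₁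
    · subst h₁; simp [posVal, h₀]; omega
    · simp [posVal, h₀, h₁]

theorem mem_posInstances {n : ℕ} {i : List (Lit R m) × (Fin m → ℕ)} (w : List Sym) (a : ℕ)
    (ha : a + w.length ≤ n) (hi : i ∈ Θ.posInstances a w) :
    Θ.IsClauseOf i.1 ∧ ∀ j, i.2 j < 2 ^ width n := by
  induction w generalizing a with
  | nil =>
    simp only [List.length_nil, add_zero] at ha
    simp only [posInstances, List.mem_cons, List.not_mem_nil, or_false] at hi
    rcases hi with rfl | rfl
    · exact ⟨by simp [IsClauseOf], Θ.posVal_lt (by omega)⟩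
    · exact ⟨by simp [IsClauseOf], Θ.posVal_lt (by omega)⟩
  | cons s w ih =>
    rw [List.length_cons] at ha
    simp only [posInstances, List.mem_cons] at hi
    rcases hi with rfl | rfl | hi
    · exact ⟨by simp [IsClauseOf], Θ.posVal_lt (by omega)⟩
    · exact ⟨by simp [IsClauseOf], Θ.posVal_lt (by omega)⟩
    · exact ih (a + 1) (by omega) hi

theorem mem_instances {w : List Sym} {i : List (Lit R m) × (Fin m → ℕ)} (hi : i ∈ Θ.instances w) :
    Θ.IsClauseOf i.1 ∧ ∀ j, i.2 j < 2 ^ width w.length := by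
  simp only [instances, List.cons_append, List.mem_cons, List.mem_append, List.mem_flatMap,
    List.mem_map] at hi
  rcases hi with rfl | rfl | hi | ⟨v, hv, c, hc, rfl⟩
  · exact ⟨by simp [IsClauseOf], Θ.posVal_lt (by omega)⟩
  · exact ⟨by simp [IsClauseOf], Θ.posVal_lt (by omega)⟩
  · exact Θ.mem_posInstances w 0 (by omega) hi
  · exact ⟨by simp [IsClauseOf, hc], mem_valuations.1 hv⟩

variable [Fintype R]

/-- The number of propositional variables. -/
def numVars (R : Type) [Fintype R] (m : ℕ) (w : List Sym) : ℕ :=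
  (2 ^ width w.length) ^ m * 2 ^ (Fintype.card R + 1)

/-- The number of variables is larger than necessary: it is a multiple of the number of valuations,
so that the list of cardinalities can be written by the same nested loops, one fixed block for each
valuation. Unused variables do not affect satisfiability. -/
theorem atomVar_lt_numVars (hm : 3 ≤ m) (w : List Sym) (r : R) (a : Fin 3 → ℕ) :
    atomVar (width w.length) r a < numVars R m w := by
  refine (atomVar_lt _ r a).trans_le ?_
  rw [numVars, pow_add, pow_mul]
  gcongr
  exact Nat.one_le_two_pow

/-- No two literals of a clause have the same relation symbol. -/
def IsLinear : Prop := ∀ c, Θ.IsClauseOf c → (c.map Lit.rel).Nodup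

variable {Θ}

/-- Distinct relation symbols give distinct tags, so no valuation can identify two atoms of the
clause. This is what allows its variables to be the scope of a factor. -/
theorem IsLinear.atomVar_injective (h : Θ.IsLinear) (W : ℕ) {c : List (Lit R m)}
    (hc : Θ.IsClauseOf c) (v : Fin m → ℕ) :
    Function.Injective fun i : Fin c.length =>
      atomVar W (c.get i).rel fun k => v ((c.get i).arg k) := by
  intro i j hij
  have h₁ := (atomBits_eq hij).1
  have h₂ := h c hc
  rw [List.nodup_iff_injective_get] at h₂
  have h₃ := @h₂ ⟨i, by simp⟩ ⟨j, by simp⟩ (by simpa using h₁)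
  simpa [Fin.ext_iff] using h₃

/-- The propositional variables of a ground clause. -/
noncomputable def clauseVars (h : Θ.IsLinear) (hm : 3 ≤ m) (w : List Sym)
    {c : List (Lit R m)} (hc : Θ.IsClauseOf c) (v : Fin m → ℕ) :
    Fin c.length ↪ Fin (numVars R m w) where
  toFun i := ⟨atomVar (width w.length) (c.get i).rel fun k => v ((c.get i).arg k),
    atomVar_lt_numVars hm w _ _⟩
  inj' _ _ hij := h.atomVar_injective _ hc v (congrArg Fin.val hij)

/-- The factors of the ground clauses. -/
noncomputable def groundFactors (h : Θ.IsLinear) (hm : 3 ≤ m) (w : List Sym) :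
    List (Factor fun _ : Fin (numVars R m w) => 2) :=
  (Θ.instances w).attach.map fun i =>
    clauseFactor (clauseVars h hm w (Θ.mem_instances i.2).1 i.1.2) (falsifier i.1.1)

/-- The instance of the ground clauses, with threshold zero. -/
noncomputable def query (h : Θ.IsLinear) (hm : 3 ≤ m) (w : List Sym) : Query where
  model :=
    { numVars := numVars R m w
      card := fun _ => 2
      card_pos := fun _ => by omega
      factors := groundFactors h hm w }
  k := 0

theorem query_isCNF (h : Θ.IsLinear) (hm : 3 ≤ m) (w : List Sym) :
    (query h hm w).model.IsCNF := by
  refine ⟨fun _ => rfl, fun f hf => ?_⟩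
  obtain ⟨i, _, rfl⟩ := List.mem_map.1 hf
  exact clauseFactor_isClause _ _

/-- The string written for each valuation: the numbers of values of some variables. -/
def unitStr (R : Type) [Fintype R] : List Sym :=
  (List.replicate (2 ^ (Fintype.card R + 1)) (encNat 2 ++ [Sym.comma])).flatten

/-- The variables were numbered so that this identity holds: the text produced with the raw digits
of the counters is the prescribed encoding. -/
theorem encode_query (h : Θ.IsLinear) (hm : 3 ≤ m) (w : List Sym) :
    (query h hm w).encode = Θ.text (relTag R) (unitStr R) w := by
  -- Zero has no binary digits, so the threshold is a slash followed by the denominator 1.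
  have e₁ : encRat 0 = [Sym.slash, Sym.bit true] := by simp [encRat, encNat]
  have e₂ : encList encNat (List.ofFn fun _ : Fin (numVars R m w) => 2)
      = (valuations m (width w.length)).flatMap (fun _ => unitStr R) ++ [Sym.semi] := by
    rw [encList, List.ofFn_const]
    congr 1
    have : ∀ (l : List (Fin m → ℕ)) (s : List Sym),
        l.flatMap (fun _ => s) = (List.replicate l.length s).flatten := by
      intro l s
      induction l with
      | nil => simp
      | cons a l ih => simp [ih, List.replicate_succ]
    rw [this, length_valuations, numVars, unitStr]
    generalize (2 ^ width w.length) ^ m = a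
    generalize 2 ^ (Fintype.card R + 1) = b
    rw [List.flatMap_def, List.map_replicate]
    induction a with
    | zero => simp
    | succ a ih =>
      rw [add_mul, one_mul, List.replicate_add, List.flatten_append, ih, List.replicate_succ',
        List.flatten_append]
      simp
  have e₃ : (groundFactors h hm w).flatMap Factor.encode
      = (Θ.instances w).flatMap fun i => clauseStr (relTag R) (width w.length) i.1 i.2 := by
    have key : ∀ (c : List (Lit R m)) (hc : Θ.IsClauseOf c) (v : Fin m → ℕ),
        (clauseFactor (clauseVars h hm w hc v) (falsifier c)).encode
          = clauseStr (relTag R) (width w.length) c v := by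
      intro c hc v
      have e : encList (fun u : Fin (numVars R m w) => encNat u)
          (List.ofFn (clauseVars h hm w hc v)) = c.flatMap (fun l =>
          (atomBits (relTag R) (width w.length) l.rel fun k => v (l.arg k)).map Sym.bit ++
            [Sym.comma]) ++ [Sym.semi] := by
        rw [encList, List.flatMap_def, List.flatMap_def, List.map_ofFn]
        conv_rhs => rw [← List.ofFn_get c, List.map_ofFn]
        congr 3
        funext i
        simp [clauseVars, encNat_atomVar]
      rw [clauseStr, List.append_cons, ← e]
      rfl
    rw [groundFactors, List.flatMap_map]
    simp only [key]
    conv_rhs => rw [← List.attach_map_subtype_val (Θ.instances w), List.flatMap_map]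
  change encRat 0 ++ Sym.semi :: (encList encNat (List.ofFn fun _ : Fin (numVars R m w) => 2) ++
    (groundFactors h hm w).flatMap Factor.encode) = _
  rw [e₁, e₂, e₃, text]
  simp

/-- A sum of nonnegative terms is positive exactly when one joint value is nonzero, that is, when no
clause is at its falsifying row. Assignments and structures are then matched atom by atom. -/
theorem dpr_query (h : Θ.IsLinear) (hm : 3 ≤ m) (w : List Sym) :
    DPR (query h hm w) ↔ ∃ A : R → (Fin 3 → ℕ) → Prop, ∀ i ∈ Θ.instances w, Holds A i.1 i.2 := by
  have h₁ : DPR (query h hm w) ↔ ∃ x : Fin (numVars R m w) → Fin 2, ∀ i (hi : i ∈ Θ.instances w),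
      (fun j => x (clauseVars h hm w (Θ.mem_instances hi).1 i.2 j)) ≠ falsifier i.1 := by
    have e : DPR (query h hm w) ↔ ∃ x, ((query h hm w).model.joint x : ℚ) ≠ 0 := by
      rw [DPR, gt_iff_lt]
      change 0 < _ ↔ _
      rw [(Finset.sum_nonneg fun x _ => NNRat.coe_nonneg _).lt_iff_ne', Ne,
        Finset.sum_eq_zero_iff_of_nonneg fun x _ => NNRat.coe_nonneg _]
      simp
    rw [e]
    refine exists_congr fun x => ?_
    rw [NNRat.coe_ne_zero]
    have key : ∀ x : Fin (numVars R m w) → Fin 2,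
        ((groundFactors h hm w).map fun f => f.eval x).prod ≠ 0 ↔ ∀ i (hi : i ∈ Θ.instances w),
          (fun j => x (clauseVars h hm w (Θ.mem_instances hi).1 i.2 j)) ≠ falsifier i.1 := by
      intro x
      rw [Ne, List.prod_eq_zero_iff, groundFactors, List.map_map]
      simp only [List.mem_map, List.mem_attach, true_and, Subtype.exists, not_exists]
      refine forall_congr' fun i => forall_congr' fun hi => ?_
      simp [Factor.eval, clauseFactor]
    exact key x
  have h₂ : ∀ (c : List (Lit R m)) (y : Fin c.length → Fin 2),
      y ≠ falsifier c ↔ ∃ j, (y j = 1 ↔ (c.get j).pos = true) := by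
    intro c y
    rw [Ne, funext_iff, not_forall]
    refine exists_congr fun j => ?_
    rw [falsifier]
    generalize y j = b
    generalize (c.get j).pos = p
    revert b p
    decide
  rw [h₁]
  simp only [h₂]
  constructor
  · rintro ⟨x, hx⟩
    refine ⟨fun r a => x ⟨_, atomVar_lt_numVars hm w r a⟩ = 1, fun i hi => ?_⟩
    obtain ⟨j, hj⟩ := hx i hi
    exact ⟨i.1.get j, List.get_mem _ _, hj⟩
  · rintro ⟨A, hA⟩
    classical
    -- Restricting to arguments that fit into the counters makes the atom coded by `u` unique; all
    -- ground instances use only such arguments.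
    refine ⟨fun u => if ∃ r a, (∀ k, a k < 2 ^ width w.length) ∧ atomVar (width w.length) r a = u ∧
      A r a then 1 else 0, fun i hi => ?_⟩
    obtain ⟨l, hl, hl'⟩ := hA i hi
    obtain ⟨j, rfl⟩ := List.get_of_mem hl
    refine ⟨j, Iff.trans ?_ hl'⟩
    simp only [ite_eq_left_iff, zero_ne_one, imp_false, not_not]
    constructor
    · rintro ⟨r, a, ha, e, h⟩
      obtain ⟨e₁, e₂⟩ := atomBits_eq (s := (i.1.get j).rel)
        (b := fun k => i.2 ((i.1.get j).arg k)) e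
      have : a = fun k => i.2 ((i.1.get j).arg k) :=
        funext fun k => binary_injective (ha k) ((Θ.mem_instances hi).2 _) (e₂ k)
      rwa [← e₁, ← this]
    · exact fun h => ⟨_, _, fun k => (Θ.mem_instances hi).2 _, rfl, h⟩

end Theory

end FactorModel

namespace FactorModel

/-! ### Clauses with repeated relation symbols -/

namespace Theory

variable {R : Type} {m : ℕ} (Θ : Theory R m)

/-- Give the literals of a clause copies of their relation symbols that are numbered by the
positions in the clause. -/
def slotted (S : ℕ) [NeZero S] (c : List (Lit R m)) : List (Lit (R × Fin S) m) :=
  c.mapIdx fun i l => ⟨(l.rel, Fin.ofNat S i), l.arg, l.pos⟩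

/-- The copy `s` of the relation `r` implies the copy `t`. -/
def link {S : ℕ} (a : Fin 3 → Fin m) (r : R) (s t : Fin S) : List (Lit (R × Fin S) m) :=
  [⟨(r, s), a, false⟩, ⟨(r, t), a, true⟩]

/-- All the links between different copies. -/
noncomputable def links [Fintype R] (S : ℕ) (a : Fin 3 → Fin m) :
    List (List (Lit (R × Fin S) m)) :=
  ((Finset.univ : Finset (R × Fin S × Fin S)).filter fun x => x.2.1 ≠ x.2.2).toList.map
    fun x => link a x.1 x.2.1 x.2.2

/-- A theory without repeated relation symbols in the clauses. -/
noncomputable def linearize [Fintype R] (S : ℕ) [NeZero S] (a : Fin 3 → Fin m) :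
    Theory (R × Fin S) m where
  i₀ := Θ.i₀
  i₁ := Θ.i₁
  ne := Θ.ne
  first := slotted S Θ.first
  last := slotted S Θ.last
  next := slotted S Θ.next
  symb s := slotted S (Θ.symb s)
  rules := Θ.rules.map (slotted S) ++ links S a

variable [Fintype R] {S : ℕ} [NeZero S] {a : Fin 3 → Fin m}

theorem isLinear_linearize (hS : ∀ c, Θ.IsClauseOf c → c.length ≤ S) :
    (Θ.linearize S a).IsLinear := by
  have key : ∀ c, Θ.IsClauseOf c → ((slotted S c).map Lit.rel).Nodup := by
    intro c hc
    rw [slotted, List.nodup_iff_injective_get]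
    intro i j hij
    have hi := i.2
    have hj := j.2
    simp only [List.length_map, List.length_mapIdx] at hi hj
    have h := congrArg (fun x : R × Fin S => (x.2 : ℕ)) hij
    simp only [List.get_eq_getElem, List.getElem_map, List.getElem_mapIdx,
      Fin.val_ofNat] at h
    have := hS c hc
    -- No clause is longer than `S`, so the copy numbers do not wrap around.
    rw [Nat.mod_eq_of_lt (by omega), Nat.mod_eq_of_lt (by omega)] at h
    exact Fin.ext h
  rintro c (rfl | rfl | rfl | ⟨s, rfl⟩ | hc)
  · exact key _ (by simp [IsClauseOf])
  · exact key _ (by simp [IsClauseOf])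
  · exact key _ (by simp [IsClauseOf])
  · exact key _ (by simp [IsClauseOf])
  · simp only [linearize, List.mem_append, List.mem_map, links, Finset.mem_toList,
      Finset.mem_filter, Finset.mem_univ, true_and] at hc
    rcases hc with ⟨c, hc, rfl⟩ | ⟨x, hx, rfl⟩
    · exact key _ (by simp [IsClauseOf, hc])
    · simp [link, hx]

theorem posInstances_linearize (n : ℕ) (w : List Sym) :
    (Θ.linearize S a).posInstances n w
      = (Θ.posInstances n w).map fun i => (slotted S i.1, i.2) := by
  induction w generalizing n with
  | nil => rfl
  | cons s w ih => rw [posInstances, ih]; rfl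

theorem mem_instances_linearize {w : List Sym} {i : List (Lit (R × Fin S) m) × (Fin m → ℕ)} :
    i ∈ (Θ.linearize S a).instances w ↔ (∃ j ∈ Θ.instances w, i = (slotted S j.1, j.2)) ∨
      ∃ v, (∀ k, v k < 2 ^ width w.length) ∧ ∃ r s t, s ≠ t ∧ i = (link a r s t, v) := by
  have hl : ∀ c, c ∈ links (R := R) S a ↔ ∃ r s t, s ≠ t ∧ c = link a r s t := by
    intro c
    simp only [links, List.mem_map, Finset.mem_toList, Finset.mem_filter, Finset.mem_univ, true_and,
      Prod.exists]
    constructor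
    · rintro ⟨r, s, t, h, rfl⟩; exact ⟨r, s, t, h, rfl⟩
    · rintro ⟨r, s, t, h, rfl⟩; exact ⟨r, s, t, h, rfl⟩
  have hr : (Θ.linearize S a).rules = Θ.rules.map (slotted S) ++ links S a := rfl
  simp only [instances, posInstances_linearize, List.cons_append, List.mem_cons, List.mem_append,
    List.mem_map, List.mem_flatMap, mem_valuations, hr]
  constructor
  · rintro (rfl | rfl | ⟨j, hj, rfl⟩ | ⟨v, hv, c, ⟨c, hc, rfl⟩ | hc, rfl⟩)
    · exact Or.inl ⟨_, Or.inl rfl, rfl⟩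
    · exact Or.inl ⟨_, Or.inr (Or.inl rfl), rfl⟩
    · exact Or.inl ⟨_, Or.inr (Or.inr (Or.inl hj)), rfl⟩
    · exact Or.inl ⟨(c, v), Or.inr (Or.inr (Or.inr ⟨v, hv, c, hc, rfl⟩)), rfl⟩
    · obtain ⟨r, s, t, h, rfl⟩ := (hl c).1 hc
      exact Or.inr ⟨v, hv, r, s, t, h, rfl⟩
  · rintro (⟨j, rfl | rfl | hj | ⟨v, hv, c, hc, rfl⟩, rfl⟩ | ⟨v, hv, r, s, t, h, rfl⟩)
    · exact Or.inl rfl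
    · exact Or.inr (Or.inl rfl)
    · exact Or.inr (Or.inr (Or.inl ⟨j, hj, rfl⟩))
    · exact Or.inr (Or.inr (Or.inr ⟨v, hv, _, Or.inl ⟨c, hc, rfl⟩, rfl⟩))
    · exact Or.inr (Or.inr (Or.inr ⟨v, hv, _, Or.inr ((hl _).2 ⟨r, s, t, h, rfl⟩), rfl⟩))

/-- The links run in both directions between any two copies, so all copies of a relation agree on
arguments within range. Any copy then serves as the original relation; conversely, all copies can be
interpreted by the same relation. -/
theorem exists_structure_linearize (ha : Function.Injective a) (w : List Sym) :
    (∃ A : R × Fin S → (Fin 3 → ℕ) → Prop, ∀ i ∈ (Θ.linearize S a).instances w, Holds A i.1 i.2) ↔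
      ∃ A : R → (Fin 3 → ℕ) → Prop, ∀ i ∈ Θ.instances w, Holds A i.1 i.2 := by
  constructor
  · rintro ⟨A, hA⟩
    have hlink : ∀ r s t (b : Fin 3 → ℕ), (∀ k, b k < 2 ^ width w.length) →
        A (r, s) b → A (r, t) b := by
      intro r s t b hb h
      by_cases hst : s = t
      · rwa [← hst]
      -- Since `a` is injective, every triple within range arises from a valuation, so the link is
      -- grounded at it.
      · set v : Fin m → ℕ := Function.extend a b fun _ => 0
        have hv : ∀ k, v (a k) = b k := ha.extend_apply b _
        have hv' : ∀ k, v k < 2 ^ width w.length := by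
          intro k
          by_cases hk : ∃ j, a j = k
          · obtain ⟨j, rfl⟩ := hk
            rw [hv]; exact hb j
          · simp only [v]
            rw [Function.extend_apply' _ _ _ hk]
            positivity
        have := hA (link a r s t, v) (Θ.mem_instances_linearize.2
          (Or.inr ⟨v, hv', r, s, t, hst, rfl⟩))
        simpa [Holds, link, hv, h] using this
    refine ⟨fun r b => A (r, 0) b, fun i hi => ?_⟩
    obtain ⟨l, hl, hl'⟩ := hA _ (Θ.mem_instances_linearize.2 (Or.inl ⟨i, hi, rfl⟩))
    simp only [slotted, List.mem_mapIdx] at hl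
    obtain ⟨j, hj, rfl⟩ := hl
    refine ⟨i.1[j], List.getElem_mem _, ?_⟩
    have hb : ∀ k, i.2 (i.1[j].arg k) < 2 ^ width w.length :=
      fun k => (Θ.mem_instances hi).2 _
    exact (Iff.intro (hlink _ _ _ _ hb) (hlink _ _ _ _ hb)).trans hl'
  · rintro ⟨A, hA⟩
    refine ⟨fun r b => A r.1 b, fun i hi => ?_⟩
    rcases Θ.mem_instances_linearize.1 hi with ⟨j, hj, rfl⟩ | ⟨v, -, r, s, t, -, rfl⟩
    · obtain ⟨l, hl, hl'⟩ := hA j hj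
      obtain ⟨k, hk, rfl⟩ := List.getElem_of_mem hl
      exact ⟨⟨(j.1[k].rel, Fin.ofNat S k), j.1[k].arg, j.1[k].pos⟩,
        List.mem_mapIdx.2 ⟨k, hk, rfl⟩, hl'⟩
    · by_cases h : A r fun k => v (a k)
      · exact ⟨⟨(r, t), a, true⟩, by simp [link], by simp [h]⟩
      · exact ⟨⟨(r, s), a, false⟩, by simp [link], by simp [h]⟩

/-- The existence of a structure in which the ground instances of a theory hold is reducible in
polynomial time to the satisfiability of a CNF. -/
theorem exists_reduction {α : Type} (e : α → List Sym) (hm : 3 ≤ m) :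
    ∃ r : α → Query, Nonempty (Turing.TM2ComputableInPolyTime e Query.encode r) ∧
      ∀ x, ((r x).model.IsCNF ∧ (r x).k = 0) ∧
        (DPR (r x) ↔ ∃ A : R → (Fin 3 → ℕ) → Prop, ∀ i ∈ Θ.instances (e x), Holds A i.1 i.2) := by
  -- Any common bound on the lengths of the clauses works; the final `1` keeps it nonzero.
  let S := (Finset.univ.sup fun s => (Θ.symb s).length) + Θ.first.length + Θ.last.length +
    Θ.next.length + (Θ.rules.map List.length).sum + 1
  have hS : ∀ c, Θ.IsClauseOf c → c.length ≤ S := by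
    rintro c (rfl | rfl | rfl | ⟨s, rfl⟩ | hc)
    · omega
    · omega
    · omega
    · have := Finset.le_sup (f := fun s => (Θ.symb s).length) (Finset.mem_univ s)
      omega
    · have := List.single_le_sum (l := Θ.rules.map List.length) (by simp) _
        (List.mem_map_of_mem hc)
      omega
  have ha : Function.Injective (Fin.castLE hm) := Fin.castLE_injective hm
  have hlin := Θ.isLinear_linearize (a := Fin.castLE hm) hS
  refine ⟨fun x => query hlin hm (e x), ?_, fun x => ⟨⟨query_isCNF _ _ _, rfl⟩, ?_⟩⟩
  · obtain ⟨C, hC⟩ := (Θ.linearize S (Fin.castLE hm)).exec_program (relTag (R × Fin S))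
      (unitStr (R × Fin S))
    refine Cmd.Run.tm2ComputableInPolyTime (c := (Θ.linearize S (Fin.castLE hm)).program
      (relTag (R × Fin S)) (unitStr (R × Fin S))) Stk.inp Stk.res
      (Polynomial.C C * (4 * (Polynomial.X + 1)) ^ (m + 2)) fun x => ?_
    obtain ⟨t, ht, hr⟩ := hC (e x)
    refine ⟨t, by simpa using ht, ?_⟩
    rw [encode_query]
    have e₁ : ∀ l : List Sym, Function.update (fun _ : Stk m => []) Stk.inp l
        = Store.stk ⟨l, [], [], [], [], fun _ => []⟩ := by
      intro l
      funext k
      cases k <;> simp [Store.stk]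
    have e₂ : ∀ l : List Sym, Function.update (fun _ : Stk m => []) Stk.res l
        = Store.stk ⟨[], [], [], l, [], fun _ => []⟩ := by
      intro l
      funext k
      cases k <;> simp [Store.stk]
    rw [e₁, e₂]
    exact hr
  · rw [dpr_query, Θ.exists_structure_linearize ha]

end Theory

end FactorModel

namespace FactorModel

/-! ### Evaluation of an instance in one scan of its encoding -/

/-- The modes of the scan. -/
inductive Mode
  | kNum | kDen | card | cardRest | scope | scopeRest | tab | tabSkip | num | den | done | dead
  deriving DecidableEq

instance : Fintype Mode :=
  Fintype.ofList [.kNum, .kDen, .card, .cardRest, .scope, .scopeRest, .tab, .tabSkip, .num, .den,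
    .done, .dead] fun m => by cases m <;> simp

/-- The large registers: two products `x` and `y`, a shifted factor `s` and an accumulator `a`. -/
inductive Reg
  | x | y | s | a
  deriving DecidableEq

instance : Fintype Reg := Fintype.ofList [.x, .y, .s, .a] fun r => by cases r <;> simp

/-- Operations on the large registers. -/
inductive RegOp
  | keep | bit (b : Bool) | swap | finish

/-- Operations on the stride. -/
inductive StrideOp
  | keep | one | inc | mul

/-- Operations on the target row. -/
inductive TargetOp
  | keep | dec | add

structure Instr where
  mode : Mode
  reg : RegOp := .keep
  stride : StrideOp := .keep
  target : TargetOp := .keep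

/-- The instruction for a mode and a symbol; `z` tells whether the target row is `0`. -/
def instr : Mode → Sym → Bool → Instr
  | .kNum, .bit b, _ => { mode := .kNum, reg := .bit b }
  | .kNum, .slash, _ => { mode := .kDen, reg := .swap }
  | .kDen, .bit b, _ => { mode := .kDen, reg := .bit b }
  | .kDen, .semi, _ => { mode := .card, reg := .finish }
  | .card, .bit _, _ => { mode := .cardRest }
  | .card, .semi, _ => { mode := .scope, stride := .one }
  | .cardRest, .bit _, _ => { mode := .cardRest }
  | .cardRest, .comma, _ => { mode := .card, stride := .inc }
  | .scope, .bit _, _ => { mode := .scopeRest, stride := .mul, target := .add }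
  | .scope, .comma, _ => { mode := .scope, stride := .mul, target := .add }
  | .scope, .semi, _ => { mode := .tab }
  | .scopeRest, .bit _, _ => { mode := .scopeRest }
  | .scopeRest, .comma, _ => { mode := .scope }
  | .tab, .bit b, true => { mode := .num, reg := .bit b }
  | .tab, .slash, true => { mode := .den, reg := .swap }
  | .tab, .bit _, false => { mode := .tabSkip, target := .dec }
  | .tab, .slash, false => { mode := .tabSkip, target := .dec }
  | .tabSkip, .comma, _ => { mode := .tab }
  | .tabSkip, .bit _, _ => { mode := .tabSkip }
  | .tabSkip, .slash, _ => { mode := .tabSkip }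
  | .num, .bit b, _ => { mode := .num, reg := .bit b }
  | .num, .slash, _ => { mode := .den, reg := .swap }
  | .den, .bit b, _ => { mode := .den, reg := .bit b }
  | .den, .comma, _ => { mode := .done, reg := .swap }
  | .done, .semi, _ => { mode := .scope, stride := .one }
  | .done, .bit _, _ => { mode := .done }
  | .done, .slash, _ => { mode := .done }
  | .done, .comma, _ => { mode := .done }
  | _, _, _ => { mode := .dead }

/-- The state of the scan: the `stride` is also used to count the variables, and `seen` is the
number of variables whose number of values has been read. -/
structure State where
  mode : Mode
  x : ℕ
  y : ℕ
  s : ℕ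
  a : ℕ
  stride : ℕ
  target : ℕ
  seen : ℕ

def State.reg (st : State) : Reg → ℕ
  | .x => st.x
  | .y => st.y
  | .s => st.s
  | .a => st.a

/-- The new contents of a register. -/
inductive Src
  | copy (r : Reg) | zero | dbl | sum

/-- A product is computed by shift and add: `s` starts as the old product, doubles at each digit and
is added to `a` at a digit 1. A swap stores `a` in `y`, moves the other product into `x` and `s`,
and clears `a`. Two swaps, after numerator and denominator, thus multiply both products and restore
their places. After the threshold, `finish` leaves the denominator in `x` and the numerator in `y`.
-/
def RegOp.src : RegOp → Reg → Src
  | .keep, r => .copy r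
  | .bit _, .s => .dbl
  | .bit true, .a => .sum
  | .bit _, r => .copy r
  | .swap, .x => .copy .y
  | .swap, .y => .copy .a
  | .swap, .s => .copy .y
  | .swap, .a => .zero
  | .finish, .x => .copy .a
  | .finish, .y => .copy .y
  | .finish, .s => .copy .a
  | .finish, .a => .zero

def Src.eval (st : State) : Src → ℕ
  | .copy r => st.reg r
  | .zero => 0
  | .dbl => 2 * st.s
  | .sum => st.a + st.s

/-- The number written at the beginning of a string. -/
def numAt : List Sym → ℕ
  | .bit b :: l => 2 * numAt l + b.toNat
  | _ => 0

/-- The numbers of values of the variables, and an instantiation. -/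
structure Env where
  card : ℕ → ℕ
  val : ℕ → ℕ

/-- The number of a variable is looked up as a whole at its first symbol, via `numAt` on the
remaining string; its further digits are skipped. -/
def StrideOp.eval (E : Env) (st : State) (l : List Sym) : StrideOp → ℕ
  | .keep => st.stride
  | .one => 1
  | .inc => st.stride + 1
  | .mul => st.stride * E.card (numAt l)

def TargetOp.eval (E : Env) (st : State) (l : List Sym) : TargetOp → ℕ
  | .keep => st.target
  | .dec => st.target - 1
  | .add => st.target + st.stride * E.val (numAt l)

/-- The instruction in a state. -/
def State.instr (st : State) (c : Sym) : Instr := FactorModel.instr st.mode c (decide (st.target = 0))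

/-- A step of the scan; `c :: l` is the rest of the string. -/
def Env.step (E : Env) (st : State) (c : Sym) (l : List Sym) : State where
  mode := (st.instr c).mode
  x := ((st.instr c).reg.src .x).eval st
  y := ((st.instr c).reg.src .y).eval st
  s := ((st.instr c).reg.src .s).eval st
  a := ((st.instr c).reg.src .a).eval st
  stride := (st.instr c).stride.eval E st (c :: l)
  target := (st.instr c).target.eval E st (c :: l)
  seen := if st.mode = .card ∧ ∃ b, c = .bit b then st.seen + 1 else st.seen

theorem Env.reg_step (E : Env) (st : State) (c : Sym) (l : List Sym) (r : Reg) :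
    (E.step st c l).reg r = ((st.instr c).reg.src r).eval st := by
  cases r <;> rfl

/-- What a step has to satisfy: the small numbers are at most `B`, and the numbers of values of the
`n` variables are those of `E`. -/
structure Env.Good (E : Env) (n B : ℕ) (st : State) (c : Sym) (l : List Sym) : Prop where
  stride_le : (E.step st c l).stride ≤ B
  target_le : (E.step st c l).target ≤ B
  card : st.mode = .card → (∃ b, c = .bit b) →
    st.stride = st.seen ∧ st.seen < n ∧ E.card st.seen = numAt (c :: l)
  scope : st.mode = .scope → c ≠ .semi → numAt (c :: l) < st.seen ∧ numAt (c :: l) ≤ B ∧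
    0 < E.card (numAt (c :: l)) ∧ E.card (numAt (c :: l)) ≤ B ∧
      E.val (numAt (c :: l)) < E.card (numAt (c :: l))

/-- `E.Path n B st l st' l'`: the scan leads from the state `st` at the rest `l` of the string to the
state `st'` at the rest `l'`, by good steps. -/
inductive Env.Path (E : Env) (n B : ℕ) : State → List Sym → State → List Sym → Prop
  | refl (st l) : Path E n B st l st l
  | step {st c l st' l'} : E.Good n B st c l → Path E n B (E.step st c l) l st' l' →
      Path E n B st (c :: l) st' l'

namespace Env

variable {E : Env} {n B : ℕ}

theorem Path.trans {st st' st'' : State} {l l' l'' : List Sym} (h : E.Path n B st l st' l')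
    (h' : E.Path n B st' l' st'' l'') : E.Path n B st l st'' l'' := by
  induction h with
  | refl => exact h'
  | step hg _ ih => exact .step hg (ih h')

theorem Path.single {st st' : State} {c : Sym} {l : List Sym} (h : E.Good n B st c l)
    (e : E.step st c l = st') : E.Path n B st (c :: l) st' l :=
  .step h (e ▸ .refl _ _)

/-- Steps outside the lists of variables. -/
theorem Path.plain {st st' : State} {c : Sym} {l : List Sym} (e : E.step st c l = st')
    (h₁ : st'.stride ≤ B) (h₂ : st'.target ≤ B) (h₃ : st.mode = .card → c = .semi)
    (h₄ : st.mode = .scope → c = .semi) : E.Path n B st (c :: l) st' l := by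
  refine .single ⟨by rwa [e], by rwa [e], fun h ⟨b, hb⟩ => ?_, fun h h' => absurd (h₄ h) h'⟩ e
  have := h₃ h
  simp [hb] at this

theorem ofBits_cons (b : Bool) (l : List Bool) : ofBits (b :: l) = 2 * ofBits l + b.toNat := by
  change Nat.bit b (ofBits l) = _
  rw [Nat.bit_val]

theorem ofBits_bits (k : ℕ) : ofBits k.bits = k := by
  induction k using Nat.binaryRec' with
  | zero => simp [ofBits]
  | bit b k h ih =>
    rw [Nat.bits_append_bit k b h, ofBits_cons, ih, Nat.bit_val]

theorem numAt_encNat (k : ℕ) {c : Sym} (hc : ∀ b, c ≠ .bit b) (l : List Sym) :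
    numAt (encNat k ++ c :: l) = k := by
  have : ∀ bs : List Bool, numAt (bs.map Sym.bit ++ c :: l) = ofBits bs := by
    intro bs
    induction bs with
    | nil =>
      cases c with
      | bit b => exact absurd rfl (hc b)
      | _ => rfl
    | cons b bs ih => rw [ofBits_cons, ← ih]; rfl
  rw [encNat, this, ofBits_bits]

/-- Reading the digits of a factor of a product. -/
theorem Path.digits {M : Mode} (hM : M = .kNum ∨ M = .kDen ∨ M = .num ∨ M = .den)
    {x y s a u t k : ℕ} (hu : u ≤ B) (ht : t ≤ B) (bs : List Bool) (l : List Sym) :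
    ∃ s', E.Path n B ⟨M, x, y, s, a, u, t, k⟩ (bs.map Sym.bit ++ l)
      ⟨M, x, y, s', a + s * ofBits bs, u, t, k⟩ l := by
  induction bs generalizing s a with
  | nil => exact ⟨s, by simpa [ofBits] using .refl _ _⟩
  | cons b bs ih =>
    obtain ⟨s', h⟩ := ih (s := 2 * s) (a := a + s * b.toNat)
    refine ⟨s', ?_⟩
    rw [ofBits_cons, show a + s * (2 * ofBits bs + b.toNat)
      = a + s * b.toNat + 2 * s * ofBits bs by ring]
    refine Path.trans (Path.plain (st' := ⟨M, x, y, 2 * s, a + s * b.toNat, u, t, k⟩) ?_ hu ht ?_ ?_) h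
    · rcases hM with rfl | rfl | rfl | rfl <;> cases b <;>
        simp [Env.step, State.instr, instr, RegOp.src, Src.eval, State.reg, StrideOp.eval,
          TargetOp.eval]
    · rcases hM with rfl | rfl | rfl | rfl <;> simp
    · rcases hM with rfl | rfl | rfl | rfl <;> simp

/-- Steps that change nothing. -/
theorem Path.skip {st : State} (hu : st.stride ≤ B) (ht : st.target ≤ B) (h₁ : st.mode ≠ .card)
    (h₂ : st.mode ≠ .scope) (l l' : List Sym)
    (hl : ∀ c ∈ l, instr st.mode c (decide (st.target = 0)) = { mode := st.mode }) :
    E.Path n B st (l ++ l') st l' := by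
  induction l with
  | nil => exact .refl _ _
  | cons c l ih =>
    refine Path.trans (Path.plain ?_ hu ht (fun h => absurd h h₁) (fun h => absurd h h₂))
      (ih fun c hc => hl c (by simp [hc]))
    obtain ⟨M, x, y, s, a, u, t, k⟩ := st
    have := hl c (by simp)
    simp only at this h₁
    simp [Env.step, State.instr, this, RegOp.src, Src.eval, State.reg, StrideOp.eval, TargetOp.eval, h₁]

theorem Path.skip_encNat {M : Mode} (hM : M = .cardRest ∨ M = .scopeRest)
    {x y s a u t k : ℕ} (hu : u ≤ B) (ht : t ≤ B) (bs : List Bool) (l : List Sym) :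
    E.Path n B ⟨M, x, y, s, a, u, t, k⟩ (bs.map Sym.bit ++ l) ⟨M, x, y, s, a, u, t, k⟩ l := by
  refine Path.skip hu ht ?_ ?_ _ _ ?_
  · rcases hM with rfl | rfl <;> simp
  · rcases hM with rfl | rfl <;> simp
  · intro c hc
    obtain ⟨b, -, rfl⟩ := List.mem_map.1 hc
    rcases hM with rfl | rfl <;> rfl

theorem encList_cons {α : Type} (e : α → List Sym) (b : α) (L : List α) (l : List Sym) :
    encList e (b :: L) ++ l = e b ++ Sym.comma :: (encList e L ++ l) := by
  simp [encList]

/-- Reading the numbers of values of the variables. -/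
theorem Path.cards {x y s a k : ℕ} (hB : 1 ≤ B) (L : List ℕ) (l : List Sym) (hL : k + L.length ≤ n)
    (hn : n ≤ B) (hE : ∀ j (hj : j < L.length), E.card (k + j) = L[j] ∧ 0 < L[j]) :
    E.Path n B ⟨.card, x, y, s, a, k, 0, k⟩ (encList encNat L ++ l)
      ⟨.scope, x, y, s, a, 1, 0, k + L.length⟩ l := by
  induction L generalizing k with
  | nil =>
    refine Path.plain ?_ (by simpa using hB) (by simp) (by simp) (by simp)
    simp [Env.step, State.instr, instr, RegOp.src, Src.eval, State.reg, StrideOp.eval, TargetOp.eval]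
  | cons c L ih =>
    rw [List.length_cons] at hL ⊢
    obtain ⟨h₁, h₂⟩ := hE 0 (by simp)
    simp only [add_zero, List.getElem_cons_zero] at h₁ h₂
    have ih' := ih (k := k + 1) (by omega) (fun j hj => by
      have := hE (j + 1) (by simp; omega)
      simpa [add_comm, add_left_comm, add_assoc] using this)
    rw [show k + (L.length + 1) = k + 1 + L.length by omega, encList_cons]
    have hnum := numAt_encNat c (c := .comma) (by simp) (encList encNat L ++ l)
    -- A cardinality is positive and so has a first digit, at which it is recorded.
    have hne : c.bits ≠ [] := by
      intro h
      have := ofBits_bits c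
      rw [h] at this
      simp [ofBits] at this
      omega
    obtain ⟨b, bs, hb⟩ := List.exists_cons_of_ne_nil hne
    rw [encNat, hb, List.map_cons, List.cons_append] at hnum ⊢
    -- The count `seen` rises at the first digit, but the stride only at the comma: the stride must
    -- still be the index of this variable when its cardinality is recorded.
    refine Path.trans (Path.single (st' := ⟨.cardRest, x, y, s, a, k, 0, k + 1⟩)
      ⟨?_, ?_, ?_, ?_⟩ ?_) (Path.trans (Path.skip_encNat (Or.inl rfl) (by omega) (by omega) bs _)
        (Path.trans (Path.plain (st' := ⟨.card, x, y, s, a, k + 1, 0, k + 1⟩) ?_ ?_ ?_ ?_ ?_) ih'))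
    · simp [Env.step, State.instr, instr, StrideOp.eval]; omega
    · simp [Env.step, State.instr, instr, TargetOp.eval]
    · exact fun _ _ => ⟨rfl, by simp only; omega, by rw [h₁, hnum]⟩
    · simp
    · simp [Env.step, State.instr, instr, RegOp.src, Src.eval, State.reg, StrideOp.eval, TargetOp.eval]
    · simp [Env.step, State.instr, instr, RegOp.src, Src.eval, State.reg, StrideOp.eval, TargetOp.eval]
    · simp only; omega
    · simp
    · simp
    · simp

/-- The stride and the target row after the variables of a list. -/
def rowOf (E : Env) (p : ℕ × ℕ) (L : List ℕ) : ℕ × ℕ :=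
  L.foldl (fun p v => (p.1 * E.card v, p.2 + p.1 * E.val v)) p

/-- Reading the variables of a factor. -/
theorem Path.scope {x y s a u t k : ℕ} (L : List ℕ) (l : List Sym)
    (hE : ∀ v ∈ L, v < k ∧ v ≤ B ∧ 0 < E.card v ∧ E.card v ≤ B ∧ E.val v < E.card v)
    (ht : t < u) (hu : (E.rowOf (u, t) L).1 ≤ B) :
    E.Path n B ⟨.scope, x, y, s, a, u, t, k⟩ (encList encNat L ++ l)
      ⟨.tab, x, y, s, a, (E.rowOf (u, t) L).1, (E.rowOf (u, t) L).2, k⟩ l ∧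
      (E.rowOf (u, t) L).2 < (E.rowOf (u, t) L).1 ∧ u ≤ (E.rowOf (u, t) L).1 := by
  induction L generalizing u t with
  | nil =>
    refine ⟨Path.plain ?_ hu ?_ (by simp) (by simp), ht, le_rfl⟩
    · simp [Env.step, State.instr, instr, RegOp.src, Src.eval, State.reg, StrideOp.eval, TargetOp.eval,
        rowOf]
    · exact ht.le.trans hu
  | cons v L ih =>
    obtain ⟨h₁, h₂, h₃, h₄, h₅⟩ := hE v (by simp)
    have e : E.rowOf (u, t) (v :: L) = E.rowOf (u * E.card v, t + u * E.val v) L := rfl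
    rw [e] at hu ⊢
    -- The mixed-radix invariant: a row number stays below the stride.
    have ht' : t + u * E.val v < u * E.card v := by
      calc t + u * E.val v < u + u * E.val v := by omega
        _ = u * (E.val v + 1) := by ring
        _ ≤ u * E.card v := Nat.mul_le_mul_left _ h₅
    obtain ⟨ih₁, ih₂, ih₃⟩ := ih (fun v hv => hE v (by simp [hv])) ht' hu
    refine ⟨?_, ih₂, (Nat.le_mul_of_pos_right u h₃).trans ih₃⟩
    have hnum := numAt_encNat v (c := .comma) (by simp) (encList encNat L ++ l)
    rw [encList_cons]
    rw [encNat] at hnum ⊢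
    -- Variable 0 is written without digits; the comma then takes the role of the first digit.
    cases hb : v.bits with
    | nil =>
      rw [hb, List.map_nil, List.nil_append] at hnum
      refine Path.trans (Path.single (st' := ⟨.scope, x, y, s, a, u * E.card v,
        t + u * E.val v, k⟩) ⟨?_, ?_, ?_, ?_⟩ ?_) ih₁
      · simp only [Env.step, State.instr, instr, StrideOp.eval, hnum]; omega
      · simp only [Env.step, State.instr, instr, TargetOp.eval, hnum]; omega
      · simp
      · rw [hnum]; exact fun _ _ => ⟨h₁, h₂, h₃, h₄, h₅⟩
      · simp [Env.step, State.instr, instr, RegOp.src, Src.eval, State.reg, StrideOp.eval,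
          TargetOp.eval, hnum]
    | cons b bs =>
      rw [hb, List.map_cons, List.cons_append] at hnum
      rw [List.map_cons, List.cons_append]
      refine Path.trans (Path.single (st' := ⟨.scopeRest, x, y, s, a, u * E.card v,
        t + u * E.val v, k⟩) ⟨?_, ?_, ?_, ?_⟩ ?_)
        (Path.trans (Path.skip_encNat (Or.inr rfl) (by omega) (by omega) bs _)
        (Path.trans (Path.plain (st' := ⟨.scope, x, y, s, a, u * E.card v,
          t + u * E.val v, k⟩) ?_ ?_ ?_ ?_ ?_) ih₁))
      · simp only [Env.step, State.instr, instr, StrideOp.eval, hnum]; omega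
      · simp only [Env.step, State.instr, instr, TargetOp.eval, hnum]; omega
      · simp
      · rw [hnum]; exact fun _ _ => ⟨h₁, h₂, h₃, h₄, h₅⟩
      · simp [Env.step, State.instr, instr, RegOp.src, Src.eval, State.reg, StrideOp.eval,
          TargetOp.eval, hnum]
      · simp [Env.step, State.instr, instr, RegOp.src, Src.eval, State.reg, StrideOp.eval,
          TargetOp.eval]
      · simp only; omega
      · simp only; omega
      · simp
      · simp

theorem mem_encNNRat {q : ℚ≥0} {c : Sym} (hc : c ∈ encNNRat q) : (∃ b, c = .bit b) ∨ c = .slash := by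
  simp only [encNNRat, encNat, List.mem_append, List.mem_map, List.mem_cons] at hc
  rcases hc with ⟨b, -, rfl⟩ | rfl | ⟨b, -, rfl⟩ <;> simp

/-- Reading the selected entry of a table. -/
theorem Path.entry {x y u k : ℕ} (hu : u ≤ B) (q : ℚ≥0) (l : List Sym) :
    E.Path n B ⟨.tab, x, y, x, 0, u, 0, k⟩ (encNNRat q ++ Sym.comma :: l)
      ⟨.done, x * q.num, y * q.den, x * q.num, 0, u, 0, k⟩ l := by
  have h₁ : E.Path n B ⟨.tab, x, y, x, 0, u, 0, k⟩
      (encNat q.num ++ Sym.slash :: (encNat q.den ++ Sym.comma :: l))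
      ⟨.den, y, x * q.num, y, 0, u, 0, k⟩ (encNat q.den ++ Sym.comma :: l) := by
    have hnum := ofBits_bits q.num
    rw [encNat]
    -- A zero numerator has no digits, and the slash follows at once, with `a = 0`.
    cases hb : q.num.bits with
    | nil =>
      rw [hb] at hnum
      refine Path.plain ?_ hu (by simp) (by simp) (by simp)
      simp [Env.step, State.instr, instr, RegOp.src, Src.eval, State.reg, StrideOp.eval,
          TargetOp.eval, ← hnum, ofBits]
    | cons b bs =>
      rw [hb, ofBits_cons] at hnum
      -- The first digit is consumed in mode `tab`, so the remaining ones start from the shifted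
      -- factor `2 * x`.
      obtain ⟨s', h⟩ := Path.digits (E := E) (n := n) (B := B) (M := .num) (by simp) (x := x) (y := y) (s := 2 * x)
        (a := x * b.toNat) (u := u) (t := 0) (k := k) hu (by simp) bs
        (Sym.slash :: (encNat q.den ++ Sym.comma :: l))
      refine Path.trans (Path.plain (st' := ⟨.num, x, y, 2 * x, x * b.toNat, u, 0, k⟩) ?_ hu
        (by simp) (by simp) (by simp)) (h.trans (Path.plain ?_ hu (by simp) (by simp) (by simp)))
      · cases b <;> simp [Env.step, State.instr, instr, RegOp.src, Src.eval, State.reg, StrideOp.eval,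
          TargetOp.eval]
      · simp [Env.step, State.instr, instr, RegOp.src, Src.eval, State.reg, StrideOp.eval,
          TargetOp.eval, ← hnum]
        ring
  obtain ⟨s', h⟩ := Path.digits (E := E) (n := n) (B := B) (M := .den) (by simp) (x := y) (y := x * q.num) (s := y)
    (a := 0) (u := u) (t := 0) (k := k) hu (by simp) q.den.bits (Sym.comma :: l)
  rw [encNNRat, List.append_assoc, List.cons_append]
  refine h₁.trans (h.trans (Path.plain ?_ hu (by simp) (by simp) (by simp)))
  simp [Env.step, State.instr, instr, RegOp.src, Src.eval, State.reg, StrideOp.eval,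
          TargetOp.eval, ofBits_bits]

/-- Reading the table of a factor. -/
theorem Path.table {x y u t k : ℕ} (hB : 1 ≤ B) (hu : u ≤ B) (L : List ℚ≥0) (l : List Sym)
    (ht : t < L.length) (ht' : t ≤ B) :
    E.Path n B ⟨.tab, x, y, x, 0, u, t, k⟩ (encList encNNRat L ++ l)
      ⟨.scope, x * L[t].num, y * L[t].den, x * L[t].num, 0, 1, 0, k⟩ l := by
  induction L generalizing t with
  | nil => simp at ht
  | cons q L ih =>
    rw [encList_cons]
    cases t with
    | zero =>
      refine (Path.entry hu q _).trans ?_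
      have : encList encNNRat L ++ l
          = L.flatMap (fun a => encNNRat a ++ [Sym.comma]) ++ (Sym.semi :: l) := by
        simp [encList]
      rw [this]
      refine Path.trans (Path.skip hu (by simp) (by simp) (by simp) _ _ fun c hc => ?_)
        (Path.plain ?_ (by simpa using hB) (by simp) (by simp) (by simp))
      · simp only [List.mem_flatMap, List.mem_append, List.mem_singleton] at hc
        obtain ⟨q', -, hc | rfl⟩ := hc
        · rcases mem_encNNRat hc with ⟨b, rfl⟩ | rfl <;> rfl
        · rfl
      · simp [Env.step, State.instr, instr, RegOp.src, Src.eval, State.reg, StrideOp.eval,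
          TargetOp.eval]
    | succ t =>
      -- Every entry contains a slash, so it has a first symbol, at which the target row is
      -- decremented.
      have hne : encNNRat q ≠ [] := by simp [encNNRat]
      obtain ⟨c, cs, hc⟩ := List.exists_cons_of_ne_nil hne
      have hmem : ∀ c' ∈ c :: cs, (∃ b, c' = .bit b) ∨ c' = .slash :=
        fun c' h => mem_encNNRat (q := q) (hc ▸ h)
      rw [hc, List.cons_append]
      have ih' := ih (t := t) (by simpa using ht) (by omega)
      refine Path.trans (Path.plain (st' := ⟨.tabSkip, x, y, x, 0, u, t, k⟩) ?_ hu ?_ (by simp) (by simp))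
        (Path.trans (Path.skip hu ?_ (by simp) (by simp) _ _ fun c' hc' => ?_)
          (Path.trans (Path.plain (st' := ⟨.tab, x, y, x, 0, u, t, k⟩) ?_ hu ?_ (by simp) (by simp)) ih'))
      · rcases hmem c (by simp) with ⟨b, rfl⟩ | rfl <;>
          simp [Env.step, State.instr, instr, RegOp.src, Src.eval, State.reg, StrideOp.eval,
            TargetOp.eval]
      · simp only; omega
      · simp only; omega
      · rcases hmem c' (by simp [hc']) with ⟨b, rfl⟩ | rfl <;> rfl
      · simp [Env.step, State.instr, instr, RegOp.src, Src.eval, State.reg, StrideOp.eval,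
          TargetOp.eval]
      · simp only; omega

end Env

end FactorModel

/-! ### The scan of an encoded instance -/

namespace FactorModel

namespace Env

variable {E : Env} {n B : ℕ}

/-- The sum has the shape of `finPiFinEquiv_apply`, which identifies the computed target with the
index used in the table. -/
theorem rowOf_ofFn (E : Env) {a : ℕ} (g : Fin a → ℕ) :
    E.rowOf (1, 0) (List.ofFn g) = (∏ j, E.card (g j),
      ∑ i : Fin a, E.val (g i) * ∏ j : Fin i, E.card (g (Fin.castLE i.is_lt.le j))) := by
  induction a with
  | zero => simp [rowOf]
  | succ a ih =>
    have := ih fun i => g i.castSucc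
    rw [rowOf] at this ⊢
    rw [List.ofFn_succ_last, List.foldl_append, this, Fin.prod_univ_castSucc, Fin.sum_univ_castSucc]
    simp only [List.foldl_cons, List.foldl_nil, Prod.mk.injEq, true_and]
    rw [mul_comm (E.val _)]
    rfl

end Env

/-- The environment of an instantiation. -/
def Model.env (M : Model) (x : Instantiation M.card) : Env where
  card v := if h : v < M.numVars then M.card ⟨v, h⟩ else 0
  val v := if h : v < M.numVars then x ⟨v, h⟩ else 0

theorem Model.env_card (M : Model) (x : Instantiation M.card) (v : Fin M.numVars) :
    (M.env x).card v = M.card v := by simp [Model.env]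

theorem Model.env_val (M : Model) (x : Instantiation M.card) (v : Fin M.numVars) :
    (M.env x).val v = x v := by simp [Model.env]

theorem Model.env_val_lt (M : Model) (x : Instantiation M.card) {v : ℕ} (hv : v < M.numVars) :
    (M.env x).val v < (M.env x).card v := by
  rw [M.env_val x ⟨v, hv⟩, M.env_card x ⟨v, hv⟩]
  exact (x _).2

theorem Factor.length_table {n : ℕ} {card : Fin n → ℕ} (f : Factor card) :
    f.table.length = ∏ j, card (f.scope j) := by
  simp [Factor.table]

theorem encList_ofFn_val {a n : ℕ} (g : Fin a → Fin n) :
    encList (fun v : Fin n => encNat v) (List.ofFn g)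
      = encList encNat (List.ofFn fun j => (g j : ℕ)) := by
  have : (List.ofFn fun j => (g j : ℕ)) = (List.ofFn g).map Fin.val := by
    rw [List.map_ofFn]; rfl
  rw [encList, encList, this, List.flatMap_map]

theorem Env.Path.factor {M : Model} {B : ℕ} (x : Instantiation M.card) (f : Factor M.card)
    (hn : M.numVars ≤ B) (hf : f.table.length ≤ B) (X Y : ℕ) (l : List Sym) :
    (M.env x).Path M.numVars B ⟨.scope, X, Y, X, 0, 1, 0, M.numVars⟩ (f.encode ++ l)
      ⟨.scope, X * (f.eval x).num, Y * (f.eval x).den, X * (f.eval x).num, 0, 1, 0, M.numVars⟩ l := by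
  have hrow := (M.env x).rowOf_ofFn fun j => (f.scope j : ℕ)
  simp only [M.env_card, M.env_val] at hrow
  set t := finPiFinEquiv fun j => x (f.scope j) with ht
  rw [← finPiFinEquiv_apply (n := fun j => M.card (f.scope j)) fun j => x (f.scope j), ← ht] at hrow
  have hpos : 0 < ∏ j, M.card (f.scope j) := Finset.prod_pos fun j _ => M.card_pos _
  rw [f.length_table] at hf
  have hget : ∀ h : (t : ℕ) < f.table.length, f.table[(t : ℕ)] = f.eval x := by
    intro h
    simp [Factor.table, ht, Factor.eval]
  have htl : (t : ℕ) < f.table.length := by rw [f.length_table]; exact t.2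
  rw [Factor.encode, encList_ofFn_val, List.append_assoc]
  have h₁ := Env.Path.scope (E := M.env x) (n := M.numVars) (B := B) (x := X) (y := Y) (s := X)
    (a := 0) (u := 1) (t := 0) (k := M.numVars) (List.ofFn fun j => (f.scope j : ℕ))
    (encList encNNRat f.table ++ l) ?_ one_pos (by rw [hrow]; exact hf)
  · rw [hrow] at h₁
    have h₂ := Env.Path.table (E := M.env x) (n := M.numVars) (B := B) (x := X) (y := Y)
      (k := M.numVars) (hpos.trans_le hf) hf f.table l htl (t.2.le.trans hf)
    rw [hget htl] at h₂
    exact h₁.1.trans h₂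
  · intro v hv
    obtain ⟨j, rfl⟩ := List.mem_ofFn.1 hv
    simp only [M.env_card, M.env_val]
    refine ⟨(f.scope j).2, (f.scope j).2.le.trans hn, M.card_pos _, ?_, (x _).2⟩
    -- A cardinality divides the positive length of the table, and the table is written out in full.
    exact (Nat.le_of_dvd hpos (Finset.dvd_prod_of_mem _ (Finset.mem_univ j))).trans hf

theorem Env.Path.factors {M : Model} {B : ℕ} (x : Instantiation M.card) (fs : List (Factor M.card))
    (hn : M.numVars ≤ B) (hf : ∀ f ∈ fs, f.table.length ≤ B) (X Y : ℕ) :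
    (M.env x).Path M.numVars B ⟨.scope, X, Y, X, 0, 1, 0, M.numVars⟩ (fs.flatMap Factor.encode)
      ⟨.scope, X * (fs.map fun f => (f.eval x).num).prod, Y * (fs.map fun f => (f.eval x).den).prod,
        X * (fs.map fun f => (f.eval x).num).prod, 0, 1, 0, M.numVars⟩ [] := by
  induction fs generalizing X Y with
  | nil => simpa using Env.Path.refl _ _
  | cons f fs ih =>
    have h₁ := Env.Path.factor x f hn (hf f (by simp)) X Y (fs.flatMap Factor.encode)
    have h₂ := ih (fun f hf' => hf f (by simp [hf'])) (X * (f.eval x).num) (Y * (f.eval x).den)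
    simp only [List.flatMap_cons, List.map_cons, List.prod_cons, ← mul_assoc]
    exact h₁.trans h₂

/-- The initial state of the scan. -/
def State.start : State := ⟨.kNum, 1, 1, 1, 0, 0, 0, 0⟩

/-- The denominator goes to `x` and the numerator to `y`, since the final test is `k.num * ∏ den <
k.den * ∏ num`. -/
theorem Env.Path.threshold {E : Env} {n B : ℕ} {k : ℚ} (hk : 0 ≤ k) (l : List Sym) :
    E.Path n B .start (encRat k ++ Sym.semi :: l)
      ⟨.card, k.den, k.num.natAbs, k.den, 0, 0, 0, 0⟩ l := by
  rw [encRat, if_neg hk.not_gt, List.nil_append, List.append_assoc, List.cons_append, encNat, encNat]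
  obtain ⟨s₁, h₁⟩ := Path.digits (E := E) (n := n) (B := B) (M := .kNum) (by simp) (x := 1) (y := 1)
    (s := 1) (a := 0) (u := 0) (t := 0) (k := 0) (by simp) (by simp) k.num.natAbs.bits
    (Sym.slash :: (k.den.bits.map Sym.bit ++ Sym.semi :: l))
  obtain ⟨s₂, h₂⟩ := Path.digits (E := E) (n := n) (B := B) (M := .kDen) (by simp) (x := 1)
    (y := k.num.natAbs) (s := 1) (a := 0) (u := 0) (t := 0) (k := 0) (by simp) (by simp) k.den.bits
    (Sym.semi :: l)
  refine h₁.trans (Path.trans (Path.plain ?_ (by simp) (by simp) (by simp) (by simp))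
    (h₂.trans (Path.plain ?_ (by simp) (by simp) (by simp) (by simp))))
  · simp [Env.step, State.instr, instr, RegOp.src, Src.eval, State.reg, StrideOp.eval,
      TargetOp.eval, ofBits_bits]
  · simp [Env.step, State.instr, instr, RegOp.src, Src.eval, State.reg, StrideOp.eval,
      TargetOp.eval, ofBits_bits]

/-- A minus sign has no instruction, so the scan is dead from its first step on. -/
theorem Env.Path.dead {E : Env} {n B : ℕ} {k : ℚ} (hk : k < 0) (l : List Sym) :
    ∃ st : State, st.mode = .dead ∧ E.Path n B .start (encRat k ++ l) st [] := by
  rw [encRat, if_pos hk, List.append_assoc, List.append_assoc, List.singleton_append]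
  refine ⟨⟨.dead, 1, 1, 1, 0, 0, 0, 0⟩, rfl, Path.trans
    (Path.plain (st' := ⟨.dead, 1, 1, 1, 0, 0, 0, 0⟩) ?_ (by simp) (by simp)
    (by simp [State.start]) (by simp [State.start])) ?_⟩
  rotate_left
  · have := Path.skip (E := E) (n := n) (B := B) (st := ⟨.dead, 1, 1, 1, 0, 0, 0, 0⟩)
      (by simp) (by simp) (by simp) (by simp)
      (encNat k.num.natAbs ++ (Sym.slash :: encNat k.den ++ l)) []
      fun c _ => by cases c <;> rfl
    rw [List.append_nil] at this
    exact this
  · simp [State.start, Env.step, State.instr, instr, RegOp.src, Src.eval, State.reg, StrideOp.eval,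
      TargetOp.eval]

/-- Each entry is followed by a comma. Through this bound the small numbers of the scan are at most
the length of the input. -/
theorem length_le_encList {α : Type} (e : α → List Sym) (L : List α) :
    L.length ≤ (encList e L).length := by
  induction L with
  | nil => simp
  | cons a L ih =>
    have := congrArg List.length (Env.encList_cons e a L [])
    simp only [List.append_nil, List.length_append, List.length_cons] at this ⊢
    omega

theorem Query.numVars_le (Q : Query) : Q.model.numVars ≤ Q.encode.length := by
  have := length_le_encList encNat (List.ofFn Q.model.card)
  simp only [List.length_ofFn] at this
  simp only [Query.encode, List.length_append, List.length_cons]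
  omega

theorem Query.length_table_le (Q : Query) {f : Factor Q.model.card} (hf : f ∈ Q.model.factors) :
    f.table.length ≤ Q.encode.length := by
  have h₁ := length_le_encList encNNRat f.table
  have h₂ : f.encode.length ≤ (Q.model.factors.flatMap Factor.encode).length := by
    obtain ⟨s, t, h⟩ := List.append_of_mem hf
    rw [h]
    simp
    omega
  simp only [Factor.encode, List.length_append] at h₂
  simp only [Query.encode, List.length_append, List.length_cons]
  omega

/-- The scan of a query with a nonnegative threshold compares the joint factor with the
threshold. -/
theorem Query.exists_path (Q : Query) (hk : 0 ≤ Q.k) (x : Instantiation Q.model.card) {B : ℕ}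
    (hB : Q.encode.length < B) :
    ∃ st : State, st.mode = .scope ∧ (st.y < st.x ↔ (Q.model.joint x : ℚ) > Q.k) ∧
      (Q.model.env x).Path Q.model.numVars B .start Q.encode st [] := by
  have h₁ := Env.Path.threshold (E := Q.model.env x) (n := Q.model.numVars) (B := B) hk
    (encList encNat (List.ofFn Q.model.card) ++ Q.model.factors.flatMap Factor.encode)
  have h₂ := Env.Path.cards (E := Q.model.env x) (n := Q.model.numVars) (B := B) (x := Q.k.den)
    (y := Q.k.num.natAbs) (s := Q.k.den) (a := 0) (k := 0) (by omega) (List.ofFn Q.model.card)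
    (Q.model.factors.flatMap Factor.encode) (by simp) (Q.numVars_le.trans hB.le) ?_
  · have h₃ := Env.Path.factors x Q.model.factors (Q.numVars_le.trans hB.le)
      (fun f hf => (Q.length_table_le hf).trans hB.le) Q.k.den Q.k.num.natAbs
    simp only [List.length_ofFn, zero_add] at h₂
    refine ⟨_, ?_, ?_, h₁.trans (h₂.trans h₃)⟩
    · rfl
    · simp only
      -- The products need not be in lowest terms; only cross-multiplication is used.
      have hj : (Q.model.joint x : ℚ) = ((Q.model.factors.map fun f => (f.eval x).num).prod : ℕ) /
          ((Q.model.factors.map fun f => (f.eval x).den).prod : ℕ) := by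
        rw [Model.joint]
        generalize Q.model.factors = fs
        induction fs with
        | nil => simp
        | cons f fs ih =>
          simp only [List.map_cons, List.prod_cons, NNRat.cast_mul, Nat.cast_mul, ih]
          rw [mul_div_mul_comm]
          congr 1
          conv_lhs => rw [← NNRat.num_div_den (f.eval x)]
          push_cast
          rfl
      have hd : 0 < (Q.model.factors.map fun f => (f.eval x).den).prod :=
        List.prod_pos fun a ha => by
          obtain ⟨f, -, rfl⟩ := List.mem_map.1 ha
          exact NNRat.den_pos _
      have hk' : Q.k = (Q.k.num.natAbs : ℚ) / (Q.k.den : ℚ) := by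
        conv_lhs => rw [← Rat.num_div_den Q.k]
        congr 1
        have := Rat.num_nonneg.2 hk
        rw [Nat.cast_natAbs, abs_of_nonneg this]
      rw [hj, gt_iff_lt, hk', div_lt_div_iff₀ (by exact_mod_cast Q.k.den_pos) (by exact_mod_cast hd),
        ← hk', mul_comm Q.k.den]
      exact_mod_cast Iff.rfl
  · intro j hj
    simp only [List.length_ofFn] at hj
    simp only [zero_add, List.getElem_ofFn]
    exact ⟨Q.model.env_card x ⟨j, hj⟩, Q.model.card_pos _⟩

/-! ### The trace of the scan -/

/-- The state after some steps of the scan. -/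
def Env.run (E : Env) : State → List Sym → ℕ → State
  | st, _, 0 => st
  | st, [], _ + 1 => st
  | st, c :: l, i + 1 => E.run (E.step st c l) l i

namespace Env

variable {E : Env} {n B : ℕ}

theorem run_zero (st : State) (w : List Sym) : E.run st w 0 = st := by
  rw [run]

theorem run_succ {st : State} {w : List Sym} {i : ℕ} {c : Sym} {l : List Sym}
    (h : w.drop i = c :: l) : E.run st w (i + 1) = E.step (E.run st w i) c l := by
  induction i generalizing st w with
  | zero =>
    rw [List.drop_zero] at h
    subst h
    simp [run]
  | succ i ih =>
    cases w with
    | nil => simp at h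
    | cons d w =>
      rw [run, run, ih (by simpa using h)]

theorem Path.run_length {st st' : State} {w : List Sym} (h : E.Path n B st w st' []) :
    E.run st w w.length = st' := by
  generalize hl : ([] : List Sym) = l at h
  induction h with
  | refl => subst hl; rfl
  | step _ _ ih => exact ih hl

theorem Path.good {st st' : State} {w : List Sym} (h : E.Path n B st w st' []) {i : ℕ} {c : Sym}
    {l : List Sym} (hi : w.drop i = c :: l) : E.Good n B (E.run st w i) c l := by
  generalize hl : ([] : List Sym) = l' at h
  induction h generalizing i with
  | refl => subst hl; simp at hi
  | @step st c' w' _ _ hg _ ih =>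
    cases i with
    | zero =>
      simp only [List.drop_zero, List.cons.injEq] at hi
      obtain ⟨rfl, rfl⟩ := hi
      rw [run_zero]
      exact hg
    | succ i => exact ih (by simpa using hi) hl

/-- The registers grow slowly. -/
theorem reg_run_le (w : List Sym) (i : ℕ) {st : State} {k : ℕ} (hx : st.x ≤ 2 ^ k)
    (hy : st.y ≤ 2 ^ k) (hs : st.s ≤ 2 ^ k) (ha : st.a ≤ st.s) :
    (E.run st w i).x ≤ 2 ^ (k + i) ∧ (E.run st w i).y ≤ 2 ^ (k + i) := by
  induction i generalizing st w k with
  | zero => rw [run_zero]; exact ⟨hx, hy⟩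
  | succ i ih =>
    cases w with
    | nil =>
      have : 2 ^ k ≤ 2 ^ (k + (i + 1)) := Nat.pow_le_pow_right (by omega) (by omega)
      exact ⟨hx.trans this, hy.trans this⟩
    | cons c l =>
      rw [run, show k + (i + 1) = k + 1 + i by omega]
      have := pow_succ 2 k
      have := Nat.two_pow_pos k
      -- The invariant `a ≤ s` makes `a + s` at most `2 * s`, so one step at most doubles the common
      -- bound.
      apply ih
      all_goals
        simp only [step]
        rcases (st.instr c).reg with _ | b | _ | _
      all_goals
        first
        | simp only [RegOp.src, Src.eval, State.reg]; omega
        | cases b <;> simp only [RegOp.src, Src.eval, State.reg] <;> omega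

end Env

end FactorModel

namespace FactorModel

/-! ### The ground instances of a theory, by positions -/

namespace Theory

variable {R : Type} {m : ℕ} (Θ : Theory R m)

theorem mem_posInstances_iff {i : List (Lit R m) × (Fin m → ℕ)} (w : List Sym) (a : ℕ) :
    i ∈ Θ.posInstances a w ↔ i = (Θ.last, Θ.posVal (a + w.length + 1)) ∨
      (∃ j ≤ w.length, i = (Θ.next, Θ.posVal (a + j + 1))) ∨
      ∃ j s, w[j]? = some s ∧ i = (Θ.symb s, Θ.posVal (a + j + 1)) := by
  induction w generalizing a with
  | nil => simp [posInstances]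
  | cons c w ih =>
    simp only [posInstances, List.mem_cons, ih, List.length_cons]
    constructor
    · rintro (rfl | rfl | rfl | ⟨j, hj, rfl⟩ | ⟨j, s, hj, rfl⟩)
      · exact Or.inr (Or.inr ⟨0, c, by simp, rfl⟩)
      · exact Or.inr (Or.inl ⟨0, by simp, rfl⟩)
      · exact Or.inl (by rw [show a + 1 + w.length = a + (w.length + 1) by omega])
      · exact Or.inr (Or.inl ⟨j + 1, by omega, by rw [show a + 1 + j = a + (j + 1) by omega]⟩)
      · exact Or.inr (Or.inr ⟨j + 1, s, by simpa using hj,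
          by rw [show a + 1 + j = a + (j + 1) by omega]⟩)
    · rintro (rfl | ⟨j, hj, rfl⟩ | ⟨j, s, hj, rfl⟩)
      · exact Or.inr (Or.inr (Or.inl (by rw [show a + 1 + w.length = a + (w.length + 1) by omega])))
      · cases j with
        | zero => exact Or.inr (Or.inl rfl)
        | succ j => exact Or.inr (Or.inr (Or.inr (Or.inl ⟨j, by omega,
            by rw [show a + 1 + j = a + (j + 1) by omega]⟩)))
      · cases j with
        | zero =>
          simp only [List.getElem?_cons_zero, Option.some.injEq] at hj
          subst hj
          exact Or.inl rfl
        | succ j => exact Or.inr (Or.inr (Or.inr (Or.inr ⟨j, s, by simpa using hj,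
            by rw [show a + 1 + j = a + (j + 1) by omega]⟩)))

theorem forall_mem_instances {w : List Sym} {P : List (Lit R m) × (Fin m → ℕ) → Prop} :
    (∀ i ∈ Θ.instances w, P i) ↔ P (Θ.first, Θ.posVal 0) ∧ P (Θ.last, Θ.posVal (w.length + 1)) ∧
      (∀ j ≤ w.length + 1, P (Θ.next, Θ.posVal j)) ∧
      (∀ j s, w[j]? = some s → P (Θ.symb s, Θ.posVal (j + 1))) ∧
      ∀ c ∈ Θ.rules, ∀ v, (∀ k, v k < 2 ^ width w.length) → P (c, v) := by
  simp only [instances, List.cons_append, List.mem_cons, List.mem_append, mem_posInstances_iff,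
    List.mem_flatMap, List.mem_map, mem_valuations]
  constructor
  · intro h
    refine ⟨h _ (Or.inl rfl), h _ (by simp), fun j hj => ?_, fun j s hj => ?_, fun c hc v hv => ?_⟩
    · cases j with
      | zero => exact h _ (Or.inr (Or.inl rfl))
      | succ j => exact h _ (Or.inr (Or.inr (Or.inl (Or.inr (Or.inl ⟨j, by omega, by simp⟩)))))
    · exact h _ (Or.inr (Or.inr (Or.inl (Or.inr (Or.inr ⟨j, s, hj, by simp⟩)))))
    · exact h _ (Or.inr (Or.inr (Or.inr ⟨v, hv, c, hc, rfl⟩)))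
  · rintro ⟨h₁, h₂, h₃, h₄, h₅⟩ i
      (rfl | rfl | (rfl | ⟨j, hj, rfl⟩ | ⟨j, s, hj, rfl⟩) | ⟨v, hv, c, hc, rfl⟩)
    · exact h₁
    · exact h₃ 0 (by omega)
    · simpa using h₂
    · simpa using h₃ (j + 1) (by omega)
    · simpa using h₄ j s hj
    · exact h₅ c hc v hv

end Theory

/-! ### The rules of the scan -/

/-- The predicates of the description of a scan. -/
inductive Pred
  | first | last | next | sym (s : Sym) | plus | times | num
  | mode (M : Mode) | inst (M : Mode) (s : Sym) (z : Bool) | stride | target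
  | card | choice | free | bit (r : Reg) (b : Bool) | carry (b : Bool) | le
  deriving DecidableEq, Fintype

/-- A predicate applied to variables. -/
structure Atom where
  pred : Pred
  x : Fin 8
  y : Fin 8
  z : Fin 8

/-- An implication from the conjunction of the `body` to the disjunction of the `head`. -/
structure Rule where
  body : List Atom
  head : List Atom

/-- Interpretations of the predicates. -/
abbrev Interp : Type := Pred → ℕ → ℕ → ℕ → Prop

def Atom.Sat (I : Interp) (v : Fin 8 → ℕ) (a : Atom) : Prop := I a.pred (v a.x) (v a.y) (v a.z)

def Rule.Sat (I : Interp) (v : Fin 8 → ℕ) (r : Rule) : Prop :=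
  r.body.foldr (fun a P => a.Sat I v → P) (r.head.foldr (fun a P => a.Sat I v ∨ P) False)

def Atom.lit (b : Bool) (a : Atom) : Lit Pred 8 := ⟨a.pred, ![a.x, a.y, a.z], b⟩

def Rule.clause (r : Rule) : List (Lit Pred 8) := r.body.map (Atom.lit false) ++ r.head.map (Atom.lit true)

/-- A clause is the classical reading of an implication between its negative and positive literals.
The curried form of `Rule.Sat` allows rules to be applied as functions later. -/
theorem Rule.holds_clause (A : Pred → (Fin 3 → ℕ) → Prop) (r : Rule) (v : Fin 8 → ℕ) :
    Holds A r.clause v ↔ r.Sat (fun p a b c => A p ![a, b, c]) v := by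
  have hA : ∀ (a : Atom) b, A (a.lit b).rel (fun k => v ((a.lit b).arg k)) ↔
      a.Sat (fun p a b c => A p ![a, b, c]) v := by
    intro a b
    have : (fun k => v ((a.lit b).arg k)) = ![v a.x, v a.y, v a.z] := by
      funext k
      fin_cases k <;> rfl
    rw [this]
    rfl
  obtain ⟨body, head⟩ := r
  simp only [Holds, Rule.clause, Rule.Sat, List.mem_append, List.mem_map]
  induction body with
  | nil =>
    simp only [List.not_mem_nil, false_and, exists_false, false_or, List.foldr_nil]
    induction head with
    | nil => simp
    | cons a head ih =>
      refine Iff.trans ?_ (or_congr Iff.rfl ih)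
      constructor
      · rintro ⟨l, ⟨b, hb, rfl⟩, h⟩
        rcases List.mem_cons.1 hb with rfl | hb
        · exact Or.inl ((hA _ _).1 (h.2 rfl))
        · exact Or.inr ⟨_, ⟨b, hb, rfl⟩, h⟩
      · rintro (h | ⟨l, ⟨b, hb, rfl⟩, h⟩)
        · exact ⟨_, ⟨a, by simp, rfl⟩, iff_of_true ((hA _ _).2 h) rfl⟩
        · exact ⟨_, ⟨b, by simp [hb], rfl⟩, h⟩
  | cons a body ih =>
    refine Iff.trans ?_ (imp_congr_right fun _ => ih)
    constructor
    · rintro ⟨l, ⟨b, hb, rfl⟩ | hl, h⟩ ha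
      · rcases List.mem_cons.1 hb with rfl | hb
        · exact absurd (h.1 ((hA _ _).2 ha)) (by simp [Atom.lit])
        · exact ⟨_, Or.inl ⟨b, hb, rfl⟩, h⟩
      · exact ⟨l, Or.inr hl, h⟩
    · intro h
      by_cases ha : a.Sat (fun p a b c => A p ![a, b, c]) v
      · obtain ⟨l, ⟨b, hb, rfl⟩ | hl, h⟩ := h ha
        · exact ⟨_, Or.inl ⟨b, by simp [hb], rfl⟩, h⟩
        · exact ⟨l, Or.inr hl, h⟩
      · exact ⟨_, Or.inl ⟨a, by simp, rfl⟩, iff_of_false (fun h => ha ((hA _ _).1 h)) (by simp [Atom.lit])⟩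

/-- The majority of three bits. -/
def majority (x y c : Bool) : Bool := (x && y) || (x && c) || (y && c)

namespace Pred

/-- Atoms; the last argument of a unary or binary predicate is repeated. -/
def un (p : Pred) (x : Fin 8) : Atom := ⟨p, x, x, x⟩

def bin (p : Pred) (x y : Fin 8) : Atom := ⟨p, x, y, y⟩

def tri (p : Pred) (x y z : Fin 8) : Atom := ⟨p, x, y, z⟩

/-- Addition and multiplication. -/
def arithRules : List Rule :=
  [⟨[un first 0], [tri plus 1 0 1]⟩,
   ⟨[tri plus 0 1 2, bin next 1 3, bin next 2 4], [tri plus 0 3 4]⟩,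
   ⟨[un first 0], [tri times 1 0 0]⟩,
   ⟨[tri times 0 1 2, tri plus 2 0 3, bin next 1 4], [tri times 0 4 3]⟩]

/-- The number that is written at a position. -/
def numRules : Option Sym → List Rule
  | none => [⟨[un last 0, un first 1], [bin num 0 1]⟩]
  | some (.bit false) => [⟨[un (sym (.bit false)) 0, bin next 0 1, bin num 1 2,
      tri plus 2 2 3], [bin num 0 3]⟩]
  | some (.bit true) => [⟨[un (sym (.bit true)) 0, bin next 0 1, bin num 1 2,
      tri plus 2 2 3, bin next 3 4], [bin num 0 4]⟩]
  | some s => [⟨[un (sym s) 0, un first 1], [bin num 0 1]⟩]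

/-- The carries in the addition of the shifted factor to the accumulator. -/
def carryRules (x y c : Bool) : List Rule :=
  [⟨[un first 1], [bin (carry false) 0 1]⟩,
   ⟨[bin (bit .a x) 0 1, bin (bit .s y) 0 1, bin (carry c) 0 1, bin next 1 2],
    [bin (carry (majority x y c)) 0 2]⟩]

/-- The initial state, at the position after the first one. -/
def initRules (r : Reg) : List Rule :=
  [⟨[un first 0, bin next 0 1], [un (mode .kNum) 1]⟩,
   ⟨[un first 0, bin next 0 1], [bin stride 1 0]⟩,
   ⟨[un first 0, bin next 0 1], [bin target 1 0]⟩,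
   ⟨[un first 0, bin next 0 1], [bin (bit r (r ≠ .a)) 1 0]⟩,
   ⟨[un first 0, bin next 0 1, bin next 2 3], [bin (bit r false) 1 3]⟩]

/-- The choice of the instruction, and the reading of the numbers of values. -/
def fetchRules (M : Mode) (s : Sym) : List Rule :=
  [⟨[un (mode M) 0, un (sym s) 0, bin target 0 1, un first 1],
    [un (inst M s true) 0]⟩,
   ⟨[un (mode M) 0, un (sym s) 0, bin target 0 1, bin next 2 1],
    [un (inst M s false) 0]⟩] ++
  match M, s with
  | .card, .bit b => [⟨[un (mode .card) 0, un (sym (.bit b)) 0, bin stride 0 1, bin num 0 2],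
      [bin card 1 2]⟩]
  | _, _ => []

def srcRules (i : Pred) (r : Reg) (x y c : Bool) : Src → List Rule
  | .copy r' => [⟨[un i 0, bin next 0 1, bin (bit r' x) 0 2], [bin (bit r x) 1 2]⟩]
  | .zero => [⟨[un i 0, bin next 0 1], [bin (bit r false) 1 2]⟩]
  | .dbl =>
    [⟨[un i 0, bin next 0 1, un first 2], [bin (bit r false) 1 2]⟩,
     ⟨[un i 0, bin next 0 1, bin (bit .s x) 0 2, bin next 2 3], [bin (bit r x) 1 3]⟩]
  | .sum => [⟨[un i 0, bin next 0 1, bin (bit .a x) 0 2, bin (bit .s y) 0 2,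
      bin (carry c) 0 2], [bin (bit r ((x ^^ y) ^^ c)) 1 2]⟩]

def strideRules (i : Pred) : StrideOp → List Rule
  | .keep => [⟨[un i 0, bin next 0 1, bin stride 0 2], [bin stride 1 2]⟩]
  | .one => [⟨[un i 0, bin next 0 1, un first 2, bin next 2 3], [bin stride 1 3]⟩]
  | .inc => [⟨[un i 0, bin next 0 1, bin stride 0 2, bin next 2 3], [bin stride 1 3]⟩]
  | .mul => [⟨[un i 0, bin next 0 1, bin num 0 2, bin card 2 3, bin stride 0 4,
      tri times 4 3 5], [bin stride 1 5]⟩]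

def targetRules (i : Pred) : TargetOp → List Rule
  | .keep => [⟨[un i 0, bin next 0 1, bin target 0 2], [bin target 1 2]⟩]
  | .dec => [⟨[un i 0, bin next 0 1, bin target 0 2, bin next 3 2], [bin target 1 3]⟩]
  | .add => [⟨[un i 0, bin next 0 1, bin num 0 2, bin choice 2 3, bin stride 0 4,
      tri times 4 3 5, bin target 0 6, tri plus 6 5 7], [bin target 1 7]⟩]

/-- The execution of an instruction. -/
def instRules (M : Mode) (s : Sym) (z : Bool) (r : Reg) (x y c : Bool) : List Rule :=
  [⟨[un (inst M s z) 0, bin next 0 1], [un (mode (instr M s z).mode) 1]⟩] ++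
  srcRules (inst M s z) r x y c ((instr M s z).reg.src r) ++
  strideRules (inst M s z) (instr M s z).stride ++ targetRules (inst M s z) (instr M s z).target

/-- The choice of an instantiation. -/
def choiceRules : List Rule :=
  [⟨[un first 1], [bin free 0 1]⟩,
   ⟨[bin free 0 1, bin next 1 2], [bin choice 0 1, bin free 0 2]⟩,
   ⟨[bin card 0 1, bin free 0 1], []⟩]

/-- The comparison of the two products at the end. -/
def compareRules (b : Bool) : List Rule :=
  [⟨[un first 0], [un le 0]⟩,
   ⟨[un last 0, bin next 1 2, un le 1, bin (bit .x b) 0 1, bin (bit .y b) 0 1],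
    [un le 2]⟩,
   ⟨[un last 0, bin next 1 2, bin (bit .x false) 0 1, bin (bit .y true) 0 1],
    [un le 2]⟩,
   ⟨[un last 0, un (mode .scope) 0, un le 0], []⟩]

/-- The list of all the elements of a finite type. -/
noncomputable def all (α : Type) [Fintype α] : List α := Finset.univ.toList

noncomputable def rules : List Rule :=
  arithRules ++ (all (Option Sym)).flatMap numRules ++
  (all (Bool × Bool × Bool)).flatMap (fun b => carryRules b.1 b.2.1 b.2.2) ++
  (all Reg).flatMap initRules ++ (all (Mode × Sym)).flatMap (fun i => fetchRules i.1 i.2) ++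
  (all (Mode × Sym × Bool × Reg × Bool × Bool × Bool)).flatMap (fun i =>
    instRules i.1 i.2.1 i.2.2.1 i.2.2.2.1 i.2.2.2.2.1 i.2.2.2.2.2.1 i.2.2.2.2.2.2) ++
  choiceRules ++ (all Bool).flatMap compareRules

end Pred

/-- The description of a scan of a string, with a choice of the instantiation. -/
noncomputable def scanTheory : Theory Pred 8 where
  i₀ := 0
  i₁ := 1
  ne := by decide
  first := Rule.clause ⟨[], [Pred.un .first 0]⟩
  last := Rule.clause ⟨[], [Pred.un .last 0]⟩
  next := Rule.clause ⟨[], [Pred.bin .next 0 1]⟩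
  symb s := Rule.clause ⟨[], [Pred.un (.sym s) 0]⟩
  rules := Pred.rules.map Rule.clause

end FactorModel

/-! ### Descriptions of a scan as models of the theory, and carries -/

namespace FactorModel

namespace Pred

theorem mem_all {α : Type} [Fintype α] (a : α) : a ∈ all α := by simp [all]

theorem mem_rules {r : Rule} : r ∈ rules ↔ r ∈ arithRules ∨ (∃ s, r ∈ numRules s) ∨
    (∃ x y c, r ∈ carryRules x y c) ∨ (∃ g, r ∈ initRules g) ∨ (∃ M s, r ∈ fetchRules M s) ∨
    (∃ M s z g x y c, r ∈ instRules M s z g x y c) ∨ r ∈ choiceRules ∨ ∃ b, r ∈ compareRules b := by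
  simp only [rules, List.mem_append, List.mem_flatMap, mem_all, true_and, Prod.exists, or_assoc]

end Pred

/-- A description of a scan of the string `w`. -/
structure Interp.Describes (I : Interp) (w : List Sym) : Prop where
  first : I .first 0 0 0
  last : I .last (w.length + 1) (w.length + 1) (w.length + 1)
  next : ∀ a ≤ w.length + 1, I .next a (a + 1) (a + 1)
  sym : ∀ j s, w[j]? = some s → I (.sym s) (j + 1) (j + 1) (j + 1)
  rules : ∀ r ∈ Pred.rules, ∀ v, (∀ k, v k < 2 ^ width w.length) → r.Sat I v

theorem exists_structure_iff (w : List Sym) :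
    (∃ A : Pred → (Fin 3 → ℕ) → Prop, ∀ i ∈ scanTheory.instances w, Holds A i.1 i.2) ↔
      ∃ I : Interp, I.Describes w := by
  have h₀ : ∀ a, scanTheory.posVal a 0 = a := fun a => by
    simp [Theory.posVal, scanTheory]
  have h₁ : ∀ a, scanTheory.posVal a 1 = a + 1 := fun a => by
    simp [Theory.posVal, scanTheory]
  have key : ∀ A : Pred → (Fin 3 → ℕ) → Prop, (∀ i ∈ scanTheory.instances w, Holds A i.1 i.2) ↔
      Interp.Describes (fun p a b c => A p ![a, b, c]) w := by
    intro A
    rw [scanTheory.forall_mem_instances]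
    have hr : scanTheory.rules = Pred.rules.map Rule.clause := rfl
    simp only [hr, List.forall_mem_map]
    simp only [scanTheory, Rule.holds_clause]
    change Rule.Sat _ (scanTheory.posVal _) _ ∧ Rule.Sat _ (scanTheory.posVal _) _ ∧
      (∀ j ≤ _, Rule.Sat _ (scanTheory.posVal _) _) ∧
      (∀ j s, _ → Rule.Sat _ (scanTheory.posVal _) _) ∧ _ ↔ _
    simp only [Rule.Sat, List.foldr_nil, List.foldr_cons, or_false, Atom.Sat, Pred.un, Pred.bin, h₀,
      h₁]
    exact ⟨fun ⟨a, b, c, d, e⟩ => ⟨a, b, c, d, e⟩, fun ⟨a, b, c, d, e⟩ => ⟨a, b, c, d, e⟩⟩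
  constructor
  · rintro ⟨A, hA⟩
    exact ⟨_, (key A).1 hA⟩
  · rintro ⟨I, hI⟩
    exact ⟨fun p f => I p (f 0) (f 1) (f 2), (key _).2 hI⟩

/-- The carry into a digit of a sum. -/
def carryBit (a b j : ℕ) : Bool := decide (2 ^ j ≤ a % 2 ^ j + b % 2 ^ j)

theorem carryBit_zero (a b : ℕ) : carryBit a b 0 = false := by simp [carryBit, Nat.mod_one]

theorem carryBit_succ (a b j : ℕ) :
    carryBit a b (j + 1) = majority (a.testBit j) (b.testBit j) (carryBit a b j) := by
  have ha := Nat.mod_lt a (Nat.two_pow_pos j)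
  have hb := Nat.mod_lt b (Nat.two_pow_pos j)
  simp only [carryBit, Nat.testBit_eq_decide_div_mod_eq, Nat.mod_pow_succ]
  rw [pow_succ]
  rcases Nat.mod_two_eq_zero_or_one (a / 2 ^ j) with h | h <;>
    rcases Nat.mod_two_eq_zero_or_one (b / 2 ^ j) with h' | h' <;>
    simp only [h, h', majority] <;> by_cases hc : 2 ^ j ≤ a % 2 ^ j + b % 2 ^ j <;>
    simp [hc] <;> omega

theorem testBit_add_eq (a b j : ℕ) :
    (a + b).testBit j = ((a.testBit j ^^ b.testBit j) ^^ carryBit a b j) := by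
  simp only [carryBit, Nat.testBit_eq_decide_div_mod_eq, Nat.add_div (Nat.two_pow_pos j)]
  rcases Nat.mod_two_eq_zero_or_one (a / 2 ^ j) with h | h <;>
    rcases Nat.mod_two_eq_zero_or_one (b / 2 ^ j) with h' | h' <;>
    by_cases hc : 2 ^ j ≤ a % 2 ^ j + b % 2 ^ j <;>
    simp [hc, h, h', Nat.add_mod]

theorem mod_two_pow_succ (a j : ℕ) : a % 2 ^ (j + 1) = a % 2 ^ j + 2 ^ j * (a.testBit j).toNat := by
  rw [Nat.mod_pow_succ, Nat.toNat_testBit]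

/-! ### A description of a scan determines the scan -/

/-- The valuation of the variables by a list. -/
def val (l : List ℕ) (i : Fin 8) : ℕ := l.getD i 0

namespace Interp.Describes

variable {I : Interp} {w : List Sym}

/-- Variables that do not occur in the rule receive 0, and numbers up to `w.length + 2` fit into the
counters, so this valuation is among the grounded ones. -/
theorem rule (h : I.Describes w) {r : Rule} (hr : r ∈ Pred.rules) (l : List ℕ) (hl : ∀ a ∈ l, a ≤ w.length + 2) :
    r.Sat I (val l) := by
  refine h.rules r hr _ fun k => ?_
  have := lt_two_pow_width w.length
  by_cases hk : (k : ℕ) < l.length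
  · rw [val, List.getD_eq_getElem _ _ hk]
    exact (hl _ (List.getElem_mem hk)).trans_lt this
  · rw [val, List.getD_eq_default _ _ (not_lt.1 hk)]
    omega

/-- The rules force the true sums, by recursion on the second summand as long as everything stays in
range. Further triples may satisfy the relation without harm. -/
theorem plus (h : I.Describes w) (a b : ℕ) (hab : a + b ≤ w.length + 2) : I .plus a b (a + b) := by
  have hm : ∀ r ∈ Pred.arithRules, r ∈ Pred.rules := fun r hr => Pred.mem_rules.2 (Or.inl hr)
  induction b with
  | zero =>
    -- A head is a disjunction ending in `False`, which `resolve_right id` removes.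
    exact (h.rule (hm _ (.head _)) [0, a] (by simp; omega) h.first).resolve_right id
  | succ b ih =>
    exact (h.rule (hm _ (.tail _ (.head _))) [a, b, a + b, b + 1, a + b + 1] (by simp; omega)
      (ih (by omega)) (h.next b (by omega)) (h.next (a + b) (by omega))).resolve_right id

theorem times (h : I.Describes w) (a b : ℕ) (ha : a ≤ w.length + 2) (hb : b ≤ w.length + 2)
    (hab : a * b ≤ w.length + 2) : I .times a b (a * b) := by
  have hm : ∀ r ∈ Pred.arithRules, r ∈ Pred.rules := fun r hr => Pred.mem_rules.2 (Or.inl hr)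
  induction b with
  | zero =>
    exact (h.rule (hm _ (.tail _ (.tail _ (.head _)))) [0, a] (by simp; omega) h.first).resolve_right id
  | succ b ih =>
    rw [Nat.mul_succ] at hab ⊢
    exact (h.rule (hm _ (.tail _ (.tail _ (.tail _ (.head _))))) [a, b, a * b, a * b + a, b + 1]
      (by simp; omega) (ih (by omega) (by omega)) (h.plus _ _ hab) (h.next b (by omega))).resolve_right id

/-- Digits come least significant first, so the value at a position follows from the value at the
next one. The induction starts at a symbol that is not a digit or at the end marker. -/
theorem num (h : I.Describes w) {i : ℕ} (hi : i ≤ w.length) (hn : numAt (w.drop i) ≤ w.length + 2) :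
    I .num (i + 1) (numAt (w.drop i)) (numAt (w.drop i)) := by
  have hm : ∀ s, ∀ r ∈ Pred.numRules s, r ∈ Pred.rules :=
    fun s r hr => Pred.mem_rules.2 (Or.inr (Or.inl ⟨s, hr⟩))
  induction hl : w.drop i generalizing i with
  | nil =>
    have : i = w.length := by
      have := List.drop_eq_nil_iff.1 hl
      omega
    subst this
    exact (h.rule (hm none _ (.head _)) [w.length + 1, 0] (by simp)
      h.last h.first).resolve_right id
  | cons s l ih =>
    have hlt : i < w.length := by
      by_contra hc
      rw [List.drop_eq_nil_of_le (not_lt.1 hc)] at hl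
      simp at hl
    have hs := h.sym i s (by rw [← List.head?_drop, hl]; rfl)
    have hl' : w.drop (i + 1) = l := by rw [← List.tail_drop, hl]; rfl
    rw [hl] at hn
    cases s with
    | bit b =>
      cases b with
      | false =>
        simp only [numAt, Bool.toNat_false, add_zero] at hn ⊢
        have := ih (i := i + 1) (by omega) (by rw [hl']; omega) hl'
        rw [two_mul] at hn ⊢
        exact (h.rule (hm (some (.bit false)) _ (.head _)) [i + 1, i + 2, numAt l, numAt l + numAt l]
          (by simp; omega) hs (h.next (i + 1) (by omega)) this (h.plus (numAt l) (numAt l) (by omega))).resolve_right id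
      | true =>
        simp only [numAt, Bool.toNat_true] at hn ⊢
        have := ih (i := i + 1) (by omega) (by rw [hl']; omega) hl'
        rw [two_mul] at hn ⊢
        exact (h.rule (hm (some (.bit true)) _ (.head _)) [i + 1, i + 2, numAt l, numAt l + numAt l,
          numAt l + numAt l + 1] (by simp; omega) hs (h.next (i + 1) (by omega)) this (h.plus (numAt l) (numAt l) (by omega))
          (h.next (numAt l + numAt l) (by omega))).resolve_right id
    | slash => exact (h.rule (hm (some .slash) _ (.head _)) [i + 1, 0] (by simp; omega) hs
        h.first).resolve_right id
    | minus => exact (h.rule (hm (some .minus) _ (.head _)) [i + 1, 0] (by simp; omega) hs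
        h.first).resolve_right id
    | comma => exact (h.rule (hm (some .comma) _ (.head _)) [i + 1, 0] (by simp; omega) hs
        h.first).resolve_right id
    | semi => exact (h.rule (hm (some .semi) _ (.head _)) [i + 1, 0] (by simp; omega) hs
        h.first).resolve_right id

/-- If no value below `c` were chosen, `free` would climb from 0 to `c`, which the rule with empty
head forbids. -/
theorem exists_choice (h : I.Describes w) {v c : ℕ} (hv : v ≤ w.length + 2) (hc : c ≤ w.length + 2)
    (hcard : I .card v c c) : ∃ a < c, I .choice v a a := by
  have hm : ∀ r ∈ Pred.choiceRules, r ∈ Pred.rules :=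
    fun r hr => Pred.mem_rules.2 (by simp [hr])
  by_contra! hne
  have : ∀ a ≤ c, I .free v a a := by
    intro a ha
    induction a with
    | zero => exact (h.rule (hm _ (.head _)) [v, 0] (by simp; omega) h.first).resolve_right id
    | succ a ih =>
      exact ((h.rule (hm _ (.tail _ (.head _))) [v, a, a + 1] (by simp; omega)
        (ih (by omega)) (h.next a (by omega))).resolve_left (hne a ha)).resolve_right id
  exact h.rule (hm _ (.tail _ (.tail _ (.head _)))) [v, c] (by simp; omega) hcard (this c le_rfl)

end Interp.Describes

/-- The state of the scan after `i` steps is described. -/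
structure Interp.Knows (I : Interp) (w : List Sym) (E : Env) (i : ℕ) (st : State) : Prop where
  mode : I (.mode st.mode) (i + 1) (i + 1) (i + 1)
  stride : I .stride (i + 1) st.stride st.stride
  target : I .target (i + 1) st.target st.target
  bit : ∀ r, ∀ j ≤ w.length + 1, I (.bit r ((st.reg r).testBit j)) (i + 1) j j
  card : ∀ v < st.seen, E.card v ≤ w.length + 1 → I .card v (E.card v) (E.card v)
  stride_le : st.stride ≤ w.length + 1
  target_le : st.target ≤ w.length + 1

namespace Interp.Describes

variable {I : Interp} {w : List Sym}

theorem knows_init (h : I.Describes w) (E : Env) : I.Knows w E 0 .start := by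
  have hm : ∀ g, ∀ r ∈ Pred.initRules g, r ∈ Pred.rules :=
    fun g r hr => Pred.mem_rules.2 (Or.inr (Or.inr (Or.inr (Or.inl ⟨g, hr⟩))))
  have hn := h.next 0 (by omega)
  refine ⟨?_, ?_, ?_, fun r j hj => ?_, fun v hv => absurd hv (Nat.not_lt_zero _), by simp [State.start],
    by simp [State.start]⟩
  · exact (h.rule (hm .x _ (.head _)) [0, 1] (by simp) h.first hn).resolve_right id
  · exact (h.rule (hm .x _ (.tail _ (.head _))) [0, 1] (by simp) h.first hn).resolve_right id
  · exact (h.rule (hm .x _ (.tail _ (.tail _ (.head _)))) [0, 1] (by simp) h.first hn).resolve_right id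
  · cases j with
    | zero =>
      have := (h.rule (hm r _ (.tail _ (.tail _ (.tail _ (.head _))))) [0, 1] (by simp)
        h.first hn).resolve_right id
      cases r <;> exact this
    | succ j =>
      have := (h.rule (hm r _ (.tail _ (.tail _ (.tail _ (.tail _ (.head _)))))) [0, 1, j, j + 1]
        (by simp; omega) h.first hn (h.next j (by omega))).resolve_right id
      have e : (State.start.reg r).testBit (j + 1) = false := by
        cases r <;> simp [State.start, State.reg, Nat.testBit_add_one]
      rw [e]
      exact this

theorem carry (h : I.Describes w) {E : Env} {i : ℕ} {st : State} (hi : i ≤ w.length) (hk : I.Knows w E i st) {j : ℕ}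
    (hj : j ≤ w.length + 1) : I (.carry (carryBit st.a st.s j)) (i + 1) j j := by
  have hm : ∀ x y c, ∀ r ∈ Pred.carryRules x y c, r ∈ Pred.rules :=
    fun x y c r hr => Pred.mem_rules.2 (Or.inr (Or.inr (Or.inl ⟨x, y, c, hr⟩)))
  induction j with
  | zero =>
    rw [carryBit_zero]
    exact (h.rule (hm true true true _ (.head _)) [i + 1, 0] (by simp; omega) h.first).resolve_right id
  | succ j ih =>
    rw [carryBit_succ]
    exact (h.rule (hm _ _ _ _ (.tail _ (.head _))) [i + 1, j, j + 1] (by simp; omega)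
      (hk.bit .a j (by omega)) (hk.bit .s j (by omega)) (ih (by omega))
      (h.next j (by omega))).resolve_right id

/-- The mode, the symbol and the zero test of the target force the instruction, and its rules force
each component of the next state. Good steps keep stride and target in range. The guessed
instantiation enters only through `hE`. -/
theorem knows_step (h : I.Describes w) {E : Env} {n i : ℕ} {st : State} {c : Sym} {l : List Sym}
    (hE : ∀ v, E.card v ≤ w.length + 1 → v ≤ w.length + 1 → 0 < E.card v →
      I .card v (E.card v) (E.card v) → I .choice v (E.val v) (E.val v))
    (hl : w.drop i = c :: l) (hk : I.Knows w E i st)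
    (hg : E.Good n (w.length + 1) st c l) : I.Knows w E (i + 1) (E.step st c l) := by
  have hlt : i < w.length := by
    by_contra hc
    rw [List.drop_eq_nil_of_le (not_lt.1 hc)] at hl
    simp at hl
  have hs := h.sym i c (by rw [← List.head?_drop, hl]; rfl)
  have hnext := h.next (i + 1) (by omega)
  have hst := hk.stride_le
  have htt := hk.target_le
  have hf : ∀ M s, ∀ r ∈ Pred.fetchRules M s, r ∈ Pred.rules := fun M s r hr =>
    Pred.mem_rules.2 (Or.inr (Or.inr (Or.inr (Or.inr (Or.inl ⟨M, s, hr⟩)))))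
  have hi : ∀ M s z g x y c, ∀ r ∈ Pred.instRules M s z g x y c, r ∈ Pred.rules :=
    fun M s z g x y c r hr => Pred.mem_rules.2
      (Or.inr (Or.inr (Or.inr (Or.inr (Or.inr (Or.inl ⟨M, s, z, g, x, y, c, hr⟩))))))
  obtain ⟨z, hz, hinst⟩ : ∃ z, z = decide (st.target = 0) ∧
      I (.inst st.mode c z) (i + 1) (i + 1) (i + 1) := by
    have ht := hk.target
    refine ⟨_, rfl, ?_⟩
    by_cases h0 : st.target = 0
    · rw [h0] at ht
      simp only [h0, decide_true]
      exact (h.rule (hf st.mode c _ (.head _)) [i + 1, 0] (by simp; omega) hk.mode hs ht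
        h.first).resolve_right id
    · obtain ⟨u, hu⟩ := Nat.exists_eq_succ_of_ne_zero h0
      rw [hu] at ht htt
      simp only [h0, decide_false]
      exact (h.rule (hf st.mode c _ (.tail _ (.head _))) [i + 1, u + 1, u] (by simp; omega) hk.mode hs
        ht (h.next u (by omega))).resolve_right id
  have hins : st.instr c = instr st.mode c z := by rw [hz]; rfl
  have hnum : numAt (c :: l) ≤ w.length + 2 → I .num (i + 1) (numAt (c :: l)) (numAt (c :: l)) := by
    rw [← hl]
    exact h.num hlt.le
  -- Lookups of variables occur only at the first symbol of a variable in a scope, where a good step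
  -- guarantees that its cardinality has been read; this is checked over all instructions.
  have hscope : (st.instr c).stride = .mul ∨ (st.instr c).target = .add →
      st.mode = .scope ∧ c ≠ .semi := by
    rw [hins]
    generalize st.mode = M
    clear * -
    cases M <;> cases c <;> cases z <;> simp [instr]
  have hnumcard : (st.instr c).stride = .mul ∨ (st.instr c).target = .add →
      numAt (c :: l) ≤ w.length + 1 ∧ 0 < E.card (numAt (c :: l)) ∧
        E.card (numAt (c :: l)) ≤ w.length + 1 ∧ E.val (numAt (c :: l)) < E.card (numAt (c :: l)) ∧
        I .card (numAt (c :: l)) (E.card (numAt (c :: l))) (E.card (numAt (c :: l))) := by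
    intro hop
    obtain ⟨h₁, h₂⟩ := hscope hop
    obtain ⟨g₁, g₂, g₃, g₄, g₅⟩ := hg.scope h₁ h₂
    exact ⟨g₂, g₃, g₄, g₅, hk.card _ g₁ g₄⟩
  refine ⟨?_, ?_, ?_, ?_, ?_, hg.stride_le, hg.target_le⟩
  · change I (.mode (st.instr c).mode) _ _ _
    rw [hins]
    -- The mode rule does not depend on the register and the three digits; any values select it.
    exact (h.rule (hi st.mode c z .x true true true _ (.head _)) [i + 1, i + 2]
      (by simp; omega) hinst hnext).resolve_right id
  · have hm : ∀ r ∈ Pred.strideRules (.inst st.mode c z) (st.instr c).stride, r ∈ Pred.rules :=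
      fun r hr => hi st.mode c z .x true true true r (by
        rw [hins] at hr; simp [Pred.instRules, hr])
    have hle := hg.stride_le
    simp only [Env.step] at hle ⊢
    cases hop : (st.instr c).stride with
    | keep =>
      rw [hop] at hm
      exact (h.rule (hm _ (.head _)) [i + 1, i + 2, st.stride] (by simp; omega) hinst hnext
        hk.stride).resolve_right id
    | one =>
      rw [hop] at hm
      exact (h.rule (hm _ (.head _)) [i + 1, i + 2, 0, 1] (by simp; omega) hinst hnext
        h.first (h.next 0 (by omega))).resolve_right id
    | inc =>
      rw [hop] at hm
      exact (h.rule (hm _ (.head _)) [i + 1, i + 2, st.stride, st.stride + 1] (by simp; omega) hinst hnext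
        hk.stride (h.next st.stride (by omega))).resolve_right id
    | mul =>
      obtain ⟨g₁, g₂, g₃, g₄, g₅⟩ := hnumcard (Or.inl hop)
      rw [hop] at hm hle
      simp only [StrideOp.eval] at hle ⊢
      exact (h.rule (hm _ (.head _)) [i + 1, i + 2, numAt (c :: l), E.card (numAt (c :: l)), st.stride,
        st.stride * E.card (numAt (c :: l))] (by simp; omega) hinst hnext (hnum (by omega)) g₅
        hk.stride (h.times st.stride (E.card (numAt (c :: l))) (by omega) (by omega) (by omega))).resolve_right id
  · have hm : ∀ r ∈ Pred.targetRules (.inst st.mode c z) (st.instr c).target, r ∈ Pred.rules :=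
      fun r hr => hi st.mode c z .x true true true r (by
        rw [hins] at hr; simp [Pred.instRules, hr])
    have hle := hg.target_le
    simp only [Env.step] at hle ⊢
    cases hop : (st.instr c).target with
    | keep =>
      rw [hop] at hm
      exact (h.rule (hm _ (.head _)) [i + 1, i + 2, st.target] (by simp; omega) hinst hnext
        hk.target).resolve_right id
    | dec =>
      rw [hop] at hm
      -- A decrement is only issued when the zero test failed, so the predecessor required by the
      -- rule exists.
      have h0 : st.target ≠ 0 := by
        rw [hins] at hop
        intro h0
        simp only [h0, decide_true] at hz
        revert hop
        rw [hz]
        generalize st.mode = M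
        clear * -
        cases M <;> cases c <;> simp [instr]
      have ht := hk.target
      obtain ⟨u, hu⟩ := Nat.exists_eq_succ_of_ne_zero h0
      simp only [TargetOp.eval, hu, Nat.succ_eq_add_one, Nat.add_sub_cancel]
      rw [hu] at ht htt
      exact (h.rule (hm _ (.head _)) [i + 1, i + 2, u + 1, u] (by simp; omega) hinst hnext
        ht (h.next u (by omega))).resolve_right id
    | add =>
      obtain ⟨g₁, g₂, g₃, g₄, g₅⟩ := hnumcard (Or.inr hop)
      rw [hop] at hm hle
      simp only [TargetOp.eval] at hle ⊢
      exact (h.rule (hm _ (.head _)) [i + 1, i + 2, numAt (c :: l), E.val (numAt (c :: l)), st.stride,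
        st.stride * E.val (numAt (c :: l)), st.target, st.target + st.stride * E.val (numAt (c :: l))]
        (by simp; omega) hinst hnext (hnum (by omega)) (hE _ g₃ g₁ g₂ g₅)
        hk.stride (h.times st.stride (E.val (numAt (c :: l))) (by omega) (by omega) (by omega)) hk.target
        (h.plus st.target (st.stride * E.val (numAt (c :: l))) (by omega))).resolve_right id
  · intro r j hj
    have hm : ∀ x y d, ∀ r' ∈ Pred.srcRules (.inst st.mode c z) r x y d ((st.instr c).reg.src r),
        r' ∈ Pred.rules :=
      fun x y d r' hr => hi st.mode c z r x y d r' (by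
        rw [hins] at hr; simp [Pred.instRules, hr])
    rw [Env.reg_step]
    cases hop : (st.instr c).reg.src r with
    | copy r' =>
      rw [hop] at hm
      exact (h.rule (hm _ true true _ (.head _)) [i + 1, i + 2, j] (by simp; omega) hinst hnext
        (hk.bit r' j hj)).resolve_right id
    | zero =>
      rw [hop] at hm
      simp only [Src.eval, Nat.zero_testBit]
      exact (h.rule (hm true true true _ (.head _)) [i + 1, i + 2, j] (by simp; omega) hinst
        hnext).resolve_right id
    | dbl =>
      rw [hop] at hm
      simp only [Src.eval]
      cases j with
      | zero =>
        have : (2 * st.s).testBit 0 = false := by simp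
        rw [this]
        exact (h.rule (hm true true true _ (.head _)) [i + 1, i + 2, 0] (by simp; omega) hinst
          hnext h.first).resolve_right id
      | succ j =>
        rw [Nat.testBit_add_one, Nat.mul_div_cancel_left _ two_pos]
        exact (h.rule (hm _ true true _ (.tail _ (.head _))) [i + 1, i + 2, j, j + 1] (by simp; omega)
          hinst hnext (hk.bit .s j (by omega)) (h.next j (by omega))).resolve_right id
    | sum =>
      rw [hop] at hm
      simp only [Src.eval]
      rw [testBit_add_eq]
      exact (h.rule (hm _ _ _ _ (.head _)) [i + 1, i + 2, j] (by simp; omega) hinst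
        hnext (hk.bit .a j hj) (hk.bit .s j hj) (h.carry hlt.le hk hj)).resolve_right id
  · intro v hv hcv
    simp only [Env.step] at hv
    split_ifs at hv with hc
    · rcases Nat.lt_succ_iff_lt_or_eq.1 hv with hv | rfl
      · exact hk.card v hv hcv
      -- At the first digit of a cardinality the stride is the index of the variable being read.
      · obtain ⟨hmode, b, rfl⟩ := hc
        obtain ⟨g₁, g₂, g₃⟩ := hg.card hmode ⟨b, rfl⟩
        have hm := hk.mode
        have hst' := hk.stride
        rw [hmode] at hm
        rw [g₁] at hst'
        rw [g₃] at hcv ⊢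
        exact (h.rule (hf .card (.bit b) _ (.tail _ (.tail _ (.head _))))
          [i + 1, st.seen, numAt (.bit b :: l)] (by simp; omega) hm hs hst'
          (hnum (by omega))).resolve_right id
    · exact hk.card v hv hcv

theorem knows_of_path (h : I.Describes w) {E : Env} {n i : ℕ} {st st' : State} {l : List Sym}
    (hE : ∀ v, E.card v ≤ w.length + 1 → v ≤ w.length + 1 → 0 < E.card v →
      I .card v (E.card v) (E.card v) → I .choice v (E.val v) (E.val v))
    (hi : i ≤ w.length) (hl : w.drop i = l) (hk : I.Knows w E i st)
    (hp : E.Path n (w.length + 1) st l st' []) : I.Knows w E w.length st' := by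
  generalize hl' : ([] : List Sym) = l' at hp
  induction hp generalizing i with
  | refl =>
    subst hl'
    have := List.drop_eq_nil_iff.1 hl
    rwa [show w.length = i by omega]
  | @step st c l _ _ hg _ ih =>
    have hlt : i < w.length := by
      by_contra hc
      rw [List.drop_eq_nil_of_le (not_lt.1 hc)] at hl
      simp at hl
    exact ih hlt (by rw [← List.tail_drop, hl]; rfl) (h.knows_step hE hl hk hg) hl'

/-- If `y ≥ x` held, `le` would be forced digit by digit up to `w.length + 1`. The size bounds make
the residues there the registers themselves, and the rule with empty head applies. -/
theorem lt_of_knows (h : I.Describes w) {E : Env} {st : State} (hk : I.Knows w E w.length st) (hm : st.mode = .scope)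
    (hx : st.x < 2 ^ (w.length + 1)) (hy : st.y < 2 ^ (w.length + 1)) : st.y < st.x := by
  have hr : ∀ b, ∀ r ∈ Pred.compareRules b, r ∈ Pred.rules :=
    fun b r hr => Pred.mem_rules.2
      (Or.inr (Or.inr (Or.inr (Or.inr (Or.inr (Or.inr (Or.inr ⟨b, hr⟩)))))))
  have hmode := hk.mode
  rw [hm] at hmode
  by_contra! hle
  have : ∀ j ≤ w.length + 1, st.x % 2 ^ j ≤ st.y % 2 ^ j → I .le j j j := by
    intro j hj hxy
    induction j with
    | zero => exact (h.rule (hr true _ (.head _)) [0] (by simp) h.first).resolve_right id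
    | succ j ih =>
      have hbx := hk.bit .x j (by omega)
      have hby := hk.bit .y j (by omega)
      have hn := h.next j (by omega)
      have := Nat.mod_lt st.x (Nat.two_pow_pos j)
      have := Nat.mod_lt st.y (Nat.two_pow_pos j)
      simp only [State.reg] at hbx hby
      rw [mod_two_pow_succ, mod_two_pow_succ] at hxy
      by_cases he : st.x.testBit j = st.y.testBit j
      · rw [he] at hbx hxy
        exact (h.rule (hr _ _ (.tail _ (.head _))) [w.length + 1, j, j + 1] (by simp; omega) h.last hn
          (ih (by omega) (by omega)) hbx hby).resolve_right id
      -- If the leading digits differ, an inequality of the residues leaves only this possibility,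
      -- and the lower digits no longer matter.
      · have hb : st.x.testBit j = false ∧ st.y.testBit j = true := by
          cases hb : st.x.testBit j <;> cases hb' : st.y.testBit j <;> simp_all
          omega
        rw [hb.1] at hbx
        rw [hb.2] at hby
        exact (h.rule (hr true _ (.tail _ (.tail _ (.head _)))) [w.length + 1, j, j + 1]
          (by simp; omega) h.last hn hbx hby).resolve_right id
  have hle' := this _ le_rfl (by rwa [Nat.mod_eq_of_lt hx, Nat.mod_eq_of_lt hy])
  exact h.rule (hr true _ (.tail _ (.tail _ (.tail _ (.head _))))) [w.length + 1] (by simp) h.last hmode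
    hle'

end Interp.Describes

end FactorModel

namespace FactorModel

/-! ### The description of a scan -/

/-- The interpretation of the predicates by a scan. -/
def Env.interp (E : Env) (n : ℕ) (w : List Sym) : Interp
  | .first, a, _, _ => a = 0
  | .last, a, _, _ => a = w.length + 1
  | .next, a, b, _ => b = a + 1
  | .sym s, p, _, _ => 0 < p ∧ w[p - 1]? = some s
  | .plus, a, b, c => a + b = c
  | .times, a, b, c => a * b = c
  | .num, p, k, _ => numAt (w.drop (p - 1)) = k
  | .mode M, p, _, _ => (E.run .start w (p - 1)).mode = M
  | .inst M s z, p, _, _ => 0 < p ∧ w[p - 1]? = some s ∧ (E.run .start w (p - 1)).mode = M ∧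
      z = decide ((E.run .start w (p - 1)).target = 0)
  | .stride, p, u, _ => (E.run .start w (p - 1)).stride = u
  | .target, p, u, _ => (E.run .start w (p - 1)).target = u
  | .card, v, c, _ => v < n ∧ E.card v = c
  | .choice, v, a, _ => E.val v = a
  | .free, v, a, _ => a ≤ E.val v
  | .bit r b, p, j, _ => ((E.run .start w (p - 1)).reg r).testBit j = b
  | .carry b, p, j, _ => carryBit (E.run .start w (p - 1)).a (E.run .start w (p - 1)).s j = b
  | .le, j, _, _ => (E.run .start w w.length).x % 2 ^ j ≤ (E.run .start w w.length).y % 2 ^ j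

theorem drop_eq_cons {w : List Sym} {i : ℕ} {s : Sym} (h : w[i]? = some s) :
    w.drop i = s :: w.drop (i + 1) := by
  obtain ⟨hi, rfl⟩ := List.getElem?_eq_some_iff.1 h
  exact List.drop_eq_getElem_cons hi

/-- A successful scan is described by its interpretation. -/
theorem Env.Path.describes {E : Env} {n B : ℕ} {w : List Sym} {st : State}
    (hp : E.Path n B .start w st []) (hE : ∀ v < n, E.val v < E.card v)
    (hst : st.mode = .scope → st.y < st.x) : (E.interp n w).Describes w := by
  have hrun := hp.run_length
  refine ⟨rfl, rfl, fun a _ => rfl, fun j s hj => ⟨by omega, hj⟩, fun r hr v _ => ?_⟩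
  -- A true `inst` atom pins down symbol, mode and zero test, so the next state is the result of
  -- that instruction.
  have hinst : ∀ {M s z p q}, (E.interp n w) (.inst M s z) p p p → (E.interp n w) .next p q q →
      w.drop (p - 1) = s :: w.drop p ∧
      E.run .start w (q - 1) = E.step (E.run .start w (p - 1)) s (w.drop p) ∧
      (E.run .start w (p - 1)).instr s = instr M s z := by
    rintro M s z p q ⟨h₁, h₂, rfl, rfl⟩ rfl
    have h₃ := drop_eq_cons h₂
    rw [Nat.sub_add_cancel h₁] at h₃
    refine ⟨h₃, ?_, rfl⟩
    rw [← Env.run_succ h₃, Nat.sub_add_cancel h₁]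
    rfl
  rcases Pred.mem_rules.1 hr with hr | ⟨s, hr⟩ | ⟨x, y, c, hr⟩ | ⟨g, hr⟩ | ⟨M, s, hr⟩ |
    ⟨M, s, z, g, x, y, c, hr⟩ | hr | ⟨b, hr⟩
  · simp only [Pred.arithRules, List.mem_cons, List.not_mem_nil, or_false] at hr
    rcases hr with rfl | rfl | rfl | rfl <;>
      simp only [Rule.Sat, List.foldr_cons, List.foldr_nil, Atom.Sat, Pred.un, Pred.bin, Pred.tri,
        Env.interp, or_false]
    · intro h; omega
    · intro h₁ h₂ h₃; omega
    · intro h; rw [h, mul_zero]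
    · intro h₁ h₂ h₃; rw [h₃, Nat.mul_succ, h₁, h₂]
  · have key : ∀ {p q : ℕ} {b : Bool}, 0 < p ∧ w[p - 1]? = some (.bit b) → q = p + 1 →
        numAt (w.drop (p - 1)) = 2 * numAt (w.drop (q - 1)) + b.toNat := by
      rintro p q b ⟨h₁, h₂⟩ rfl
      rw [drop_eq_cons h₂, numAt, Nat.sub_add_cancel h₁, Nat.add_sub_cancel]
    have key' : ∀ {p : ℕ} {s : Sym}, 0 < p ∧ w[p - 1]? = some s → (∀ b, s ≠ .bit b) →
        numAt (w.drop (p - 1)) = 0 := by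
      rintro p s ⟨h₁, h₂⟩ hs
      rw [drop_eq_cons h₂]
      cases s with
      | bit b => exact absurd rfl (hs b)
      | _ => rfl
    rcases s with _ | (_ | _) | _ | _ | _ | _ <;>
      simp only [Pred.numRules, List.mem_cons, List.not_mem_nil, or_false] at hr <;> subst hr <;>
      simp only [Rule.Sat, List.foldr_cons, List.foldr_nil, Atom.Sat, Pred.un, Pred.bin, Pred.tri,
        Env.interp, or_false]
    · intro h₁ h₂
      rw [h₁, h₂, Nat.add_sub_cancel, List.drop_length]
      rfl
    · intro h₁ h₂ h₃ h₄
      rw [key h₁ h₂, h₃, ← h₄, Bool.toNat_false, two_mul, add_zero]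
    · intro h₁ h₂ h₃ h₄ h₅
      rw [key h₁ h₂, h₃, h₅, ← h₄, Bool.toNat_true, two_mul]
    all_goals
      intro h₁ h₂
      rw [key' h₁ (by simp), h₂]
  · simp only [Pred.carryRules, List.mem_cons, List.not_mem_nil, or_false] at hr
    rcases hr with rfl | rfl <;>
      simp only [Rule.Sat, List.foldr_cons, List.foldr_nil, Atom.Sat, Pred.un, Pred.bin,
        Env.interp, or_false]
    · intro h; rw [h, carryBit_zero]
    · intro h₁ h₂ h₃ h₄
      rw [h₄, carryBit_succ, h₃, ← h₁, ← h₂]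
      rfl
  · simp only [Pred.initRules, List.mem_cons, List.not_mem_nil, or_false] at hr
    have h0 : ∀ {z q : ℕ}, z = 0 → q = z + 1 → E.run .start w (q - 1) = .start := by
      rintro z q rfl rfl
      rw [zero_add, Nat.sub_self, Env.run_zero]
    rcases hr with rfl | rfl | rfl | rfl | rfl <;>
      simp only [Rule.Sat, List.foldr_cons, List.foldr_nil, Atom.Sat, Pred.un, Pred.bin,
        Env.interp, or_false] <;> intro h₁ h₂ <;> rw [h0 h₁ h₂]
    · rfl
    · exact h₁.symm
    · exact h₁.symm
    · rw [h₁]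
      cases g <;> rfl
    · intro h₃
      rw [h₃]
      cases g <;> simp [State.start, State.reg, Nat.testBit_add_one]
  · simp only [Pred.fetchRules, List.mem_append, List.mem_cons, List.not_mem_nil, or_false] at hr
    rcases hr with (rfl | rfl) | hr
    · simp only [Rule.Sat, List.foldr_cons, List.foldr_nil, Atom.Sat, Pred.un, Pred.bin,
        Env.interp, or_false]
      intro h₁ h₂ h₃ h₄
      exact ⟨h₂.1, h₂.2, h₁, by simp [h₃, h₄]⟩
    · simp only [Rule.Sat, List.foldr_cons, List.foldr_nil, Atom.Sat, Pred.un, Pred.bin,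
        Env.interp, or_false]
      intro h₁ h₂ h₃ h₄
      exact ⟨h₂.1, h₂.2, h₁, by simp [h₃, h₄]⟩
    · split at hr
      · rename_i b
        rw [List.mem_singleton] at hr
        subst hr
        simp only [Rule.Sat, List.foldr_cons, List.foldr_nil, Atom.Sat, Pred.un, Pred.bin,
          Env.interp, or_false]
        intro h₁ h₂ h₃ h₄
        have h₅ := drop_eq_cons h₂.2
        -- Good steps guarantee that the cardinality read from the string is the one of the
        -- environment, for a variable below `n`.
        obtain ⟨g₁, g₂, g₃⟩ := (hp.good h₅).card h₁ ⟨b, rfl⟩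
        rw [← h₅, h₄] at g₃
        rw [← h₃, g₁]
        exact ⟨g₂, g₃⟩
      · simp at hr
  · simp only [Pred.instRules, List.mem_append, List.mem_singleton] at hr
    rcases hr with ((rfl | hr) | hr) | hr
    · intro h₁ h₂
      obtain ⟨e₁, e₂, e₃⟩ := hinst h₁ h₂
      exact Or.inl ((congrArg State.mode e₂).trans (congrArg Instr.mode e₃))
    · have key : ∀ {p q j : ℕ}, (E.interp n w) (.inst M s z) p p p → (E.interp n w) .next p q q →
          (E.interp n w) (.bit g ((((instr M s z).reg.src g).eval (E.run .start w (p - 1))).testBit j))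
            q j j := by
        intro p q j h₁ h₂
        obtain ⟨e₁, e₂, e₃⟩ := hinst h₁ h₂
        change ((E.run .start w _).reg g).testBit j = _
        rw [e₂, Env.reg_step, e₃]
      generalize (instr M s z).reg.src g = src at hr key
      cases src <;> simp only [Pred.srcRules, List.mem_cons, List.not_mem_nil, or_false] at hr
      · subst hr
        intro h₁ h₂ h₃
        exact Or.inl ((key h₁ h₂).trans h₃)
      · subst hr
        intro h₁ h₂
        exact Or.inl ((key h₁ h₂).trans (by simp [Src.eval]))
      · rcases hr with rfl | rfl
        · intro h₁ h₂ h₃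
          change v 2 = 0 at h₃
          exact Or.inl ((key h₁ h₂).trans (by simp [Src.eval, Pred.bin, h₃]))
        · intro h₁ h₂ h₃ h₄
          change v 3 = v 2 + 1 at h₄
          refine Or.inl ((key h₁ h₂).trans (Eq.trans ?_ h₃))
          simp only [Pred.bin, h₄, Src.eval, State.reg]
          rw [Nat.testBit_add_one, Nat.mul_div_cancel_left _ two_pos]
          rfl
      · subst hr
        intro h₁ h₂ h₃ h₄ h₅
        refine Or.inl ((key h₁ h₂).trans ?_)
        rw [Src.eval, testBit_add_eq, ← h₃, ← h₄, ← h₅]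
        rfl
    · have key : ∀ {p q : ℕ}, (E.interp n w) (.inst M s z) p p p → (E.interp n w) .next p q q →
          (E.run .start w (q - 1)).stride =
            (instr M s z).stride.eval E (E.run .start w (p - 1)) (w.drop (p - 1)) := by
        intro p q h₁ h₂
        obtain ⟨e₁, e₂, e₃⟩ := hinst h₁ h₂
        rw [e₂, e₁, ← e₃]
        rfl
      generalize (instr M s z).stride = op at hr key
      cases op <;> simp only [Pred.strideRules, List.mem_cons, List.not_mem_nil, or_false] at hr <;>
        subst hr <;> intro h₁ h₂
      · exact fun h₃ => Or.inl ((key h₁ h₂).trans h₃)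
      · intro h₃ h₄
        change v 2 = 0 at h₃
        change v 3 = v 2 + 1 at h₄
        refine Or.inl ((key h₁ h₂).trans ?_)
        simp [StrideOp.eval, Pred.bin, h₃, h₄]
      · intro h₃ h₄
        refine Or.inl ((key h₁ h₂).trans ?_)
        change v 3 = v 2 + 1 at h₄
        change (E.run .start w (v 0 - 1)).stride = v 2 at h₃
        simp only [StrideOp.eval, Pred.un, Pred.bin, h₃, h₄]
      · intro h₃ h₄ h₅ h₆
        refine Or.inl ((key h₁ h₂).trans ?_)
        change numAt (w.drop (v 0 - 1)) = v 2 at h₃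
        change v 2 < n ∧ E.card (v 2) = v 3 at h₄
        change (E.run .start w (v 0 - 1)).stride = v 4 at h₅
        simp only [StrideOp.eval, Pred.un, Pred.bin, h₃, h₄.2, h₅]
        exact h₆
    · have key : ∀ {p q : ℕ}, (E.interp n w) (.inst M s z) p p p → (E.interp n w) .next p q q →
          (E.run .start w (q - 1)).target =
            (instr M s z).target.eval E (E.run .start w (p - 1)) (w.drop (p - 1)) := by
        intro p q h₁ h₂
        obtain ⟨e₁, e₂, e₃⟩ := hinst h₁ h₂
        rw [e₂, e₁, ← e₃]
        rfl
      generalize (instr M s z).target = op at hr key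
      cases op <;> simp only [Pred.targetRules, List.mem_cons, List.not_mem_nil, or_false] at hr <;>
        subst hr <;> intro h₁ h₂
      · exact fun h₃ => Or.inl ((key h₁ h₂).trans h₃)
      · intro h₃ h₄
        refine Or.inl ((key h₁ h₂).trans ?_)
        change v 2 = v 3 + 1 at h₄
        change (E.run .start w (v 0 - 1)).target = v 2 at h₃
        simp only [TargetOp.eval, Pred.un, Pred.bin, h₃, h₄, Nat.add_sub_cancel]
      · intro h₃ h₄ h₅ h₆ h₇ h₈
        refine Or.inl ((key h₁ h₂).trans ?_)
        change numAt (w.drop (v 0 - 1)) = v 2 at h₃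
        change E.val (v 2) = v 3 at h₄
        change (E.run .start w (v 0 - 1)).stride = v 4 at h₅
        change v 4 * v 3 = v 5 at h₆
        change (E.run .start w (v 0 - 1)).target = v 6 at h₇
        simp only [TargetOp.eval, Pred.un, Pred.bin, h₃, h₄, h₅, h₆, h₇]
        exact h₈
  · simp only [Pred.choiceRules, List.mem_cons, List.not_mem_nil, or_false] at hr
    rcases hr with rfl | rfl | rfl <;>
      simp only [Rule.Sat, List.foldr_cons, List.foldr_nil, Atom.Sat, Pred.un, Pred.bin,
        Env.interp, or_false]
    · intro h; omega
    · intro h₁ h₂; omega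
    · rintro ⟨h₁, h₂⟩ h₃
      have := hE _ h₁
      omega
  · simp only [Pred.compareRules, List.mem_cons, List.not_mem_nil, or_false] at hr
    rcases hr with rfl | rfl | rfl | rfl <;>
      simp only [Rule.Sat, List.foldr_cons, List.foldr_nil, Atom.Sat, Pred.un, Pred.bin,
        Env.interp, or_false]
    · intro h; rw [h]; simp [Nat.mod_one]
    · intro h₁ h₂ h₃ h₄ h₅
      rw [h₁, Nat.add_sub_cancel] at h₄ h₅
      simp only [State.reg] at h₄ h₅
      rw [h₂, mod_two_pow_succ, mod_two_pow_succ, h₄, h₅]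
      omega
    · intro h₁ h₂ h₃ h₄
      rw [h₁, Nat.add_sub_cancel] at h₃ h₄
      simp only [State.reg] at h₃ h₄
      rw [h₂, mod_two_pow_succ, mod_two_pow_succ, h₃, h₄]
      have := Nat.mod_lt (E.run .start w w.length).x (Nat.two_pow_pos (v 1))
      simp only [Bool.toNat_false, Bool.toNat_true]
      omega
    · intro h₁ h₂ h₃
      rw [h₁, Nat.add_sub_cancel, hrun] at h₂
      -- The residues modulo `2 ^ (w.length + 1)` are the registers themselves, so `le` at the last
      -- position would contradict `y < x`.
      obtain ⟨hx, hy⟩ := Env.reg_run_le (E := E) w w.length (st := .start) (k := 0) (by simp [State.start])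
        (by simp [State.start]) (by simp [State.start]) (by simp [State.start])
      have := hst h₂
      rw [h₁, hrun] at h₃
      rw [hrun, zero_add] at hx hy
      have hlt : 2 ^ w.length < 2 ^ (w.length + 1) := Nat.pow_lt_pow_right (by omega) (by omega)
      rw [Nat.mod_eq_of_lt (by omega), Nat.mod_eq_of_lt (by omega)] at h₃
      omega

/-- D-MPE is described by the scans. -/
theorem dmpe_iff_describes (Q : Query) : DMPE Q ↔ ∃ I : Interp, I.Describes Q.encode := by
  constructor
  · rintro ⟨x, hx⟩
    have hE : ∀ v < Q.model.numVars, (Q.model.env x).val v < (Q.model.env x).card v :=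
      fun v hv => Q.model.env_val_lt x hv
    by_cases hk : 0 ≤ Q.k
    · obtain ⟨st, -, h₂, h₃⟩ := Q.exists_path hk x (B := Q.encode.length + 1) (by omega)
      exact ⟨_, h₃.describes hE fun _ => h₂.2 hx⟩
    · obtain ⟨st, h₁, h₂⟩ := Env.Path.dead (E := Q.model.env x) (n := Q.model.numVars) (B := 0)
        (not_le.1 hk) (Sym.semi ::
          (encList encNat (List.ofFn Q.model.card) ++ Q.model.factors.flatMap Factor.encode))
      exact ⟨_, h₂.describes hE fun h => by simp [h₁] at h⟩
  · rintro ⟨I, hI⟩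
    classical
    by_cases hk : 0 ≤ Q.k
    -- The instantiation is read off from `choice`; the default 0 is never relevant for a variable
    -- whose cardinality is known in `I`.
    · let x : Instantiation Q.model.card := fun v =>
        if h : ∃ a : Fin (Q.model.card v), I .choice v a a then h.choose else ⟨0, Q.model.card_pos v⟩
      obtain ⟨st, h₁, h₂, h₃⟩ := Q.exists_path hk x (B := Q.encode.length + 1) (by omega)
      refine ⟨x, h₂.1 ?_⟩
      have hknows := hI.knows_of_path (i := 0) ?_ (by omega) List.drop_zero
        (hI.knows_init _) h₃
      · obtain ⟨hx, hy⟩ := Env.reg_run_le (E := Q.model.env x) Q.encode Q.encode.length (st := .start)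
          (k := 0) (by simp [State.start]) (by simp [State.start]) (by simp [State.start])
          (by simp [State.start])
        rw [h₃.run_length, zero_add] at hx hy
        have hlt : 2 ^ Q.encode.length < 2 ^ (Q.encode.length + 1) :=
          Nat.pow_lt_pow_right (by omega) (by omega)
        exact hI.lt_of_knows hknows h₁ (hx.trans_lt hlt) (hy.trans_lt hlt)
      · intro v hc hv hpos hcard
        -- Outside the model the environment has cardinality 0.
        have hv' : v < Q.model.numVars := by
          by_contra hv'
          simp [Model.env, hv'] at hpos
        obtain ⟨a, ha, ha'⟩ := hI.exists_choice (by omega) (by omega) hcard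
        rw [Q.model.env_card x ⟨v, hv'⟩] at ha
        have hex : ∃ a : Fin (Q.model.card ⟨v, hv'⟩), I .choice v a a := ⟨⟨a, ha⟩, ha'⟩
        rw [Q.model.env_val x ⟨v, hv'⟩]
        simp only [x, dif_pos hex]
        exact hex.choose_spec
    -- For a negative threshold any instantiation works, since the joint factor is nonnegative.
    · refine ⟨fun v => ⟨0, Q.model.card_pos v⟩, lt_of_lt_of_le (not_le.1 hk) (NNRat.coe_nonneg _)⟩

end FactorModel

theorem mainTheorem9 :
    ∃ r : FactorModel.Query → FactorModel.Query,
      FactorModel.IsPolyTimeReduction FactorModel.Query.encode FactorModel.Query.encode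
          FactorModel.DMPE FactorModel.DPR r ∧
        ∀ Q : FactorModel.Query, (r Q).model.IsCNF ∧ (r Q).k = 0 := by
  obtain ⟨r, hr, h⟩ := FactorModel.scanTheory.exists_reduction FactorModel.Query.encode (by norm_num)
  refine ⟨r, ⟨hr, fun Q => ?_⟩, fun Q => (h Q).1⟩
  rw [(h Q).2, FactorModel.exists_structure_iff, FactorModel.dmpe_iff_describes]
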